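/- Let $\mathcal{O}$ be a regular local ring of dimension $3$ and let $E$ be a finitely generated reflexive $\mathcal{O}$-module which is not free. Let $I\subset\mathcal{O}$ be the ideal of a regular curve, i.e. $\mathcal{O}/I$ is a regular (local) ring of dimension $1$, and let $f:X=\operatorname{Proj}\bigl(\bigoplus_{n\ge 0}I^n\bigr)\to\operatorname{Spec}\mathcal{O}$ be the blow-up of $\operatorname{Spec}\mathcal{O}$ along $V(I)$. Write $E^\vee=\operatorname{Hom}_{\mathcal{O}}(E,\mathcal{O})$ and $(f^*E)^\vee=\mathcal{H}om_{\mathcal{O}_X}(f^*E,\mathcal{O}_X)$. Then the sheaf $\mathcal{E}xt^1_{\mathcal{O}_X}((f^*E)^\vee,\mathcal{O}_X)$ is supported at closed points of $X$, the $\mathcal{O}$-module $\operatorname{Ext}^1_{\mathcal{O}}(E^\vee,\mathcal{O})$ has finite length, and $$\ell\bigl(\mathcal{E}xt^1_{\mathcal{O}_X}((f^*E)^\vee,\mathcal{O}_X)\bigr)<\ell\bigl(\operatorname{Ext}^1_{\mathcal{O}}(E^\vee,\mathcal{O})\bigr),$$ where $\ell$ denotes the length of $\mathcal{O}$-modules;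 for the sheaf on the left it is the length over $\mathcal{O}$ of its module of global sections. -/

import Mathlib

open CategoryTheory Limits Opposite TopologicalSpace AlgebraicGeometry

universe u

namespace BlowUpExt

section Rees

open Polynomial

/-- The degree `n` part `I ^ n t ^ n` of the Rees algebra `⨁ I ^ n t ^ n ⊆ R[t]`. -/
noncomputable def reesGrading {R : Type u} [CommRing R] (I : Ideal R) (n : ℕ) : Submodule R (reesAlgebra I) :=
  (LinearMap.range (monomial n : R →ₗ[R] R[X])).comap (reesAlgebra I).val.toLinearMap

theorem mem_reesGrading {R : Type u} [CommRing R] (I : Ideal R) (n : ℕ) (f : reesAlgebra I) :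
    f ∈ reesGrading I n ↔ monomial n ((f : R[X]).coeff n) = (f : R[X]) := by
  constructor
  · rintro ⟨r, hr⟩
    change monomial n r = (f : R[X]) at hr
    rw [← hr]; simp
  · intro h
    exact ⟨_, h⟩

/-- The degree `n` component of an element of the Rees algebra. -/
noncomputable def reesComponent {R : Type u} [CommRing R] (I : Ideal R) (f : reesAlgebra I) (n : ℕ) :
    reesGrading I n :=
  ⟨⟨monomial n ((f : R[X]).coeff n), reesAlgebra.monomial_mem.2 (f.2 n)⟩, ⟨_, rfl⟩⟩

instance reesGradedMonoid {R : Type u} [CommRing R] (I : Ideal R) :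
    SetLike.GradedMonoid (reesGrading I) where
  one_mem := ⟨1, rfl⟩
  mul_mem := by
    rintro i j f g ⟨r, hr⟩ ⟨s, hs⟩
    refine ⟨r * s, ?_⟩
    change monomial i r = (f : R[X]) at hr
    change monomial j s = (g : R[X]) at hs
    change monomial (i + j) (r * s) = (f : R[X]) * (g : R[X])
    rw [← hr, ← hs, monomial_mul_monomial]

theorem coeff_coe_reesGrading {R : Type u} [CommRing R] (I : Ideal R)
    (y : DirectSum ℕ fun n => reesGrading I n) (n : ℕ) :
    ((DirectSum.coeAddMonoidHom (reesGrading I) y : reesAlgebra I) : R[X]).coeff n =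
      ((y n : reesAlgebra I) : R[X]).coeff n := by
  classical
  induction y using DirectSum.induction_on with
  | zero => simp
  | of i x =>
    rw [DirectSum.coeAddMonoidHom_of]
    by_cases h : i = n
    · subst h; simp
    · rw [DirectSum.of_eq_of_ne _ _ _ (Ne.symm h), ← (mem_reesGrading I i x).1 x.2]
      simp [coeff_monomial, h]
  | add y z hy hz => simp [hy, hz]

noncomputable instance reesGradedAlgebra {R : Type u} [CommRing R] (I : Ideal R) :
    GradedAlgebra (reesGrading I) where
  decompose' f := DirectSum.mk _ (f : R[X]).support fun n => reesComponent I f n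
  left_inv f := by
    apply Subtype.ext
    ext n
    rw [coeff_coe_reesGrading]
    by_cases h : n ∈ (f : R[X]).support
    · rw [DirectSum.mk_apply_of_mem h]; simp [reesComponent]
    · rw [DirectSum.mk_apply_of_notMem h]; simpa using (notMem_support_iff.1 h).symm
  right_inv y := by
    refine DFinsupp.ext fun n => Subtype.ext (Subtype.ext ?_)
    set f := DirectSum.coeAddMonoidHom (reesGrading I) y with hf
    have h1 := coeff_coe_reesGrading I y n
    rw [← hf] at h1
    have h2 := (mem_reesGrading I n _).1 (y n).2
    by_cases h : n ∈ (f : R[X]).support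
    · erw [DirectSum.mk_apply_of_mem h]
      rw [← h2, ← h1]; rfl
    · erw [DirectSum.mk_apply_of_notMem h]
      rw [← h2, ← h1, notMem_support_iff.1 h]; simp

/-- The blow-up of `Spec R` along the closed subscheme `V(I)`: the scheme `Proj (⨁ I ^ n)`. -/
noncomputable def blowUp {R : Type u} [CommRing R] (I : Ideal R) : Scheme.{u} :=
  Proj (reesGrading I)

/-- The structure morphism of the blow-up of `Spec R` along `V(I)`. -/
noncomputable def blowUpMap {R : Type u} [CommRing R] (I : Ideal R) :
    blowUp I ⟶ Spec (.of R) :=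
  Proj.toSpecZero (reesGrading I) ≫
    Spec.map (CommRingCat.ofHom (algebraMap R (reesGrading I 0)))

end Rees

section EnoughInjectives

theorem presheafOfModules_exactColimits {C : Type u} [SmallCategory C] (R : Cᵒᵖ ⥤ RingCat.{u})
    (J : Type u) [SmallCategory J] [IsFiltered J] :
    HasExactColimitsOfShape J (PresheafOfModules.{u} R) := by
  have : ReflectsFiniteLimits (PresheafOfModules.toPresheaf.{u} R) :=
    { reflects := fun _ _ _ => inferInstance }
  exact HasExactColimitsOfShape.domain_of_functor J (PresheafOfModules.toPresheaf.{u} R)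

theorem sheafOfModules_exactColimits (X : Scheme.{u})
    (J : Type u) [SmallCategory J] [IsFiltered J] :
    HasExactColimitsOfShape J X.Modules := by
  have := presheafOfModules_exactColimits X.ringCatSheaf.obj J
  let adj := PresheafOfModules.sheafificationAdjunction (𝟙 X.ringCatSheaf.obj)
  exact Adjunction.hasExactColimitsOfShape (D := SheafOfModules.{u} X.ringCatSheaf) adj J

theorem isSeparator_of_adjunction {C D : Type*} [Category C] [Category D] {F : C ⥤ D} {G : D ⥤ C} (adj : F ⊣ G)
    [G.Faithful] {P : C} (hP : IsSeparator P) : IsSeparator (F.obj P) := by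
  rw [isSeparator_def] at hP ⊢
  intro A B f g h
  refine G.map_injective (hP _ _ fun k => ?_)
  have h2 := h ((adj.homEquiv _ _).symm k)
  rw [← Adjunction.homEquiv_naturality_right_symm, ← Adjunction.homEquiv_naturality_right_symm] at h2
  exact (adj.homEquiv _ _).symm.injective h2

theorem modules_hasSeparator (X : Scheme.{u}) : HasSeparator X.Modules := by
  have hs := (PresheafOfModules.freeYoneda.isSeparating X.ringCatSheaf.obj)
  let adj := PresheafOfModules.sheafificationAdjunction (𝟙 X.ringCatSheaf.obj)
  exact ⟨_, isSeparator_of_adjunction (D := SheafOfModules.{u} X.ringCatSheaf) adj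
    (ObjectProperty.IsSeparating.isSeparator_coproduct hs)⟩

/-- The category of `𝒪_X`-modules is a Grothendieck abelian category; in particular it has
enough injectives. -/
instance (X : Scheme.{u}) : IsGrothendieckAbelian.{u} X.Modules where
  ab5OfSize := ⟨fun J _ _ => sheafOfModules_exactColimits X J⟩
  hasSeparator := modules_hasSeparator X

end EnoughInjectives

section SheafHom

variable {X : Scheme.{u}}

/-- The group of `𝒪_U`-linear morphisms `M|_U ⟶ N|_U`: families of `Γ(X, V)`-linear maps
`Γ(M, V) → Γ(N, V)`, for all opens `V ≤ U`, which are compatible with the restriction maps. -/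
noncomputable def localHom (M N : X.Modules) (U : X.Opens) :
    AddSubgroup (∀ V : {V : X.Opens // V ≤ U}, Γ(M, V.1) →ₗ[Γ(X, V.1)] Γ(N, V.1)) where
  carrier := {φ | ∀ (V W : {V : X.Opens // V ≤ U}) (h : W.1 ≤ V.1) (m : Γ(M, V.1)),
    N.presheaf.map (homOfLE h).op (φ V m) = φ W (M.presheaf.map (homOfLE h).op m)}
  zero_mem' V W h m := by simp
  add_mem' {φ ψ} hφ hψ V W h m := by simp [hφ V W h m, hψ V W h m]
  neg_mem' {φ} hφ V W h m := by simp [hφ V W h m]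

/-- `Γ(X, U)` acts on morphisms `M|_U ⟶ N|_U` by multiplication on the values. -/
noncomputable instance (M N : X.Modules) (U : X.Opens) : Module Γ(X, U) (localHom M N U) where
  smul r φ := ⟨fun V => X.presheaf.map (homOfLE V.2).op r • φ.1 V, fun V W h m => by
    have h1 := φ.2 V W h m
    have h2 : X.presheaf.map (homOfLE h).op (X.presheaf.map (homOfLE V.2).op r) =
        X.presheaf.map (homOfLE W.2).op r := by
      rw [← ConcreteCategory.comp_apply, ← X.presheaf.map_comp]; rfl
    rw [LinearMap.smul_apply, LinearMap.smul_apply, Scheme.Modules.map_smul, h1, h2]⟩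
  one_smul φ := Subtype.ext <| funext fun V => by
    change X.presheaf.map (homOfLE V.2).op 1 • φ.1 V = φ.1 V
    rw [map_one, one_smul]
  mul_smul r s φ := Subtype.ext <| funext fun V => by
    change X.presheaf.map (homOfLE V.2).op (r * s) • φ.1 V = X.presheaf.map (homOfLE V.2).op r •
      X.presheaf.map (homOfLE V.2).op s • φ.1 V
    rw [map_mul, mul_smul]
  smul_zero r := Subtype.ext <| funext fun V => by
    change X.presheaf.map (homOfLE V.2).op r • (0 : Γ(M, V.1) →ₗ[Γ(X, V.1)] Γ(N, V.1)) = 0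
    rw [smul_zero]
  smul_add r φ ψ := Subtype.ext <| funext fun V => by
    change X.presheaf.map (homOfLE V.2).op r • (φ.1 V + ψ.1 V) = X.presheaf.map (homOfLE V.2).op r •
      φ.1 V + X.presheaf.map (homOfLE V.2).op r • ψ.1 V
    rw [smul_add]
  add_smul r s φ := Subtype.ext <| funext fun V => by
    change X.presheaf.map (homOfLE V.2).op (r + s) • φ.1 V = X.presheaf.map (homOfLE V.2).op r •
      φ.1 V + X.presheaf.map (homOfLE V.2).op s • φ.1 V
    rw [map_add, add_smul]
  zero_smul φ := Subtype.ext <| funext fun V => by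
    change X.presheaf.map (homOfLE V.2).op 0 • φ.1 V = 0
    rw [map_zero, zero_smul]

theorem localHom_smul_apply (M N : X.Modules) (U : X.Opens) (r : Γ(X, U)) (φ : localHom M N U)
    (V : {V : X.Opens // V ≤ U}) (m : Γ(M, V.1)) :
    (r • φ).1 V m = X.presheaf.map (homOfLE V.2).op r • φ.1 V m := rfl

/-- Restriction of morphisms `M|_U ⟶ N|_U` to a smaller open subset. -/
noncomputable def localHomRes (M N : X.Modules) {U U' : X.Opens} (h : U' ≤ U) :
    localHom M N U →+ localHom M N U' where
  toFun φ := ⟨fun V => φ.1 ⟨V.1, V.2.trans h⟩, fun V W h' m => φ.2 ⟨V.1, V.2.trans h⟩ ⟨W.1, _⟩ h' m⟩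
  map_zero' := rfl
  map_add' _ _ := rfl

/-- The presheaf `U ↦ Hom(M|_U, N|_U)` of abelian groups. -/
noncomputable def localHomPresheaf (M N : X.Modules) : TopCat.Presheaf Ab.{u} X where
  obj U := .of (localHom M N U.unop)
  map i := AddCommGrpCat.ofHom (localHomRes M N i.unop.le)
  map_id _ := rfl
  map_comp _ _ := rfl

noncomputable instance (M N : X.Modules) (U : X.Opensᵒᵖ) :
    Module (X.ringCatSheaf.obj.obj U) ((localHomPresheaf M N).obj U) :=
  inferInstanceAs (Module Γ(X, U.unop) (localHom M N U.unop))

/-- The presheaf of `𝒪_X`-modules `U ↦ Hom(M|_U, N|_U)`. -/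
noncomputable def sheafHomPre (M N : X.Modules) : X.PresheafOfModules :=
  PresheafOfModules.ofPresheaf (localHomPresheaf M N) (by
    intro U V f (r : Γ(X, U.unop)) φ
    refine Subtype.ext <| funext fun W => LinearMap.ext fun m => ?_
    change X.presheaf.map (homOfLE (W.2.trans f.unop.le)).op r •
        φ.1 ⟨W.1, W.2.trans f.unop.le⟩ m =
      X.presheaf.map (homOfLE W.2).op (X.presheaf.map f r) •
        φ.1 ⟨W.1, W.2.trans f.unop.le⟩ m
    have h : X.presheaf.map (homOfLE W.2).op (X.presheaf.map f r) =
        X.presheaf.map (homOfLE (W.2.trans f.unop.le)).op r := by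
      rw [← ConcreteCategory.comp_apply, ← X.presheaf.map_comp]; rfl
    exact congrArg (fun s : Γ(X, W.1) => s • φ.1 ⟨W.1, W.2.trans f.unop.le⟩ m) h.symm)

theorem modules_res_res (M : X.Modules) {U V W : X.Opens} (i : V ≤ U) (j : W ≤ V) (m : Γ(M, U)) :
    M.presheaf.map (homOfLE j).op (M.presheaf.map (homOfLE i).op m) =
      M.presheaf.map (homOfLE (j.trans i)).op m := by
  rw [← ConcreteCategory.comp_apply, ← M.presheaf.map_comp]; rfl

theorem localHom_ext_of_cover (M N : X.Modules) {ι : Type u} (U : ι → X.Opens)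
    (φ ψ : localHom M N (iSup U))
    (h : ∀ i, localHomRes M N (le_iSup U i) φ = localHomRes M N (le_iSup U i) ψ) : φ = ψ := by
  refine Subtype.ext <| funext fun V => LinearMap.ext fun m => ?_
  refine TopCat.Sheaf.eq_of_locally_eq' ⟨N.presheaf, N.isSheaf⟩ (fun i => U i ⊓ V.1) V.1
    (fun i => homOfLE inf_le_right) ?_ _ _ fun i => ?_
  · rw [← iSup_inf_eq]; exact le_inf V.2 le_rfl
  · have hV : U i ⊓ V.1 ≤ iSup U := inf_le_right.trans V.2
    have h1 := φ.2 V ⟨U i ⊓ V.1, hV⟩ inf_le_right m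
    have h2 := ψ.2 V ⟨U i ⊓ V.1, hV⟩ inf_le_right m
    refine h1.trans (Eq.trans ?_ h2.symm)
    exact LinearMap.congr_fun (congrFun (congrArg Subtype.val (h i)) ⟨U i ⊓ V.1, inf_le_left⟩) _

theorem localHom_exists_glue (M N : X.Modules) {ι : Type u} (U : ι → X.Opens)
    (sf : ∀ i, localHom M N (U i))
    (h : ∀ i j, localHomRes M N (inf_le_left : U i ⊓ U j ≤ U i) (sf i) =
      localHomRes M N (inf_le_right : U i ⊓ U j ≤ U j) (sf j)) :
    ∃ φ : localHom M N (iSup U), ∀ i, localHomRes M N (le_iSup U i) φ = sf i := by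
  have key : ∀ (V : {V : X.Opens // V ≤ iSup U}) (m : Γ(M, V.1)), ∃! n : Γ(N, V.1),
      ∀ i, N.presheaf.map (homOfLE (inf_le_right : U i ⊓ V.1 ≤ V.1)).op n =
        (sf i).1 ⟨U i ⊓ V.1, inf_le_left⟩
          (M.presheaf.map (homOfLE (inf_le_right : U i ⊓ V.1 ≤ V.1)).op m) := by
    intro V m
    refine TopCat.Sheaf.existsUnique_gluing' ⟨N.presheaf, N.isSheaf⟩ (fun i => U i ⊓ V.1) V.1
      (fun i => homOfLE inf_le_right) ?_ (fun i => (sf i).1 ⟨U i ⊓ V.1, inf_le_left⟩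
          (M.presheaf.map (homOfLE (inf_le_right : U i ⊓ V.1 ≤ V.1)).op m)) fun i j => ?_
    · rw [← iSup_inf_eq]; exact le_inf V.2 le_rfl
    · have hW : (U i ⊓ V.1) ⊓ (U j ⊓ V.1) ≤ U i ⊓ U j := inf_le_inf inf_le_left inf_le_left
      have h1 := (sf i).2 ⟨U i ⊓ V.1, inf_le_left⟩
        ⟨(U i ⊓ V.1) ⊓ (U j ⊓ V.1), hW.trans inf_le_left⟩ inf_le_left
        (M.presheaf.map (homOfLE (inf_le_right : U i ⊓ V.1 ≤ V.1)).op m)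
      have h2 := (sf j).2 ⟨U j ⊓ V.1, inf_le_left⟩
        ⟨(U i ⊓ V.1) ⊓ (U j ⊓ V.1), hW.trans inf_le_right⟩ inf_le_right
        (M.presheaf.map (homOfLE (inf_le_right : U j ⊓ V.1 ≤ V.1)).op m)
      refine h1.trans (Eq.trans ?_ h2.symm)
      rw [modules_res_res, modules_res_res]
      exact LinearMap.congr_fun (congrFun (congrArg Subtype.val (h i j)) ⟨_, hW⟩) _
  choose f hf hu using key
  refine ⟨⟨fun V => { toFun := f V, map_add' := ?_, map_smul' := ?_ }, ?_⟩, ?_⟩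
  · intro m m'
    refine (hu V (m + m') _ fun i => ?_).symm
    rw [map_add, map_add, map_add, hf, hf]
  · intro r m
    refine (hu V (r • m) _ fun i => ?_).symm
    rw [RingHom.id_apply, Scheme.Modules.map_smul, Scheme.Modules.map_smul, map_smul, hf]
  · intro V W hWV m
    change N.presheaf.map (homOfLE hWV).op (f V m) = f W (M.presheaf.map (homOfLE hWV).op m)
    refine hu W _ _ fun i => ?_
    have h1 : U i ⊓ W.1 ≤ U i ⊓ V.1 := inf_le_inf_left _ hWV
    have h2 := (sf i).2 ⟨U i ⊓ V.1, inf_le_left⟩ ⟨U i ⊓ W.1, inf_le_left⟩ h1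
      (M.presheaf.map (homOfLE (inf_le_right : U i ⊓ V.1 ≤ V.1)).op m)
    rw [← hf V m i, modules_res_res, modules_res_res] at h2
    rw [modules_res_res, modules_res_res]
    exact h2
  · intro i
    refine Subtype.ext <| funext fun V => LinearMap.ext fun m => ?_
    change f ⟨V.1, _⟩ m = (sf i).1 V m
    refine (hu ⟨V.1, V.2.trans (le_iSup U i)⟩ m _ fun j => ?_).symm
    have h1 := (sf i).2 V ⟨U j ⊓ V.1, inf_le_right.trans V.2⟩ inf_le_right m
    refine h1.trans ?_
    exact LinearMap.congr_fun (congrFun (congrArg Subtype.val (h i j))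
      ⟨U j ⊓ V.1, le_inf (inf_le_right.trans V.2) inf_le_left⟩) _

/-- The sheaf of homomorphisms `ℋom(M, N)`, an `𝒪_X`-module. -/
noncomputable def sheafHomObj (M N : X.Modules) : X.Modules where
  val := sheafHomPre M N
  isSheaf := by
    refine (TopCat.Presheaf.isSheaf_iff_isSheafUniqueGluing (localHomPresheaf M N)).2 ?_
    intro ι U sf hsf
    obtain ⟨φ, hφ⟩ := localHom_exists_glue M N U sf hsf
    exact ⟨φ, hφ, fun ψ hψ => localHom_ext_of_cover M N U ψ φ fun i => (hψ i).trans (hφ i).symm⟩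

/-- The functor `ℋom(M, -)` on `𝒪_X`-modules. -/
noncomputable def sheafHom (M : X.Modules) : X.Modules ⥤ X.Modules where
  obj N := sheafHomObj M N
  map {N N'} g := ⟨PresheafOfModules.homMk (M₁ := sheafHomPre M N) (M₂ := sheafHomPre M N')
    { app U := AddCommGrpCat.ofHom
        { toFun φ := ⟨fun V =>
            { toFun m := g.app V.1 (φ.1 V m)
              map_add' _ _ := by rw [map_add, map_add]
              map_smul' _ _ := by rw [map_smul, Scheme.Modules.Hom.app_smul, RingHom.id_apply] }, by
            intro V W h m
            have h1 := φ.2 V W h m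
            have h2 := ConcreteCategory.congr_hom (g.mapPresheaf.naturality (homOfLE h).op) (φ.1 V m)
            exact h2.symm.trans (congrArg (g.app W.1) h1)⟩
          map_zero' := Subtype.ext <| funext fun V => LinearMap.ext fun m => map_zero (g.app V.1).hom
          map_add' φ ψ := Subtype.ext <| funext fun V => LinearMap.ext fun m =>
            map_add (g.app V.1).hom _ _ }
      naturality _ _ _ := rfl }
    (by
      intro U r φ
      refine Subtype.ext <| funext fun V => LinearMap.ext fun m => ?_
      exact Scheme.Modules.Hom.app_smul g _ _)⟩
  map_id _ := rfl
  map_comp _ _ := rfl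

instance (M : X.Modules) : (sheafHom M).Additive where
  map_add := rfl

/-- The structure sheaf `𝒪_X` as a module over itself. -/
noncomputable def structureModule (X : Scheme.{u}) : X.Modules :=
  SheafOfModules.unit X.ringCatSheaf

/-- The dual `M^∨ = ℋom(M, 𝒪_X)`. -/
noncomputable def dual (M : X.Modules) : X.Modules :=
  (sheafHom M).obj (structureModule X)

/-- The sheaf `ℰxt^n(M, N)`: the `n`-th right derived functor of `ℋom(M, -)` applied to `N`. -/
noncomputable def sheafExt (n : ℕ) (M N : X.Modules) : X.Modules :=
  ((sheafHom M).rightDerived n).obj N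

/-- All points in the support of `M` are closed, i.e. the support has dimension at most `0`. -/
def SupportedAtClosedPoints (M : X.Modules) : Prop :=
  ∀ x : X, Nontrivial (M.presheaf.stalk x) → IsClosed ({x} : Set X)

/-- The length over `R` of the global sections of an `𝒪_X`-module, for `f : X ⟶ Spec R`.
(The global sections of `M` are those of `f_* M` on `Spec R`.) -/
noncomputable def sectionsLength {R : Type u} [CommRing R] (f : X ⟶ Spec (.of R))
    (M : X.Modules) : ℕ∞ :=
  Module.length R ((moduleSpecΓFunctor (R := .of R)).obj ((Scheme.Modules.pushforward f).obj M))

/-- For `f : X ⟶ Spec R` the blow-up along `V(I)`, the sheaf `ℰxt^1((f^* E)^∨, 𝒪_X)` on `X`. -/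
noncomputable def blowUpExt {R : Type u} [CommRing R] (I : Ideal R)
    (E : Type u) [AddCommGroup E] [Module R E] : (blowUp I).Modules :=
  sheafExt 1
    (dual ((Scheme.Modules.pullback (blowUpMap I)).obj
      (tilde (R := .of R) (ModuleCat.of R E))))
    (structureModule (blowUp I))

end SheafHom

end BlowUpExt

/-! Choose a regular system of parameters `x, y, z` with `I = (x, y)`, and let `m` be the maximal
ideal. Duals inherit depth two from the ring, so the dual of `E` has a resolution `0 → R^a → R^b →
E^∨ → 0` with matrix `α`, and `Ext¹(E^∨, R)` is the cokernel of the transpose `αᵀ`. At a prime other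
than `m` the local ring has dimension at most two, so depth forces `α` to split there. Hence some `m
^ N` kills the cokernel, which has finite length.

The blow-up `X` is covered by the chart with ring `A = R[T]/(xT - y)` and the chart with `x` and `y`
exchanged. In the first chart `mA = (x, z)` is a prime ideal generated by a regular pair, and `A/mA
= k[T]`: the closed fibre has codimension two. Write `F = (f^* E)^∨`, and let `G ⊆ F` be generated
by the sections coming from generators of `E^∨`. Reflexivity of `E` shows that `m ^ N` kills `F/G`,
and the relations of `G` are locally the columns of `α`. Since `x ^ N, z ^ N` is a regular pair,
`ℰxt¹(F/G, 𝒪) = 0`, so `ℰxt¹(F, 𝒪)` embeds into `ℰxt¹(G, 𝒪)`, the cokernel of `αᵀ` on `X`. `Rel` is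
this embedding, written as a relation between sections and vectors of functions; `Rel.eq_zero` is
its injectivity.

A Čech computation with the two charts gives `H⁰(X, 𝒪) = R` and `H¹(X, 𝒪) = 0`
(`IsBlowUpCover.exists_const`, `IsBlowUpCover.exists_add`). So every global section of `ℰxt¹(F, 𝒪)`
is represented by a vector over `R`, and the global sections are a quotient of a submodule `Q` of
`Ext¹(E^∨, R)`.

The inequality is strict because `Q` is a proper submodule. At the generic point of the closed fibre
the local ring is regular of dimension two, so `F` is free and `ℰxt¹` vanishes
(`IsChart.exists_res_eq_zero`). If `Q` were everything, `αᵀ` would be surjective at that point. But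
`E` is not free, so `α` is not injective modulo `m`, and `αᵀ` is not surjective there.

For the support, `αᵀ` is surjective off the closed fibre, and the vanishing at the generic point of
the fibre leaves only closed points. -/

namespace BlowUpExt

/-! ### Regular systems of parameters and prime ideals generated by them -/

section RegularParameters

open IsLocalRing

section Domain

theorem le_ringKrullDim_quotient {R : Type*} [CommRing R] [IsLocalRing R] [IsNoetherianRing R]
    {n : ℕ} {y : R} (hy : y ∈ maximalIdeal R) (hn : ((n + 1 : ℕ) : WithBot ℕ∞) ≤ ringKrullDim R) :
    (n : WithBot ℕ∞) ≤ ringKrullDim (R ⧸ Ideal.span {y}) := by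
  have h := hn.trans (ringKrullDim_le_ringKrullDim_quotient_add_encard (R := R) {y} (by
    rw [Set.singleton_subset_iff, IsLocalRing.ringJacobson_eq_maximalIdeal]; exact hy))
  rw [Set.encard_singleton] at h
  push_cast at h
  exact ENat.WithBot.add_le_add_one_right_iff.1 h

theorem maximalIdeal_quotient_span {R : Type*} [CommRing R] [IsLocalRing R] {y : R}
    [IsLocalRing (R ⧸ Ideal.span {y})] {s : Set R}
    (h : maximalIdeal R = Ideal.span (insert y s)) :
    maximalIdeal (R ⧸ Ideal.span {y}) = Ideal.span (Ideal.Quotient.mk (Ideal.span {y}) '' s) := by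
  rw [← IsLocalRing.map_maximalIdeal_of_surjective _ Ideal.Quotient.mk_surjective, h, Ideal.map_span,
    Set.image_insert_eq]
  have : Ideal.Quotient.mk (Ideal.span {y}) y = 0 :=
    Ideal.Quotient.eq_zero_iff_mem.2 (Ideal.mem_span_singleton_self y)
  rw [this, Ideal.span_insert_zero]

/-- A minimal prime `p` inside `(y)` does not contain `y`, so every element of `p` is `y` times an
element of `p`. Nakayama gives `p = 0`. -/
theorem isDomain_of_isPrime_span_singleton {R : Type*} [CommRing R] [IsLocalRing R]
    [IsNoetherianRing R] {y : R} (hp : (Ideal.span {y}).IsPrime)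
    (hmin : Ideal.span {y} ∉ minimalPrimes R) : IsDomain R := by
  obtain ⟨p, hp', hle⟩ := Ideal.exists_minimalPrimes_le (bot_le : ⊥ ≤ Ideal.span {y})
  have : p.IsPrime := hp'.1.1
  have hy : y ∉ p := fun h => hmin (by
    have : p = Ideal.span {y} := le_antisymm hle (by rwa [Ideal.span_singleton_le_iff_mem])
    rwa [← this])
  have hbot : p = ⊥ := by
    refine Submodule.eq_bot_of_le_smul_of_le_jacobson_bot (Ideal.span {y}) p
      (IsNoetherian.noetherian p) (fun a ha => ?_) ?_
    · obtain ⟨c, rfl⟩ := Ideal.mem_span_singleton.1 (hle ha)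
      exact Ideal.mul_mem_mul (Ideal.mem_span_singleton_self y)
        ((this.mem_or_mem ha).resolve_left hy)
    · rw [IsLocalRing.jacobson_eq_maximalIdeal _ bot_ne_top]
      exact IsLocalRing.le_maximalIdeal hp.ne_top
  have : (⊥ : Ideal R).IsPrime := hbot ▸ this
  exact IsDomain.of_bot_isPrime R

/-- Regular local rings are domains. By induction, each member `y` of a minimal generating system of
the maximal ideal generates a prime ideal. It remains to find such a `y` for which `(y)` is not a
minimal prime. -/
theorem isDomain_of_maximalIdeal_eq_span (n : ℕ) : ∀ {R : Type u} [CommRing R] [IsLocalRing R]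
    [IsNoetherianRing R] (x : Fin n → R) (_ : maximalIdeal R = Ideal.span (Set.range x))
    (_ : (n : WithBot ℕ∞) ≤ ringKrullDim R), IsDomain R := by
  induction n with
  | zero =>
    intro R _ _ _ x hx _
    have h : maximalIdeal R = ⊥ := by rw [hx, Set.range_eq_empty, Ideal.span_empty]
    exact (IsLocalRing.isField_iff_maximalIdeal_eq.2 h).isDomain
  | succ n ih =>
    intro R _ _ _ x hx hn
    have hprime : ∀ (y : R) (f : Fin n → R), maximalIdeal R = Ideal.span (insert y (Set.range f)) →
        (Ideal.span {y}).IsPrime := by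
      intro y f hy
      have hym : y ∈ maximalIdeal R := hy ▸ Ideal.subset_span (Set.mem_insert _ _)
      have : Nontrivial (R ⧸ Ideal.span {y}) := Ideal.Quotient.nontrivial_iff.2 (by
        rw [Ne, Ideal.span_singleton_eq_top]; exact hym)
      have : IsLocalRing (R ⧸ Ideal.span {y}) :=
        IsLocalRing.of_surjective' _ Ideal.Quotient.mk_surjective
      rw [← Ideal.Quotient.isDomain_iff_prime]
      refine ih (Ideal.Quotient.mk _ ∘ f) ?_ (le_ringKrullDim_quotient hym hn)
      rw [maximalIdeal_quotient_span hy, Set.range_comp]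
    suffices h : ∃ (y : R) (f : Fin n → R), maximalIdeal R = Ideal.span (insert y (Set.range f)) ∧
        Ideal.span {y} ∉ minimalPrimes R by
      obtain ⟨y, f, h1, h2⟩ := h
      exact isDomain_of_isPrime_span_singleton (hprime y f h1) h2
    rcases n with - | n
    · have h0 : maximalIdeal R = Ideal.span (insert (x 0) (Set.range (![] : Fin 0 → R))) := by
        rw [hx, Set.range_eq_empty (![] : Fin 0 → R)]
        congr 1
        ext a
        simp [Fin.exists_fin_one, eq_comm]
      refine ⟨x 0, ![], h0, fun hmin => ?_⟩
      have h1 : Ideal.span {x 0} = maximalIdeal R := by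
        rw [h0, Set.range_eq_empty (![] : Fin 0 → R)]; simp
      rw [h1] at hmin
      have h2 : (maximalIdeal R).height = 0 := by rwa [Ideal.height_eq_zero_iff]
      rw [← IsLocalRing.maximalIdeal_height_eq_ringKrullDim, h2] at hn
      norm_num at hn
    · obtain ⟨a, b, f, rfl⟩ : ∃ a b f, x = Fin.cons a (Fin.cons b f) :=
        ⟨x 0, x 1, fun i => x i.succ.succ, by
          funext i
          refine Fin.cases rfl (fun i => ?_) i
          refine Fin.cases rfl (fun i => rfl) i⟩
      rw [Fin.range_cons, Fin.range_cons] at hx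
      have hspan : ∀ k : ℕ, maximalIdeal R =
          Ideal.span (insert (a + b ^ (k + 1)) (Set.range (Fin.cons b f : Fin (n + 1) → R))) := by
        intro k
        rw [hx, Fin.range_cons]
        have hb : ∀ c : R, b ^ (k + 1) ∈ Ideal.span (insert c (insert b (Set.range f))) := fun c =>
          Ideal.pow_mem_of_mem _ (Ideal.subset_span (by simp)) _ (by simp)
        apply le_antisymm <;> rw [Ideal.span_le, Set.insert_subset_iff]
        · refine ⟨?_, (Set.subset_insert _ _).trans Ideal.subset_span⟩
          have := sub_mem (Ideal.subset_span (Set.mem_insert (a + b ^ (k + 1)) _))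
            (hb (a + b ^ (k + 1)))
          rwa [add_sub_cancel_right] at this
        · exact ⟨add_mem (Ideal.subset_span (Set.mem_insert _ _)) (hb a),
            (Set.subset_insert _ _).trans Ideal.subset_span⟩
      -- Otherwise all the elements `a + b ^ (k + 1)` generate minimal primes. There are only
      -- finitely many of these, so two of the elements generate the same prime.
      by_contra hcon
      push Not at hcon
      have hmin : ∀ k, Ideal.span {a + b ^ (k + 1)} ∈ minimalPrimes R := fun k =>
        hcon _ _ (hspan k)
      have : Finite (minimalPrimes R) := Ideal.finite_minimalPrimes_of_isNoetherianRing R ⊥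
      obtain ⟨k, l, hkl, h⟩ := Finite.exists_ne_map_eq_of_infinite
        (fun k : ℕ => (⟨_, hmin k⟩ : minimalPrimes R))
      wlog hlt : k < l generalizing k l
      · exact this l k hkl.symm h.symm (lt_of_le_of_ne (not_lt.1 hlt) hkl.symm)
      have h1 : Ideal.span {a + b ^ (k + 1)} = Ideal.span {a + b ^ (l + 1)} :=
        congrArg Subtype.val h
      set p := Ideal.span {a + b ^ (k + 1)} with hp
      have hpp : p.IsPrime := hprime _ _ (hspan k)
      have hak : a + b ^ (k + 1) ∈ p := Ideal.mem_span_singleton_self _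
      have hal : a + b ^ (l + 1) ∈ p := h1 ▸ Ideal.mem_span_singleton_self _
      have hbm : b ∈ maximalIdeal R := hx ▸ Ideal.subset_span (by simp)
      -- The difference of the two generators is `b ^ (k + 1)` times the unit `1 - b ^ (d + 1)`.
      have hbp : b ^ (k + 1) ∈ p := by
        obtain ⟨d, rfl⟩ := Nat.exists_eq_add_of_lt hlt
        have h3 := sub_mem hak hal
        have h4 : a + b ^ (k + 1) - (a + b ^ (k + d + 1 + 1)) = b ^ (k + 1) * (1 - b ^ (d + 1)) := by
          ring
        rw [h4] at h3
        refine (hpp.mem_or_mem h3).resolve_right fun h5 => ?_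
        have h6 : b ^ (d + 1) ∈ maximalIdeal R := Ideal.pow_mem_of_mem _ hbm _ (by simp)
        have h7 := add_mem (IsLocalRing.le_maximalIdeal hpp.ne_top h5) h6
        rw [sub_add_cancel] at h7
        exact (Ideal.ne_top_iff_one _).1 (maximalIdeal.isMaximal R).ne_top h7
      have hb : b ∈ p := hpp.mem_of_pow_mem _ hbp
      have ham : a + b ^ (k + 1) ∈ maximalIdeal R :=
        hspan k ▸ Ideal.subset_span (Set.mem_insert _ _)
      have : IsLocalRing (R ⧸ p) := by
        have : Nontrivial (R ⧸ p) := Ideal.Quotient.nontrivial_iff.2 hpp.ne_top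
        exact IsLocalRing.of_surjective' _ Ideal.Quotient.mk_surjective
      have h8 : maximalIdeal (R ⧸ p) = Ideal.span (Set.range (Ideal.Quotient.mk p ∘ f)) := by
        have := maximalIdeal_quotient_span (hspan k)
        rw [this, Fin.range_cons, Set.image_insert_eq, Set.range_comp,
          Ideal.Quotient.eq_zero_iff_mem.2 hb, Ideal.span_insert_zero]
      -- Both `a` and `b` vanish modulo `p`, so `n` elements generate the maximal ideal of a
      -- quotient whose dimension is at least `n + 1`.
      have h9 := (le_ringKrullDim_quotient ham hn).trans
        (ringKrullDim_le_spanFinrank_maximalIdeal (R ⧸ p))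
      have h10 : (maximalIdeal (R ⧸ p)).spanFinrank ≤ n := by
        rw [h8]
        refine (Submodule.spanFinrank_span_le_ncard_of_finite (Set.finite_range _)).trans ?_
        rw [← Set.image_univ]
        refine (Set.ncard_image_le Set.finite_univ).trans ?_
        simp [Set.ncard_univ]
      have h11 : n + 1 ≤ (maximalIdeal (R ⧸ p)).spanFinrank := by exact_mod_cast h9
      omega

theorem isPrime_span_of_maximalIdeal_eq_span {R : Type u} [CommRing R] [IsLocalRing R]
    [IsNoetherianRing R] {n k : ℕ} {s : Set R} (hs : s.encard ≤ k) (x : Fin n → R)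
    (hx : maximalIdeal R = Ideal.span (s ∪ Set.range x))
    (hd : ((n + k : ℕ) : WithBot ℕ∞) ≤ ringKrullDim R) :
    (Ideal.span s).IsPrime ∧ (n : WithBot ℕ∞) ≤ ringKrullDim (R ⧸ Ideal.span s) := by
  have hsm : s ⊆ maximalIdeal R := by
    rw [hx]; exact Set.subset_union_left.trans Ideal.subset_span
  have hn : (n : WithBot ℕ∞) ≤ ringKrullDim (R ⧸ Ideal.span s) := by
    have h := hd.trans (ringKrullDim_le_ringKrullDim_quotient_add_encard s (by
      rwa [IsLocalRing.ringJacobson_eq_maximalIdeal]))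
    have h' : (s.encard : WithBot ℕ∞) ≤ (k : ℕ∞) := by exact_mod_cast hs
    have h2 := h.trans (add_le_add_right h' _)
    push_cast at h2
    exact ENat.WithBot.add_le_add_natCast_right_iff.1 h2
  refine ⟨?_, hn⟩
  have : Nontrivial (R ⧸ Ideal.span s) := Ideal.Quotient.nontrivial_iff.2 fun h => by
    have := Ideal.span_le.2 hsm
    rw [h, top_le_iff] at this
    exact (maximalIdeal.isMaximal R).ne_top this
  have : IsLocalRing (R ⧸ Ideal.span s) :=
    IsLocalRing.of_surjective' _ Ideal.Quotient.mk_surjective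
  rw [← Ideal.Quotient.isDomain_iff_prime]
  refine isDomain_of_maximalIdeal_eq_span n (Ideal.Quotient.mk _ ∘ x) ?_ hn
  rw [← IsLocalRing.map_maximalIdeal_of_surjective _ Ideal.Quotient.mk_surjective, hx, Ideal.span_union,
    Ideal.map_sup, Ideal.map_quotient_self, bot_sup_eq, Ideal.map_span, Set.range_comp]

theorem encard_pair_le {α : Type*} (a b : α) : ({a, b} : Set α).encard ≤ 2 := by
  refine (Set.encard_insert_le _ _).trans ?_
  rw [Set.encard_singleton]
  norm_num

theorem le_encard_of_maximalIdeal_eq_span {R : Type u} [CommRing R] [IsLocalRing R]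
    [IsNoetherianRing R] {n : ℕ} (hd : (n : WithBot ℕ∞) ≤ ringKrullDim R) {s : Set R}
    (hs : maximalIdeal R = Ideal.span s) : (n : ℕ∞) ≤ s.encard := by
  have h1 := hd.trans (ringKrullDim_le_spanFinrank_maximalIdeal R)
  have h2 : ((maximalIdeal R).spanFinrank : ℕ∞) ≤ s.encard := by
    rw [hs]; exact Submodule.spanFinrank_span_le_encard s
  exact le_trans (by exact_mod_cast h1) h2

end Domain

/-- `r` is a nonzerodivisor and `t` is a nonzerodivisor modulo `r`. -/
structure RegPair {A : Type*} [CommRing A] (r t : A) : Prop where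
  left (c : A) (h : r * c = 0) : c = 0
  right (c e : A) (h : t * c = r * e) : ∃ c', c = r * c'

/-- A regular system of parameters `x, y, z` of a three-dimensional local ring. -/
structure IsParams {R : Type u} [CommRing R] [IsLocalRing R] (x y z : R) : Prop where
  isDomain : IsDomain R
  span_eq : maximalIdeal R = Ideal.span {x, y, z}
  isPrime_x : (Ideal.span {x}).IsPrime
  isPrime_xy : (Ideal.span {x, y}).IsPrime
  y_notMem : y ∉ Ideal.span {x}
  z_notMem : z ∉ Ideal.span {x, y}

section Params

variable {R : Type u} [CommRing R] [IsLocalRing R] [IsNoetherianRing R]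

/-- The two non-membership conditions hold because the maximal ideal of a ring of dimension three
cannot be generated by two elements. -/
theorem isParams_of_span_eq (hd : (3 : WithBot ℕ∞) ≤ ringKrullDim R) {x y z : R}
    (h : maximalIdeal R = Ideal.span {x, y, z}) : IsParams x y z := by
  have hcard : ∀ {s : Set R} {a b : R}, s ⊆ {a, b} → maximalIdeal R ≠ Ideal.span s := by
    intro s a b hs h
    have h1 := le_encard_of_maximalIdeal_eq_span (n := 3) (by exact_mod_cast hd) h
    have h2 : s.encard ≤ 2 := (Set.encard_le_encard hs).trans (encard_pair_le a b)
    exact absurd (h1.trans h2) (by norm_num)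
  refine ⟨?_, h, ?_, ?_, fun hy => ?_, fun hz => ?_⟩
  · refine isDomain_of_maximalIdeal_eq_span 3 ![x, y, z] ?_ (by exact_mod_cast hd)
    rw [h]
    congr 1
    ext t
    simp [Matrix.range_cons, Matrix.range_empty]
    tauto
  · refine (isPrime_span_of_maximalIdeal_eq_span (n := 2) (k := 1) (s := {x}) (by simp) ![y, z] ?_
      (by exact_mod_cast hd)).1
    rw [h]
    congr 1
    ext t
    simp [Matrix.range_cons, Matrix.range_empty]
    tauto
  · refine (isPrime_span_of_maximalIdeal_eq_span (n := 1) (k := 2) (s := {x, y})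
      (encard_pair_le x y) ![z] ?_ (by exact_mod_cast hd)).1
    rw [h]
    congr 1
    ext t
    simp [Matrix.range_cons, Matrix.range_empty]
    tauto
  · refine hcard (s := {x, z}) subset_rfl (h.trans (le_antisymm ?_ (Ideal.span_mono ?_)))
    · rw [Ideal.span_le]
      rintro t (rfl | rfl | rfl)
      · exact Ideal.subset_span (by simp)
      · exact Ideal.span_mono (by simp) hy
      · exact Ideal.subset_span (by simp)
    · rintro t (rfl | rfl) <;> simp
  · refine hcard (s := {x, y}) subset_rfl (h.trans (le_antisymm ?_ (Ideal.span_mono ?_)))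
    · rw [Ideal.span_le]
      rintro t (rfl | rfl | rfl)
      · exact Ideal.subset_span (by simp)
      · exact Ideal.subset_span (by simp)
      · exact hz
    · rintro t (rfl | rfl) <;> simp

/-- A regular curve is cut out by part of a regular system of parameters. A lift `z` of a
uniformizer of `R ⧸ I` can replace one of three generators of the maximal ideal, and the other two
can be moved into `I` by subtracting multiples of `z`. -/
theorem exists_params {R : Type u} [CommRing R] [IsRegularLocalRing R] (hR : ringKrullDim R = 3)
    (I : Ideal R) [IsRegularLocalRing (R ⧸ I)] (hI : ringKrullDim (R ⧸ I) = 1) :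
    ∃ x y z : R, I = Ideal.span {x, y} ∧ maximalIdeal R = Ideal.span {x, y, z} := by
  have hIm : I ≤ maximalIdeal R := IsLocalRing.le_maximalIdeal fun h => by
    have : Nontrivial (R ⧸ I) := inferInstance
    exact (Ideal.Quotient.nontrivial_iff.1 this) h
  have hIne : I ≠ maximalIdeal R := by
    rintro rfl
    have := ringKrullDim_eq_zero_of_isField
      ((Ideal.Quotient.maximal_ideal_iff_isField_quotient _).1 (maximalIdeal.isMaximal R))
    rw [hI] at this
    exact one_ne_zero this
  -- a lift `z` of a uniformizer
  obtain ⟨z, hz⟩ : ∃ z : R, maximalIdeal R = I ⊔ Ideal.span {z} := by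
    have h1 : (maximalIdeal (R ⧸ I)).spanFinrank = 1 := by
      have := IsRegularLocalRing.spanFinrank_maximalIdeal (R := R ⧸ I)
      rw [hI] at this
      exact_mod_cast this
    obtain ⟨⟨t, ht⟩, -⟩ := (Submodule.spanFinrank_eq_one_iff _).1 h1
    obtain ⟨z, rfl⟩ := Ideal.Quotient.mk_surjective t
    refine ⟨z, ?_⟩
    have h2 : (maximalIdeal R).map (Ideal.Quotient.mk I) = (Ideal.span {z}).map (Ideal.Quotient.mk I) := by
      rw [IsLocalRing.map_maximalIdeal_of_surjective _ Ideal.Quotient.mk_surjective, ht, Ideal.map_span,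
        Set.image_singleton]
    have h3 := congrArg (Ideal.comap (Ideal.Quotient.mk I)) h2
    rw [Ideal.comap_map_of_surjective _ Ideal.Quotient.mk_surjective,
      Ideal.comap_map_of_surjective _ Ideal.Quotient.mk_surjective, ← RingHom.ker_eq_comap_bot,
      Ideal.mk_ker, sup_eq_left.2 hIm] at h3
    rw [h3, sup_comm]
  have hzm : z ∈ maximalIdeal R := by
    rw [hz]; exact Ideal.mem_sup_right (Ideal.mem_span_singleton_self z)
  obtain ⟨a, ha⟩ : ∃ a : Fin 3 → R, maximalIdeal R = Ideal.span (Set.range a) := by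
    obtain ⟨s, hs, hsp⟩ := (IsNoetherian.noetherian (maximalIdeal R)).exists_span_finset_card_eq_spanFinrank
    have h1 : s.card = 3 := by
      have := IsRegularLocalRing.spanFinrank_maximalIdeal (R := R)
      rw [hR, ← hs] at this
      exact_mod_cast this
    refine ⟨fun i => (s.equivFinOfCardEq h1).symm i, ?_⟩
    rw [← hsp]
    congr 1
    ext t
    constructor
    · intro ht; exact ⟨s.equivFinOfCardEq h1 ⟨t, ht⟩, by simp⟩
    · rintro ⟨i, rfl⟩; exact ((s.equivFinOfCardEq h1).symm i).2
  have ham : ∀ i, a i ∈ maximalIdeal R := fun i => ha ▸ Ideal.subset_span ⟨i, rfl⟩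
  have h1 : ∀ i, ∃ u ∈ I, ∃ c, a i = u + c * z := by
    intro i
    have := ham i
    rw [hz] at this
    obtain ⟨u, hu, v, hv, h⟩ := Submodule.mem_sup.1 this
    obtain ⟨c, rfl⟩ := Ideal.mem_span_singleton'.1 hv
    exact ⟨u, hu, c, h.symm⟩
  choose u huI c hc using h1
  obtain ⟨r, hr⟩ : ∃ r : Fin 3 → R, ∑ i, r i * a i = z := by
    have := hzm
    rw [ha] at this
    exact (Ideal.mem_span_range_iff_exists_fun).1 this
  obtain ⟨i, hi⟩ : ∃ i, IsUnit (r i) := by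
    by_contra hcon
    push Not at hcon
    -- If no coefficient were a unit, `z` would lie in the square of the maximal ideal, and Nakayama
    -- would make `I` equal to the maximal ideal.
    refine hIne (le_antisymm hIm ?_)
    refine Submodule.le_of_le_smul_of_le_jacobson_bot (I := maximalIdeal R)
      (IsNoetherian.noetherian _) ?_ ?_
    · rw [IsLocalRing.jacobson_eq_maximalIdeal _ bot_ne_top]
    · have hz2 : z ∈ maximalIdeal R • maximalIdeal R := by
        rw [← hr]
        exact Ideal.sum_mem _ fun i _ => Ideal.mul_mem_mul ((mem_maximalIdeal _).2 (hcon i)) (ham i)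
      nth_rw 1 [hz]
      exact sup_le_sup_left (by rwa [Ideal.span_singleton_le_iff_mem]) _
  -- the remaining two generators
  obtain ⟨j, k, hjk⟩ : ∃ j k : Fin 3, ∀ l, l = i ∨ l = j ∨ l = k := by
    fin_cases i
    · exact ⟨1, 2, by decide⟩
    · exact ⟨0, 2, by decide⟩
    · exact ⟨0, 1, by decide⟩
  have hm : maximalIdeal R = Ideal.span {u j, u k, z} := by
    have hzs : z ∈ Ideal.span {u j, u k, z} := Ideal.subset_span (by simp)
    have hjs : a j ∈ Ideal.span {u j, u k, z} := by
      rw [hc j]; exact add_mem (Ideal.subset_span (by simp)) (Ideal.mul_mem_left _ _ hzs)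
    have hks : a k ∈ Ideal.span {u j, u k, z} := by
      rw [hc k]; exact add_mem (Ideal.subset_span (by simp)) (Ideal.mul_mem_left _ _ hzs)
    have hlt : ∀ l, l ≠ i → a l ∈ Ideal.span {u j, u k, z} := by
      intro l hl
      rcases hjk l with h | h | h
      · exact absurd h hl
      · rw [h]; exact hjs
      · rw [h]; exact hks
    have his : a i ∈ Ideal.span {u j, u k, z} := by
      rw [← Finset.add_sum_erase _ _ (Finset.mem_univ i)] at hr
      have h2 : r i * a i ∈ Ideal.span {u j, u k, z} := by
        rw [eq_sub_of_add_eq hr]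
        refine sub_mem hzs (Ideal.sum_mem _ fun l hl => Ideal.mul_mem_left _ _ (hlt l ?_))
        exact (Finset.mem_erase.1 hl).1
      exact (Ideal.unit_mul_mem_iff_mem _ hi).1 h2
    refine le_antisymm ?_ ?_
    · rw [ha, Ideal.span_le]
      rintro _ ⟨l, rfl⟩
      by_cases hl : l = i
      · rw [hl]; exact his
      · exact hlt l hl
    · rw [Ideal.span_le]
      rintro t (rfl | rfl | rfl)
      · exact hIm (huI j)
      · exact hIm (huI k)
      · exact hzm
  refine ⟨u j, u k, z, ?_, hm⟩
  have hp := isPrime_span_of_maximalIdeal_eq_span (n := 1) (k := 2) (s := {u j, u k})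
      (encard_pair_le _ _) ![z] (by
        rw [hm]
        congr 1
        ext t
        simp [Matrix.range_cons, Matrix.range_empty]
        tauto) (by rw [hR]; norm_num)
  have hle : Ideal.span {u j, u k} ≤ I := by
    rw [Ideal.span_le]
    rintro t (rfl | rfl) <;> exact huI _
  -- The quotient by the prime `(u j, u k)` has dimension at most one. An element of `I` outside
  -- this prime would be a nonzerodivisor there, and the dimension of `R ⧸ I` would drop below one.
  refine le_antisymm (fun t ht => ?_) hle
  by_contra hts
  have := hp.1
  have hdim : ringKrullDim (R ⧸ Ideal.span {u j, u k}) ≤ 1 := by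
    have : Nontrivial (R ⧸ Ideal.span {u j, u k}) :=
      Ideal.Quotient.nontrivial_iff.2 hp.1.ne_top
    have : IsLocalRing (R ⧸ Ideal.span {u j, u k}) :=
      IsLocalRing.of_surjective' _ Ideal.Quotient.mk_surjective
    refine (ringKrullDim_le_spanFinrank_maximalIdeal _).trans ?_
    have h2 : maximalIdeal (R ⧸ Ideal.span {u j, u k}) =
        Ideal.span {Ideal.Quotient.mk (Ideal.span {u j, u k}) z} := by
      rw [← IsLocalRing.map_maximalIdeal_of_surjective _ Ideal.Quotient.mk_surjective, hm]
      have : ({u j, u k, z} : Set R) = {u j, u k} ∪ {z} := by ext t; simp; tauto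
      rw [this, Ideal.span_union, Ideal.map_sup, Ideal.map_quotient_self, bot_sup_eq, Ideal.map_span,
        Set.image_singleton]
    have h3 : (maximalIdeal (R ⧸ Ideal.span {u j, u k})).spanFinrank ≤ 1 := by
      rw [h2]
      refine (Submodule.spanFinrank_span_le_ncard_of_finite (Set.finite_singleton _)).trans ?_
      simp
    exact_mod_cast h3
  have hnz : Ideal.Quotient.mk (Ideal.span {u j, u k}) t ∈
      nonZeroDivisors (R ⧸ Ideal.span {u j, u k}) := by
    rw [mem_nonZeroDivisors_iff_ne_zero, Ne, Ideal.Quotient.eq_zero_iff_mem]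
    exact hts
  have h4 := (ringKrullDim_quotient_succ_le_of_nonZeroDivisor hnz).trans hdim
  let q : ((R ⧸ Ideal.span {u j, u k}) ⧸ Ideal.span {Ideal.Quotient.mk (Ideal.span {u j, u k}) t}) →+*
      R ⧸ I := Ideal.Quotient.lift _ (Ideal.Quotient.factor hle) fun s hs => by
    obtain ⟨d, rfl⟩ := Ideal.mem_span_singleton.1 hs
    rw [map_mul, Ideal.Quotient.factor_mk, Ideal.Quotient.eq_zero_iff_mem.2 ht, zero_mul]
  have hq : Function.Surjective q := by
    intro s
    obtain ⟨s, rfl⟩ := Ideal.Quotient.mk_surjective s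
    exact ⟨Ideal.Quotient.mk _ (Ideal.Quotient.mk _ s), rfl⟩
  have h5 := ringKrullDim_le_of_surjective q hq
  rw [hI] at h5
  have h6 := (add_le_add_left h5 1).trans h4
  norm_num at h6

end Params

end RegularParameters

/-! ### Depth, freeness and splitting over local rings -/

section DepthAndFreeness

open IsLocalRing

section Depth

open RingTheory.Sequence

/-- A finite module over a Noetherian local ring is free if it admits a weakly regular sequence which
generates the maximal ideal. -/
theorem free_of_isWeaklyRegular (n : ℕ) : ∀ {L N : Type u} [CommRing L] [IsLocalRing L]
    [IsNoetherianRing L] [AddCommGroup N] [Module L N] [Module.Finite L N] (rs : List L)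
    (_ : rs.length = n) (_ : Ideal.ofList rs = maximalIdeal L) (_ : IsWeaklyRegular N rs),
    Module.Free L N := by
  induction n with
  | zero =>
    intro L N _ _ _ _ _ _ rs hl h _
    rw [List.length_eq_zero_iff] at hl
    subst hl
    rw [Ideal.ofList_nil] at h
    let : Field L := (IsLocalRing.isField_iff_maximalIdeal_eq.2 h.symm).toField
    exact Module.Free.of_divisionRing L N
  | succ n ih =>
    intro L N _ _ _ _ _ _ rs hl h hreg
    obtain ⟨r, rs, rfl⟩ := List.exists_cons_of_length_eq_add_one hl
    rw [isWeaklyRegular_cons_iff'] at hreg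
    have hr : r ∈ maximalIdeal L := h ▸ Ideal.subset_span (by simp)
    have : Nontrivial (L ⧸ Ideal.span {r}) := Ideal.Quotient.nontrivial_iff.2 (by
      rw [Ne, Ideal.span_singleton_eq_top]; exact hr)
    have : IsLocalRing (L ⧸ Ideal.span {r}) :=
      IsLocalRing.of_surjective' _ Ideal.Quotient.mk_surjective
    have : Module.Finite (L ⧸ Ideal.span {r}) (QuotSMulTop r N) :=
      Module.Finite.of_restrictScalars_finite L _ _
    have := Module.finitePresentation_of_finite L N
    rw [← Module.free_quotSMulTop_iff_free L N (x := r)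
      (by rwa [IsLocalRing.jacobson_eq_maximalIdeal _ bot_ne_top]) hreg.1]
    refine ih _ (by simpa using hl) ?_ hreg.2
    rw [← IsLocalRing.map_maximalIdeal_of_surjective _ Ideal.Quotient.mk_surjective, ← h,
      Ideal.ofList_cons, Ideal.map_sup, Ideal.map_quotient_self, bot_sup_eq, Ideal.map_ofList]

theorem isSMulRegular_quotSMulTop {L N : Type*} [CommRing L] [AddCommGroup N] [Module L N] {x y : L}
    (h : ∀ n n' : N, y • n = x • n' → ∃ n'', n = x • n'') : IsSMulRegular (QuotSMulTop x N) y := by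
  rw [isSMulRegular_iff_right_eq_zero_of_smul]
  intro q hq
  obtain ⟨n, rfl⟩ := Submodule.Quotient.mk_surjective _ q
  rw [← Submodule.Quotient.mk_smul, Submodule.Quotient.mk_eq_zero,
    Submodule.mem_smul_pointwise_iff_exists] at hq
  obtain ⟨n', -, hn'⟩ := hq
  obtain ⟨n'', rfl⟩ := h n n' hn'.symm
  rw [Submodule.Quotient.mk_eq_zero]
  exact Submodule.smul_mem_pointwise_smul _ _ _ trivial

theorem free_of_regular_pair {L N : Type u} [CommRing L] [IsLocalRing L]
    [IsNoetherianRing L] [AddCommGroup N] [Module L N] [Module.Finite L N] {x y : L}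
    (hm : maximalIdeal L = Ideal.span {x, y}) (hx : ∀ n : N, x • n = 0 → n = 0)
    (hy : ∀ n n' : N, y • n = x • n' → ∃ n'', n = x • n'') : Module.Free L N := by
  refine free_of_isWeaklyRegular 2 [x, y] rfl ?_ ?_
  · rw [hm]; simp [Ideal.ofList_cons, Ideal.span_insert]
  · refine .cons ?_ (.cons (isSMulRegular_quotSMulTop hy) (.nil _ _))
    rw [isSMulRegular_iff_right_eq_zero_of_smul]
    exact hx

theorem isWeaklyRegular_triple {L N : Type*} [CommRing L] [AddCommGroup N] [Module L N] {x y z : L}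
    (hx : ∀ n : N, x • n = 0 → n = 0)
    (hy : ∀ n n' : N, y • n = x • n' → ∃ n'', n = x • n'')
    (hz : ∀ n n₁ n₂ : N, z • n = x • n₁ + y • n₂ → ∃ m₁ m₂, n = x • m₁ + y • m₂) :
    IsWeaklyRegular N [x, y, z] := by
  refine .cons ?_ (.cons (isSMulRegular_quotSMulTop hy)
    (.cons (isSMulRegular_quotSMulTop fun q q' h => ?_) (.nil _ _)))
  · rw [isSMulRegular_iff_right_eq_zero_of_smul]
    exact hx
  · obtain ⟨n, rfl⟩ := Submodule.Quotient.mk_surjective _ q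
    obtain ⟨n₂, rfl⟩ := Submodule.Quotient.mk_surjective _ q'
    rw [← Submodule.Quotient.mk_smul, ← Submodule.Quotient.mk_smul, Submodule.Quotient.eq,
      Submodule.mem_smul_pointwise_iff_exists] at h
    obtain ⟨n₁, -, h⟩ := h
    obtain ⟨m₁, m₂, rfl⟩ := hz n n₁ n₂ (by rw [h, sub_add_cancel])
    refine ⟨Submodule.Quotient.mk m₂, ?_⟩
    rw [← Submodule.Quotient.mk_smul, Submodule.Quotient.eq, add_sub_cancel_right]
    exact Submodule.smul_mem_pointwise_smul _ _ _ trivial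

theorem free_of_regular_triple {L N : Type u} [CommRing L] [IsLocalRing L]
    [IsNoetherianRing L] [AddCommGroup N] [Module L N] [Module.Finite L N] {x y z : L}
    (hm : maximalIdeal L = Ideal.span {x, y, z}) (hx : ∀ n : N, x • n = 0 → n = 0)
    (hy : ∀ n n' : N, y • n = x • n' → ∃ n'', n = x • n'')
    (hz : ∀ n n₁ n₂ : N, z • n = x • n₁ + y • n₂ → ∃ m₁ m₂, n = x • m₁ + y • m₂) :
    Module.Free L N :=
  free_of_isWeaklyRegular 3 [x, y, z] rfl (by rw [hm]; simp [Ideal.ofList_cons, Ideal.span_insert])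
    (isWeaklyRegular_triple hx hy hz)

/-- If the maximal ideal consists of zero divisors on `L ⧸ q`, prime avoidance puts it inside one
associated prime. The element whose annihilator is that prime is the socle element. -/
theorem exists_socle {L : Type*} [CommRing L] [IsLocalRing L] [IsNoetherianRing L] (q : Ideal L)
    (h : ∀ t ∈ maximalIdeal L, ∃ c, c ∉ q ∧ t * c ∈ q) :
    ∃ s, s ∉ q ∧ ∀ t ∈ maximalIdeal L, t * s ∈ q := by
  have hsub : (maximalIdeal L : Set L) ⊆ ⋃ p ∈ associatedPrimes L (L ⧸ q), (p : Set L) := by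
    intro t ht
    rw [biUnion_associatedPrimes_eq_zero_divisors]
    obtain ⟨c, hc, htc⟩ := h t ht
    exact ⟨Ideal.Quotient.mk q c, mt Ideal.Quotient.eq_zero_iff_mem.1 hc,
      Ideal.Quotient.eq_zero_iff_mem.2 htc⟩
  obtain ⟨p, hp, hle⟩ := (Ideal.subset_union_prime_finite (associatedPrimes.finite L (L ⧸ q))
    (f := fun p => p) ⊥ ⊥ (fun p hp _ _ => hp.isPrime)).1 hsub
  have hpp : p.IsPrime := hp.isPrime
  obtain ⟨-, s, hs⟩ := isAssociatedPrime_iff.1 hp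
  obtain ⟨s, rfl⟩ := Ideal.Quotient.mk_surjective s
  refine ⟨s, fun hsq => hpp.ne_top ?_, fun t ht => ?_⟩
  · rw [hs, Ideal.eq_top_iff_one, Submodule.mem_colon_singleton, Submodule.mem_bot, one_smul]
    exact Ideal.Quotient.eq_zero_iff_mem.2 hsq
  · have := hle ht
    rw [hs, Submodule.mem_colon_singleton, Submodule.mem_bot] at this
    exact Ideal.Quotient.eq_zero_iff_mem.1 this

/-- This is depth at most dimension, made explicit: a maximal regular sequence has length 0, 1 or 2
and leaves a socle element in the quotient. If all three cases failed there would be a regular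
sequence of length three, against the bound on the dimension. -/
theorem exists_socle_of_ringKrullDim_le_two {L : Type*} [CommRing L] [IsLocalRing L]
    [IsNoetherianRing L] (hL : ringKrullDim L ≤ 2) :
    (∃ s : L, s ≠ 0 ∧ ∀ t ∈ maximalIdeal L, t * s = 0) ∨
    (∃ x : L, (∀ c, x * c = 0 → c = 0) ∧ ∃ s, (¬ ∃ c, s = x * c) ∧
      ∀ t ∈ maximalIdeal L, ∃ c, t * s = x * c) ∨
    ∃ x y : L, RegPair x y ∧ ∃ s, (¬ ∃ c d, s = x * c + y * d) ∧
      ∀ t ∈ maximalIdeal L, ∃ c d, t * s = x * c + y * d := by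
  by_cases hA : ∀ t ∈ maximalIdeal L, ∃ c, c ∉ (⊥ : Ideal L) ∧ t * c ∈ (⊥ : Ideal L)
  · exact Or.inl (exists_socle ⊥ hA)
  push Not at hA
  obtain ⟨x, hxm, hx⟩ := hA
  have hx' : ∀ c, x * c = 0 → c = 0 := fun c hc => by_contra fun h => hx c h hc
  by_cases hB : ∀ t ∈ maximalIdeal L, ∃ c, c ∉ Ideal.span {x} ∧ t * c ∈ Ideal.span {x}
  · obtain ⟨s, h1, h2⟩ := exists_socle _ hB
    exact Or.inr (Or.inl ⟨x, hx', s, fun h => h1 (Ideal.mem_span_singleton.2 h),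
      fun t ht => Ideal.mem_span_singleton.1 (h2 t ht)⟩)
  push Not at hB
  obtain ⟨y, hym, hy⟩ := hB
  have hxy : RegPair x y := ⟨hx', fun c e h => Ideal.mem_span_singleton.1
    (by_contra fun hc => hy c hc (Ideal.mem_span_singleton.2 ⟨e, h⟩))⟩
  have hmem : ∀ s, s ∈ Ideal.span {x, y} ↔ ∃ c d, s = x * c + y * d := by
    intro s
    rw [Ideal.mem_span_pair]
    exact ⟨fun ⟨c, d, h⟩ => ⟨c, d, by rw [← h]; ring⟩, fun ⟨c, d, h⟩ => ⟨c, d, by rw [h]; ring⟩⟩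
  by_cases hC : ∀ t ∈ maximalIdeal L, ∃ c, c ∉ Ideal.span {x, y} ∧ t * c ∈ Ideal.span {x, y}
  · obtain ⟨s, h1, h2⟩ := exists_socle _ hC
    exact Or.inr (Or.inr ⟨x, y, hxy, s, fun h => h1 ((hmem s).2 h), fun t ht => (hmem _).1 (h2 t ht)⟩)
  push Not at hC
  obtain ⟨t, htm, ht⟩ := hC
  have hreg : IsWeaklyRegular L [x, y, t] := isWeaklyRegular_triple hx' hxy.right
    (fun n n₁ n₂ h => (hmem n).1 (by_contra fun hc => ht n hc ((hmem _).2 ⟨n₁, n₂, h⟩)))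
  have hreg' : IsRegular L [x, y, t] := by
    refine IsRegular.of_isWeaklyRegular_of_mem_maximalIdeal L (fun r hr => ?_) hreg
    simp only [List.mem_cons, List.not_mem_nil, or_false] at hr
    rcases hr with rfl | rfl | rfl <;> assumption
  have h1 := ringKrullDim_add_length_eq_ringKrullDim_of_isRegular _ hreg'
  have hnt : Nontrivial (L ⧸ Ideal.ofList [x, y, t]) := by
    rw [Ideal.Quotient.nontrivial_iff]
    intro h
    have := hreg'.top_ne_smul
    rw [h] at this
    simp at this
  have h2 : 0 ≤ ringKrullDim (L ⧸ Ideal.ofList [x, y, t]) := ringKrullDim_nonneg_of_nontrivial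
  rw [← h1] at hL
  have h3 := (add_le_add_left h2 _).trans hL
  norm_num at h3

end Depth

section Split

open Matrix

/-- A matrix over a local ring which is injective modulo the maximal ideal has a left inverse. -/
theorem exists_mul_eq_one_of_residue {L : Type*} [CommRing L] [IsLocalRing L] {a b : ℕ}
    (α : Matrix (Fin b) (Fin a) L)
    (h : ∀ v, (∀ j, (α *ᵥ v) j ∈ maximalIdeal L) → ∀ k, v k ∈ maximalIdeal L) :
    ∃ τ : Matrix (Fin a) (Fin b) L, τ * α = 1 := by
  let ρ := residue L
  have hker : LinearMap.ker (Matrix.toLin' (α.map ρ)) = ⊥ := by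
    rw [LinearMap.ker_eq_bot']
    intro w hw
    choose v hv using fun k => residue_surjective (w k)
    obtain rfl : w = fun k => ρ (v k) := funext fun k => (hv k).symm
    funext k
    refine (residue_eq_zero_iff _).2 (h v (fun j => ?_) k)
    rw [← residue_eq_zero_iff]
    have := congrFun hw j
    rw [Matrix.toLin'_apply] at this
    simpa [mulVec, dotProduct, ρ] using this
  obtain ⟨g, hg⟩ := LinearMap.exists_leftInverse_of_injective _ hker
  have hB : LinearMap.toMatrix' g * α.map ρ = 1 := by
    rw [← LinearMap.toMatrix'_toLin' (α.map ρ), ← LinearMap.toMatrix'_comp, hg, LinearMap.toMatrix'_id]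
  choose B hB' using fun k j => residue_surjective (LinearMap.toMatrix' g k j)
  have hdet : IsUnit (Matrix.of B * α).det := by
    rw [← isUnit_map_iff ρ, RingHom.map_det, RingHom.mapMatrix_apply, Matrix.map_mul]
    have : (Matrix.of B).map ρ = LinearMap.toMatrix' g := by
      ext k j; exact hB' k j
    rw [this, hB, det_one]
    exact isUnit_one
  exact ⟨(Matrix.of B * α)⁻¹ * Matrix.of B, by rw [Matrix.mul_assoc, Matrix.nonsing_inv_mul _ hdet]⟩

/-- A short exact sequence `0 → L^a → L^b → M → 0` over a local ring of dimension at most two splits if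
`M` has depth at least two in the sense that Koszul cycles of length at most two are boundaries. -/
theorem exists_mul_eq_one_of_ringKrullDim_le_two {L : Type*} [CommRing L] [IsLocalRing L]
    [IsNoetherianRing L] (hL : ringKrullDim L ≤ 2) {M : Type*} [AddCommGroup M] [Module L M]
    {a b : ℕ} (α : Matrix (Fin b) (Fin a) L) (β : (Fin b → L) →ₗ[L] M)
    (hα : Function.Injective (fun v => α *ᵥ v)) (hβ : Function.Surjective β)
    (hαβ : ∀ v, β v = 0 ↔ ∃ w, v = α *ᵥ w)
    (hx : ∀ x : L, (∀ c, x * c = 0 → c = 0) → ∀ m : M, x • m = 0 → m = 0)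
    (hxy : ∀ x y : L, RegPair x y → ∀ m n : M, x • m + y • n = 0 → ∃ h, m = y • h ∧ n = -(x • h)) :
    ∃ τ : Matrix (Fin a) (Fin b) L, τ * α = 1 := by
  -- It suffices that `α` is injective modulo the maximal ideal. Suppose `α *ᵥ v` vanishes there
  -- while `v k` is a unit, and take a socle element `s` modulo a maximal regular sequence. Then `α
  -- *ᵥ (s • v)` is divisible by the sequence. By the depth of `M` so is `s • v`, and its `k`-th
  -- coordinate gives a contradiction.
  refine exists_mul_eq_one_of_residue α fun v hv k => ?_
  by_contra hk
  have hu : IsUnit (v k) := by simpa using hk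
  have hαs : ∀ s : L, ∀ j, (α *ᵥ (s • v)) j = (α *ᵥ v) j * s := by
    intro s j
    rw [mulVec_smul, Pi.smul_apply, smul_eq_mul, mul_comm]
  rcases exists_socle_of_ringKrullDim_le_two hL with ⟨s, hs, h⟩ | ⟨x, hx1, s, hs, h⟩ |
    ⟨x, y, hxy1, s, hs, h⟩
  · have h1 : s • v = 0 := hα (by
      funext j
      simp only [mulVec_zero, Pi.zero_apply]
      rw [hαs, h _ (hv j)])
    have h2 := congrFun h1 k
    exact hs ((hu.mul_left_eq_zero).1 h2)
  · choose w hw using fun j => h _ (hv j)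
    have h1 : α *ᵥ (s • v) = x • w := funext fun j => by rw [hαs, hw, Pi.smul_apply, smul_eq_mul]
    have h2 : β w = 0 := hx x hx1 _ (by rw [← map_smul, ← h1]; exact (hαβ _).2 ⟨_, rfl⟩)
    obtain ⟨u, rfl⟩ := (hαβ w).1 h2
    have h3 : s • v = x • u := hα (by simp only [h1, mulVec_smul])
    obtain ⟨c, hc⟩ := hu
    refine hs ⟨u k * ↑c⁻¹, ?_⟩
    have h4 := congrFun h3 k
    simp only [Pi.smul_apply, smul_eq_mul, ← hc] at h4
    rw [← mul_assoc, ← h4, Units.mul_inv_cancel_right]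
  · choose w w' hw using fun j => h _ (hv j)
    have h1 : α *ᵥ (s • v) = x • w + y • w' := funext fun j => by rw [hαs, hw]; rfl
    have h2 : x • β w + y • β w' = 0 := by
      rw [← map_smul, ← map_smul, ← map_add, ← h1]; exact (hαβ _).2 ⟨_, rfl⟩
    obtain ⟨m, h3, h4⟩ := hxy x y hxy1 _ _ h2
    obtain ⟨w₃, rfl⟩ := hβ m
    -- The Koszul relation between `β w` and `β w'` is trivial. Correcting `w` and `w'` by a lift of
    -- the element that trivializes it moves both into the image of `α` without changing `x • w + y
    -- • w'`.
    obtain ⟨u, hu1⟩ := (hαβ (w - y • w₃)).1 (by rw [map_sub, map_smul, h3, sub_self])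
    obtain ⟨u', hu2⟩ := (hαβ (w' + x • w₃)).1 (by rw [map_add, map_smul, h4, neg_add_cancel])
    have h3 : s • v = x • u + y • u' := hα (by
      simp only [h1, mulVec_add, mulVec_smul, ← hu1, ← hu2, smul_sub, smul_add, smul_smul, mul_comm x y]
      abel)
    obtain ⟨c, hc⟩ := hu
    refine hs ⟨u k * ↑c⁻¹, u' k * ↑c⁻¹, ?_⟩
    have h4 := congrFun h3 k
    simp only [Pi.smul_apply, Pi.add_apply, smul_eq_mul, ← hc] at h4
    rw [← mul_assoc, ← mul_assoc, ← add_mul, ← h4, Units.mul_inv_cancel_right]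

end Split

end DepthAndFreeness

/-! ### Resolutions of length one of the dual module -/

section DualPresentations

open IsLocalRing

section HomKoszul

variable {R : Type*} [CommRing R] {E : Type*} [AddCommGroup E] [Module R E] {A : Type*} [CommRing A]
  [Algebra R A]

theorem exists_eq_smul_of_forall_dvd {x : A} (hx : ∀ c, x * c = 0 → c = 0) (φ : E →ₗ[R] A)
    (h : ∀ e, ∃ c, φ e = x * c) : ∃ ψ : E →ₗ[R] A, φ = x • ψ := by
  choose c hc using h
  have hcan : ∀ s t, x * s = x * t → s = t := fun s t h => by
    rw [← sub_eq_zero]; exact hx _ (by rw [mul_sub, h, sub_self])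
  refine ⟨{ toFun := c, map_add' := fun e e' => hcan _ _ ?_, map_smul' := fun r e => hcan _ _ ?_ }, ?_⟩
  · rw [← hc, map_add, mul_add, hc, hc]
  · rw [← hc, map_smul, RingHom.id_apply, mul_smul_comm, hc]
  · ext e; exact hc e

theorem linearMap_smul_eq_zero {x : A} (hx : ∀ c, x * c = 0 → c = 0) (φ : E →ₗ[R] A)
    (h : x • φ = 0) : φ = 0 := by
  ext e; exact hx _ (LinearMap.congr_fun h e)

/-- Divisibility of linear forms is checked on values, so a regular pair on `A` is regular on
`Hom(E, A)` whatever `E` is. This is the depth two of duals on which all freeness statements rest.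
-/
theorem linearMap_exists_eq_smul {x y : A} (hxy : RegPair x y) (φ ψ : E →ₗ[R] A)
    (h : y • φ = x • ψ) : ∃ χ, φ = x • χ :=
  exists_eq_smul_of_forall_dvd hxy.left φ fun e => hxy.right _ (ψ e) (LinearMap.congr_fun h e)

theorem linearMap_koszul {x y : A} (hxy : RegPair x y) (φ ψ : E →ₗ[R] A)
    (h : x • φ + y • ψ = 0) : ∃ χ, φ = y • χ ∧ ψ = -(x • χ) := by
  obtain ⟨χ, rfl⟩ := linearMap_exists_eq_smul hxy ψ (-φ) (by
    rw [smul_neg, eq_neg_iff_add_eq_zero, add_comm, h])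
  refine ⟨-χ, ?_, by rw [smul_neg, neg_neg]⟩
  rw [smul_neg, eq_neg_iff_add_eq_zero]
  refine linearMap_smul_eq_zero hxy.left _ ?_
  rw [smul_add, smul_comm x y, h]

end HomKoszul

open Matrix

/-- A presentation of the dual of `E` with injective relation matrix. -/
structure DualPresentation (R : Type*) [CommRing R] (E : Type*) [AddCommGroup E] [Module R E] where
  a : ℕ
  b : ℕ
  g : Fin b → Module.Dual R E
  α : Matrix (Fin b) (Fin a) R
  span (φ : Module.Dual R E) : ∃ c : Fin b → R, φ = ∑ j, c j • g j
  rel (c : Fin b → R) : ∑ j, c j • g j = 0 ↔ ∃ w, c = α *ᵥ w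
  inj : Function.Injective (fun w => α *ᵥ w)

theorem IsParams.regPair {R : Type u} [CommRing R] [IsLocalRing R] {x y z : R} (h : IsParams x y z)
    (hx : x ≠ 0) : RegPair x y where
  left c hc := by
    have := h.isDomain
    exact (mul_eq_zero.1 hc).resolve_left hx
  right c e hc := by
    have h1 : y * c ∈ Ideal.span {x} := Ideal.mem_span_singleton.2 ⟨e, hc⟩
    exact Ideal.mem_span_singleton.1 ((h.isPrime_x.mem_or_mem h1).resolve_left h.y_notMem)

section Presentation

variable {R : Type u} [CommRing R] [IsLocalRing R] [IsNoetherianRing R] {x y z : R}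

/-- The dual has depth at least two, so its first syzygy has depth three over a ring whose maximal
ideal is generated by three elements, and is therefore free. -/
theorem nonempty_dualPresentation (h : IsParams x y z) (hx : x ≠ 0) (E : Type u) [AddCommGroup E]
    [Module R E] [Module.Finite R E] : Nonempty (DualPresentation R E) := by
  have hxy := h.regPair hx
  have hfin : Module.Finite R (Module.Dual R E) := inferInstance
  obtain ⟨b, g, hg⟩ := Module.Finite.exists_fin (R := R) (M := Module.Dual R E)
  let β : (Fin b → R) →ₗ[R] Module.Dual R E := Fintype.linearCombination R g
  have hβ : ∀ c, β c = ∑ j, c j • g j := fun c => Fintype.linearCombination_apply R g c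
  have hβs : ∀ φ, ∃ c, φ = β c := by
    intro φ
    have : φ ∈ LinearMap.range β := by
      rw [Fintype.range_linearCombination, hg]; trivial
    obtain ⟨c, hc⟩ := this
    exact ⟨c, hc.symm⟩
  have hdiv : ∀ n n' : Fin b → R, y • n = x • n' → ∃ n'', n = x • n'' := by
    intro n n' h
    choose c hc using fun j => hxy.right (n j) (n' j) (congrFun h j)
    exact ⟨c, funext hc⟩
  have hfree : Module.Free R (LinearMap.ker β) := by
    refine free_of_regular_triple h.span_eq ?_ ?_ ?_
    · intro n hn
      ext j
      exact hxy.left _ (congrFun (congrArg Subtype.val hn) j)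
    · rintro ⟨n, hn⟩ ⟨n', hn'⟩ h1
      obtain ⟨n'', rfl⟩ := hdiv n n' (congrArg Subtype.val h1)
      refine ⟨⟨n'', ?_⟩, rfl⟩
      rw [LinearMap.mem_ker, map_smul] at hn
      exact linearMap_smul_eq_zero hxy.left _ hn
    · rintro ⟨n, hn⟩ ⟨n₁, hn₁⟩ ⟨n₂, hn₂⟩ h1
      have h2 : z • n = x • n₁ + y • n₂ := congrArg Subtype.val h1
      have h3 : ∀ j, ∃ c d, n j = x * c + y * d := by
        intro j
        have h4 : z * n j ∈ Ideal.span {x, y} :=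
          Ideal.mem_span_pair.2 ⟨n₁ j, n₂ j, by
            have := congrFun h2 j
            simp only [Pi.smul_apply, Pi.add_apply, smul_eq_mul] at this
            rw [this]; ring⟩
        obtain ⟨c, d, h5⟩ := Ideal.mem_span_pair.1
          ((h.isPrime_xy.mem_or_mem h4).resolve_left h.z_notMem)
        exact ⟨c, d, by rw [← h5]; ring⟩
      choose c d hcd using h3
      obtain rfl : n = x • c + y • d := funext hcd
      rw [LinearMap.mem_ker, map_add, map_smul, map_smul] at hn
      -- The coefficients `c` and `d` need not be relations themselves. The triviality of the Koszul
      -- relation between their images corrects them to relations.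
      obtain ⟨χ, h6, h7⟩ := linearMap_koszul hxy (β c) (β d) hn
      obtain ⟨c₃, rfl⟩ := hβs χ
      refine ⟨⟨c - y • c₃, ?_⟩, ⟨d + x • c₃, ?_⟩, Subtype.ext ?_⟩
      · rw [LinearMap.mem_ker, map_sub, map_smul, h6, sub_self]
      · rw [LinearMap.mem_ker, map_add, map_smul, h7, neg_add_cancel]
      · simp only [Submodule.coe_add, Submodule.coe_smul, smul_sub, smul_add, smul_smul, mul_comm y x]
        abel
  let B := Module.finBasis R (LinearMap.ker β)
  have hB : ∀ w, (Matrix.of fun j k => (B k).1 j) *ᵥ w = (∑ k, w k • B k).1 := by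
    intro w
    funext j
    rw [Submodule.coe_sum, Finset.sum_apply]
    simp [mulVec, dotProduct, mul_comm]
  refine ⟨⟨_, b, g, Matrix.of fun j k => (B k).1 j, fun φ => ?_, fun c => ?_, fun w w' hw => ?_⟩⟩
  · obtain ⟨c, rfl⟩ := hβs φ
    exact ⟨c, hβ c⟩
  · rw [← hβ]
    constructor
    · intro hc
      refine ⟨B.repr ⟨c, hc⟩, ?_⟩
      rw [hB, B.sum_repr]
    · rintro ⟨w, rfl⟩
      rw [hB]
      exact (∑ k, w k • B k).2
  · simp only [hB] at hw
    refine B.equivFun.symm.injective ?_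
    rw [B.equivFun_symm_apply, B.equivFun_symm_apply]
    exact Subtype.ext hw

end Presentation

namespace DualPresentation

variable {R : Type*} [CommRing R] {E : Type*} [AddCommGroup E] [Module R E]
  (D : DualPresentation R E)

theorem sum_smul_mulVec (w : Fin D.a → R) : ∑ j, (D.α *ᵥ w) j • D.g j = 0 := (D.rel _).2 ⟨w, rfl⟩

theorem sum_smul_column (k : Fin D.a) : ∑ j, D.α j k • D.g j = 0 := by
  have := D.sum_smul_mulVec (Pi.single k 1)
  simpa using this

/-- The ideal of the `r` such that `r • 1` factors through the relation matrix. -/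
def ann : Ideal R where
  carrier := {r | ∃ τ : Matrix (Fin D.a) (Fin D.b) R, τ * D.α = r • 1}
  zero_mem' := ⟨0, by simp⟩
  add_mem' := by
    rintro r s ⟨τ, hτ⟩ ⟨σ, hσ⟩
    exact ⟨τ + σ, by rw [Matrix.add_mul, hτ, hσ, add_smul]⟩
  smul_mem' := by
    rintro c r ⟨τ, hτ⟩
    exact ⟨c • τ, by rw [Matrix.smul_mul, hτ, smul_assoc]⟩

/-- The matrix `π = r - α τ` kills the image of `α`, so it induces a map from the dual of `E` to
`R^b`. Its coordinates are elements of the bidual, and these come from elements `e i` of `E` by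
reflexivity. -/
theorem exists_splitting [Module.IsReflexive R E] {r : R} {τ : Matrix (Fin D.a) (Fin D.b) R}
    (hτ : τ * D.α = r • (1 : Matrix (Fin D.a) (Fin D.a) R)) :
    ∃ e : Fin D.b → E, r • (1 : Matrix (Fin D.b) (Fin D.b) R) =
        Matrix.of (fun i j => D.g j (e i)) + D.α * τ ∧ ∀ m : E, r • m = ∑ j, D.g j m • e j := by
  let π : Matrix (Fin D.b) (Fin D.b) R := r • 1 - D.α * τ
  have hπ : ∀ w, π *ᵥ (D.α *ᵥ w) = 0 := by
    intro w
    rw [mulVec_mulVec]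
    have : π * D.α = 0 := by
      simp only [π, Matrix.sub_mul, Matrix.mul_assoc, hτ, Matrix.mul_smul, Matrix.smul_mul,
        Matrix.one_mul, Matrix.mul_one, sub_self]
    rw [this, zero_mulVec]
  choose C hC using D.span
  have hCC : ∀ c c' : Fin D.b → R, ∑ j, c j • D.g j = ∑ j, c' j • D.g j → π *ᵥ c = π *ᵥ c' := by
    intro c c' h
    obtain ⟨w, hw⟩ := (D.rel (c - c')).1 (by
      rw [← sub_eq_zero.2 h]
      exact LinearMap.ext fun e => by
        simp [LinearMap.sum_apply, sub_mul, Finset.sum_sub_distrib])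
    rw [← sub_eq_zero, ← mulVec_sub, hw, hπ]
  have hℓ : ∀ i, ∃ e : E, ∀ c : Fin D.b → R, (∑ j, c j • D.g j) e = (π *ᵥ c) i := by
    intro i
    let ℓ : Module.Dual R (Module.Dual R E) :=
      { toFun := fun φ => (π *ᵥ C φ) i
        map_add' := fun φ ψ => by
          rw [← Pi.add_apply, ← mulVec_add]
          refine congrFun (hCC _ _ ?_) i
          simp only [Pi.add_apply, add_smul, Finset.sum_add_distrib, ← hC]
        map_smul' := fun s φ => by
          rw [RingHom.id_apply, ← Pi.smul_apply, ← mulVec_smul]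
          refine congrFun (hCC _ _ ?_) i
          simp only [Pi.smul_apply, smul_assoc, ← Finset.smul_sum, ← hC] }
    obtain ⟨e, he⟩ := (Module.bijective_dual_eval R E).2 ℓ
    refine ⟨e, fun c => ?_⟩
    have := LinearMap.congr_fun he (∑ j, c j • D.g j)
    rw [Module.Dual.eval_apply] at this
    rw [this]
    exact congrFun (hCC _ _ (hC _).symm) i
  choose e he using hℓ
  have h1 : ∀ i j, D.g j (e i) = π i j := by
    intro i j
    have := he i (Pi.single j 1)
    simpa using this
  refine ⟨e, ?_, fun m => ?_⟩
  · have : Matrix.of (fun i j => D.g j (e i)) = π := by ext i j; exact h1 i j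
    rw [this, sub_add_cancel]
  · refine (Module.bijective_dual_eval R E).1 (LinearMap.ext fun φ => ?_)
    obtain ⟨c, rfl⟩ := D.span φ
    rw [Module.Dual.eval_apply, Module.Dual.eval_apply, map_sum]
    simp only [map_smul, he]
    have h2 : π *ᵥ c = r • c - D.α *ᵥ (τ *ᵥ c) := by
      simp only [π, sub_mulVec, smul_mulVec, one_mulVec, mulVec_mulVec]
    have h3 := LinearMap.congr_fun (D.sum_smul_mulVec (τ *ᵥ c)) m
    simp only [LinearMap.sum_apply, LinearMap.smul_apply, smul_eq_mul, LinearMap.zero_apply] at h3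
    simp only [h2, LinearMap.sum_apply, LinearMap.smul_apply, smul_eq_mul, Pi.sub_apply, mul_sub,
      Finset.sum_sub_distrib, Pi.smul_apply, Finset.mul_sum]
    rw [← sub_zero (∑ i, r * _), ← h3]
    congr 1
    · exact Finset.sum_congr rfl fun _ _ => by ring
    · exact Finset.sum_congr rfl fun _ _ => mul_comm _ _

end DualPresentation

section Regular

variable {R : Type u} [CommRing R] [IsLocalRing R] [IsNoetherianRing R] {E : Type u}
  [AddCommGroup E] [Module R E] [Module.Finite R E] (D : DualPresentation R E)

/-- `Hom` out of the finite module `E` commutes with localization, so `α` still presents `Hom(E,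
R_p)`. The ring `R_p` has dimension at most two, so `α` splits over it, and `r` is a common
denominator of a splitting. Since `ann` is the annihilator of the cokernel of `αᵀ`, this cokernel is
concentrated at the closed point. -/
theorem DualPresentation.exists_mem_ann_notMem [IsDomain R] (hd : ringKrullDim R ≤ 3) (p : Ideal R) [hp : p.IsPrime]
    (hpm : p ≠ maximalIdeal R) : ∃ r ∈ D.ann, r ∉ p := by
  let L := Localization.AtPrime p
  have hinj : Function.Injective (algebraMap R L) :=
    IsLocalization.injective L p.primeCompl_le_nonZeroDivisors
  have hL : ringKrullDim L ≤ 2 := by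
    rw [IsLocalization.AtPrime.ringKrullDim_eq_height p L]
    have h1 : p < maximalIdeal R := lt_of_le_of_ne (IsLocalRing.le_maximalIdeal hp.ne_top) hpm
    have h2 : p.height + 1 ≤ (maximalIdeal R).height := Ideal.height_add_one_le_of_lt_of_isPrime h1
    have h3 : ((maximalIdeal R).height : WithBot ℕ∞) ≤ 3 := by
      rwa [IsLocalRing.maximalIdeal_height_eq_ringKrullDim]
    have h3' : (maximalIdeal R).height ≤ 3 := WithBot.coe_le_coe.1 h3
    have h4 : p.height + 1 ≤ 2 + 1 := h2.trans (h3'.trans (by norm_num))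
    have h5 : p.height ≤ 2 := (ENat.add_le_add_iff_right (by simp)).1 h4
    exact WithBot.coe_le_coe.2 h5
  let α' : Matrix (Fin D.b) (Fin D.a) L := D.α.map (algebraMap R L)
  let g' : Fin D.b → (E →ₗ[R] L) := fun j => (Algebra.linearMap R L).comp (D.g j)
  let β : (Fin D.b → L) →ₗ[L] (E →ₗ[R] L) := Fintype.linearCombination L g'
  have hβ : ∀ w e, β w e = ∑ j, w j * algebraMap R L (D.g j e) := by
    intro w e
    simp [β, g', Fintype.linearCombination_apply, LinearMap.sum_apply]
  have hmap : ∀ w : Fin D.a → R, α' *ᵥ (fun k => algebraMap R L (w k)) =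
      fun j => algebraMap R L ((D.α *ᵥ w) j) := by
    intro w
    funext j
    simp [α', mulVec, dotProduct]
  have hclear : ∀ {n : ℕ} (w : Fin n → L), ∃ s ∉ p, ∃ w' : Fin n → R,
      ∀ j, algebraMap R L s * w j = algebraMap R L (w' j) := by
    intro n w
    obtain ⟨s, hs⟩ := IsLocalization.exist_integer_multiples_of_finite p.primeCompl w
    choose w' hw' using hs
    exact ⟨s, s.2, w', fun j => by rw [hw', Algebra.smul_def]⟩
  have hunit : ∀ s ∉ p, IsUnit (algebraMap R L s) := fun s hs =>
    IsLocalization.map_units L (⟨s, hs⟩ : p.primeCompl)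
  obtain ⟨τ, hτ⟩ := exists_mul_eq_one_of_ringKrullDim_le_two hL α' β (by
      refine (injective_iff_map_eq_zero α'.mulVecLin).2 fun w hw => ?_
      obtain ⟨s, hs, w', hw'⟩ := hclear w
      have h1 : D.α *ᵥ w' = 0 := by
        funext j
        refine hinj ?_
        rw [← congrFun (hmap w') j, Pi.zero_apply, map_zero]
        have : (fun k => algebraMap R L (w' k)) = algebraMap R L s • w := funext fun k => (hw' k).symm
        rw [this, mulVec_smul]
        rw [mulVecLin_apply] at hw
        rw [hw, smul_zero]
        rfl
      have h2 : w' = 0 := D.inj (by simp [h1])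
      funext k
      have h3 := hw' k
      rw [h2, Pi.zero_apply, map_zero] at h3
      exact ((hunit s hs).mul_right_eq_zero).1 h3)
    (by
      intro φ
      obtain ⟨n, t, ht⟩ := Module.Finite.exists_fin (R := R) (M := E)
      obtain ⟨s, hs, w', hw'⟩ := hclear (fun i => φ (t i))
      have hrange : ∀ e, ∃ c, algebraMap R L c = algebraMap R L s * φ e := by
        intro e
        have he : e ∈ Submodule.span R (Set.range t) := ht ▸ trivial
        induction he using Submodule.span_induction with
        | mem e he => obtain ⟨i, rfl⟩ := he; exact ⟨w' i, (hw' i).symm⟩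
        | zero => exact ⟨0, by simp⟩
        | add e e' _ _ h h' =>
          obtain ⟨c, hc⟩ := h
          obtain ⟨c', hc'⟩ := h'
          exact ⟨c + c', by rw [map_add, map_add, mul_add, hc, hc']⟩
        | smul r e _ h =>
          obtain ⟨c, hc⟩ := h
          exact ⟨r * c, by rw [map_mul, hc, map_smul, Algebra.smul_def]; ring⟩
      choose c hc using hrange
      let ψ : Module.Dual R E :=
        { toFun := c
          map_add' := fun e e' => hinj (by rw [map_add, hc, hc, hc, map_add, mul_add])
          map_smul' := fun r e => hinj (by
            rw [RingHom.id_apply, smul_eq_mul, map_mul, hc, hc, map_smul, Algebra.smul_def]; ring) }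
      obtain ⟨d, hd'⟩ := D.span ψ
      obtain ⟨v, hv⟩ := hunit s hs
      refine ⟨fun j => ↑v⁻¹ * algebraMap R L (d j), LinearMap.ext fun e => ?_⟩
      have h1 : algebraMap R L s * φ e = ∑ j, algebraMap R L (d j) * algebraMap R L (D.g j e) := by
        have := congrArg (algebraMap R L) (LinearMap.congr_fun hd' e)
        rw [← hc]
        refine this.trans ?_
        simp [LinearMap.sum_apply]
      rw [hβ]
      simp only [mul_assoc]
      rw [← Finset.mul_sum, ← h1, ← hv, Units.inv_mul_cancel_left])
    (by
      intro w
      constructor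
      · intro hw
        obtain ⟨s, hs, w', hw'⟩ := hclear w
        obtain ⟨v, hv⟩ := hunit s hs
        obtain ⟨u, rfl⟩ := (D.rel w').1 (LinearMap.ext fun e => hinj (by
          have h1 := LinearMap.congr_fun hw e
          rw [hβ, LinearMap.zero_apply] at h1
          simp only [LinearMap.sum_apply, LinearMap.smul_apply, smul_eq_mul, map_sum, map_mul,
            LinearMap.zero_apply, map_zero, ← hw', mul_assoc]
          rw [← Finset.mul_sum, h1, mul_zero]))
        refine ⟨fun k => ↑v⁻¹ * algebraMap R L (u k), funext fun j => ?_⟩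
        have h2 : (fun k => ↑v⁻¹ * algebraMap R L (u k)) =
            (↑v⁻¹ : L) • fun k => algebraMap R L (u k) := rfl
        rw [h2, mulVec_smul, hmap, Pi.smul_apply, smul_eq_mul, ← hw', ← hv, Units.inv_mul_cancel_left]
      · rintro ⟨u, rfl⟩
        refine LinearMap.ext fun e => ?_
        rw [hβ, LinearMap.zero_apply]
        simp only [mulVec, dotProduct, Finset.sum_mul]
        rw [Finset.sum_comm]
        refine Finset.sum_eq_zero fun k _ => ?_
        have h1 := congrArg (algebraMap R L) (LinearMap.congr_fun (D.sum_smul_column k) e)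
        simp only [LinearMap.sum_apply, LinearMap.smul_apply, smul_eq_mul, map_sum, map_mul,
          LinearMap.zero_apply, map_zero] at h1
        rw [← mul_zero (u k), ← h1, Finset.mul_sum]
        exact Finset.sum_congr rfl fun j _ => by
          change algebraMap R L (D.α j k) * u k * _ = _
          ring)
    (fun x hx m hm => linearMap_smul_eq_zero hx m hm) (fun x y hxy m n h => linearMap_koszul hxy m n h)
  obtain ⟨s, hs, τ', hτ'⟩ : ∃ s ∉ p, ∃ τ' : Matrix (Fin D.a) (Fin D.b) R,
      ∀ k j, algebraMap R L s * τ k j = algebraMap R L (τ' k j) := by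
    obtain ⟨s, hs⟩ := IsLocalization.exist_integer_multiples_of_finite p.primeCompl
      (fun kj : Fin D.a × Fin D.b => τ kj.1 kj.2)
    choose w' hw' using hs
    exact ⟨s, s.2, fun k j => w' (k, j), fun k j => by rw [hw', Algebra.smul_def]⟩
  refine ⟨s, ⟨τ', ?_⟩, hs⟩
  ext k l
  refine hinj ?_
  have h1 := congrFun (congrFun hτ k) l
  rw [Matrix.mul_apply] at h1 ⊢
  simp only [map_sum, map_mul, ← hτ', mul_assoc]
  simp only [α', Matrix.map_apply] at h1
  rw [← Finset.mul_sum, h1, Matrix.smul_apply, smul_eq_mul, map_mul, Matrix.one_apply, Matrix.one_apply]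
  split_ifs <;> simp

theorem DualPresentation.exists_pow_mem_ann [IsDomain R] (hd : ringKrullDim R ≤ 3) :
    ∃ N : ℕ, maximalIdeal R ^ N ≤ D.ann := by
  have h1 : maximalIdeal R ≤ D.ann.radical := by
    rw [Ideal.radical_eq_sInf]
    refine le_sInf fun p ⟨hp1, hp2⟩ => ?_
    by_cases hpm : p = maximalIdeal R
    · exact hpm.ge
    · obtain ⟨r, hr, hrp⟩ := D.exists_mem_ann_notMem hd p hpm
      exact absurd (hp1 hr) hrp
  obtain ⟨N, hN⟩ := Ideal.exists_radical_pow_le_of_fg D.ann (IsNoetherian.noetherian _)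
  exact ⟨N, (Ideal.pow_right_mono h1 N).trans hN⟩

/-- A splitting with `r = 1` would exhibit `E` as a direct summand of a finite free module. -/
theorem DualPresentation.one_notMem_ann [Module.IsReflexive R E] (hE : ¬ Module.Free R E) :
    (1 : R) ∉ D.ann := by
  rintro ⟨τ, hτ⟩
  obtain ⟨e, -, he⟩ := D.exists_splitting hτ
  have : Module.Projective R E := Module.Projective.of_split (M := Fin D.b → R)
    (LinearMap.pi D.g) (Fintype.linearCombination R e) (LinearMap.ext fun m => by
      rw [LinearMap.comp_apply, Fintype.linearCombination_apply, LinearMap.id_apply]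
      simpa using (he m).symm)
  have := Module.finitePresentation_of_finite R E
  exact hE (Module.free_of_flat_of_isLocalRing)

/-- If `α` were injective modulo the maximal ideal it would have a left inverse, and `1` would lie
in `ann`. The vector obtained here obstructs the surjectivity of `αᵀ` at the generic point of the
closed fibre. -/
theorem DualPresentation.exists_unimodular [Module.IsReflexive R E] (hE : ¬ Module.Free R E) :
    ∃ (c : Fin D.a → R) (k : Fin D.a), IsUnit (c k) ∧ ∀ j, (D.α *ᵥ c) j ∈ maximalIdeal R := by
  by_contra hcon
  push Not at hcon
  obtain ⟨τ, hτ⟩ := exists_mul_eq_one_of_residue D.α fun v hv k => by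
    by_contra hk
    obtain ⟨j, hj⟩ := hcon v k (by simpa using hk)
    exact hj (hv j)
  exact D.one_notMem_ann hE ⟨τ, by rw [hτ, one_smul]⟩

/-- The cokernel of the transposed relation matrix. -/
abbrev DualPresentation.Coker : Type u := (Fin D.a → R) ⧸ LinearMap.range D.αᵀ.mulVecLin

/-- The cokernel is a quotient of a finite power of `R ⧸ ann`, which is Artinian because the maximal
ideal is the only prime containing `ann`. -/
theorem DualPresentation.length_coker_lt_top [IsDomain R] [Module.IsReflexive R E] (hE : ¬ Module.Free R E)
    (hd : ringKrullDim R ≤ 3) : Module.length R D.Coker < ⊤ := by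
  rw [lt_top_iff_ne_top, Module.length_ne_top_iff, isFiniteLength_iff_isNoetherian_isArtinian]
  refine ⟨inferInstance, ?_⟩
  have hart : IsArtinianRing (R ⧸ D.ann) := by
    refine IsLocalRing.quotient_artinian_of_mem_minimalPrimes_of_isLocalRing D.ann ?_
    refine ⟨⟨inferInstance, IsLocalRing.le_maximalIdeal
      ((Ideal.ne_top_iff_one _).2 (D.one_notMem_ann hE))⟩, fun p ⟨hp1, hp2⟩ hle => ?_⟩
    by_contra hpm
    obtain ⟨r, hr, hrp⟩ := D.exists_mem_ann_notMem hd p (fun h => hpm h.ge)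
    exact hrp (hp2 hr)
  have hart' : IsArtinian R (R ⧸ D.ann) :=
    isArtinian_of_surjective_algebraMap (R := R ⧸ D.ann) Ideal.Quotient.mk_surjective
  let q : (Fin D.a → R ⧸ D.ann) →ₗ[R] D.Coker :=
    LinearMap.lsum R (fun _ => R ⧸ D.ann) R fun k =>
      (Submodule.liftQ D.ann ((Submodule.mkQ _).comp (LinearMap.single R (fun _ => R) k)) (by
        rintro r ⟨τ, hτ⟩
        rw [LinearMap.mem_ker, LinearMap.comp_apply, Submodule.mkQ_apply, Submodule.Quotient.mk_eq_zero]
        refine ⟨τ k, funext fun l => ?_⟩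
        have := congrFun (congrFun hτ k) l
        rw [Matrix.mul_apply, Matrix.smul_apply, Matrix.one_apply] at this
        rw [mulVecLin_apply, mulVec, dotProduct]
        simp only [transpose_apply, mul_comm (D.α _ _), this, LinearMap.single_apply, Pi.single_apply,
          smul_eq_mul, mul_ite, mul_one, mul_zero, eq_comm (a := k)]))
  refine isArtinian_of_surjective _ q fun v => ?_
  obtain ⟨v, rfl⟩ := Submodule.Quotient.mk_surjective _ v
  refine ⟨fun k => Submodule.Quotient.mk (v k), ?_⟩
  simp only [q, LinearMap.lsum_apply, LinearMap.sum_apply, LinearMap.comp_apply, LinearMap.proj_apply,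
    Submodule.liftQ_apply, Submodule.mkQ_apply]
  change ∑ k, Submodule.mkQ _ (LinearMap.single R (fun _ => R) k (v k)) = _
  rw [← map_sum]
  exact congrArg _ (LinearMap.sum_single_apply _ v)

end Regular

end DualPresentations

/-! ### `Ext¹` of the dual as the cokernel of the transposed matrix -/

section ExtLengths

open Matrix

section ExtLength

variable {R : Type u} [CommRing R] {E : Type u} [AddCommGroup E] [Module R E] (D : DualPresentation R E)

namespace DualPresentation

/-- The short exact sequence attached to a presentation of the dual. -/
noncomputable def shortComplex : ShortComplex (ModuleCat.{u} R) where
  X₁ := ModuleCat.of R (Fin D.a → R)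
  X₂ := ModuleCat.of R (Fin D.b → R)
  X₃ := ModuleCat.of R (Module.Dual R E)
  f := ModuleCat.ofHom D.α.mulVecLin
  g := ModuleCat.ofHom (Fintype.linearCombination R D.g)
  zero := by
    refine ModuleCat.hom_ext (LinearMap.ext fun w => ?_)
    change Fintype.linearCombination R D.g (D.α *ᵥ w) = 0
    rw [Fintype.linearCombination_apply, D.sum_smul_mulVec]

theorem shortExact : D.shortComplex.ShortExact where
  exact := by
    rw [ShortComplex.moduleCat_exact_iff]
    intro c hc
    obtain ⟨w, hw⟩ := (D.rel c).1 ((Fintype.linearCombination_apply R D.g c).symm.trans hc)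
    exact ⟨w, hw.symm⟩
  mono_f := (ModuleCat.mono_iff_injective _).2 D.inj
  epi_g := (ModuleCat.epi_iff_surjective _).2 fun φ => by
    obtain ⟨c, hc⟩ := D.span φ
    exact ⟨c, (Fintype.linearCombination_apply R D.g c).trans hc.symm⟩

/-- Vectors as linear forms on the free module of relations. -/
noncomputable def vecHom : (Fin D.a → R) →ₗ[R] (D.shortComplex.X₁ ⟶ ModuleCat.of R R) where
  toFun v := ModuleCat.ofHom (Fintype.linearCombination R v)
  map_add' v v' := ModuleCat.hom_ext (LinearMap.ext fun w => by
    change Fintype.linearCombination R (v + v') w =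
      Fintype.linearCombination R v w + Fintype.linearCombination R v' w
    simp [Fintype.linearCombination_apply, mul_add, Finset.sum_add_distrib])
  map_smul' r v := ModuleCat.hom_ext (LinearMap.ext fun w => by
    change Fintype.linearCombination R (r • v) w = r • Fintype.linearCombination R v w
    simp [Fintype.linearCombination_apply, Finset.mul_sum, mul_left_comm])

/-- The connecting map to `Ext¹`. -/
noncomputable def toExt : (Fin D.a → R) →ₗ[R]
    Abelian.Ext (ModuleCat.of R (Module.Dual R E)) (ModuleCat.of R R) 1 where
  toFun v := D.shortExact.extClass.comp (Abelian.Ext.mk₀ (D.vecHom v)) (add_zero 1)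
  map_add' v v' := by
    rw [map_add, Abelian.Ext.mk₀_add, Abelian.Ext.comp_add]
    rfl
  map_smul' r v := by
    rw [map_smul, Abelian.Ext.mk₀_smul, Abelian.Ext.comp_smul, RingHom.id_apply]
    rfl

/-- The next term of the long exact sequence is `Ext¹(R^b, R)`, which vanishes by projectivity. -/
theorem toExt_surjective : Function.Surjective D.toExt := by
  intro e
  have hproj : Projective D.shortComplex.X₂ :=
    (IsProjective.iff_projective (R := R) (Fin D.b → R)).1 inferInstance
  obtain ⟨x, hx⟩ := Abelian.Ext.contravariant_sequence_exact₃ D.shortExact (ModuleCat.of R R) e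
    (Abelian.Ext.eq_zero_of_projective _) (n₀ := 0) rfl
  obtain ⟨φ, rfl⟩ := Abelian.Ext.addEquiv₀.symm.surjective x
  refine ⟨fun k => φ.hom (Pi.single k 1), ?_⟩
  rw [← hx]
  change D.shortExact.extClass.comp (Abelian.Ext.mk₀ _) (add_zero 1) =
    D.shortExact.extClass.comp (Abelian.Ext.mk₀ φ) (add_zero 1)
  congr 2
  refine ModuleCat.hom_ext (LinearMap.pi_ext' fun k => LinearMap.ext_ring ?_)
  change Fintype.linearCombination R _ (Pi.single k 1) = φ.hom (Pi.single k 1)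
  rw [Fintype.linearCombination_apply_single, one_smul]

/-- A linear form on `R^a` dies in `Ext¹` exactly when it is the restriction along `α` of a form on
`R^b`; restricting along `α` is multiplication by the transpose. -/
theorem toExt_eq_zero_iff (v : Fin D.a → R) :
    D.toExt v = 0 ↔ v ∈ LinearMap.range D.αᵀ.mulVecLin := by
  have hcomp : ∀ u : Fin D.b → R, D.shortComplex.f ≫ (ModuleCat.ofHom (Fintype.linearCombination R u) :
      D.shortComplex.X₂ ⟶ ModuleCat.of R R) = D.vecHom (D.αᵀ *ᵥ u) := by
    intro u
    refine ModuleCat.hom_ext (LinearMap.ext fun (w : Fin D.a → R) => ?_)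
    change Fintype.linearCombination R u (D.α *ᵥ w) = Fintype.linearCombination R (D.αᵀ *ᵥ u) w
    rw [Fintype.linearCombination_apply, Fintype.linearCombination_apply]
    change D.α *ᵥ w ⬝ᵥ u = w ⬝ᵥ D.αᵀ *ᵥ u
    rw [dotProduct_mulVec, vecMul_transpose]
  have hzero : ∀ φ : D.shortComplex.X₂ ⟶ ModuleCat.of R R, D.shortExact.extClass.comp
      (Abelian.Ext.mk₀ (D.shortComplex.f ≫ φ)) (add_zero 1) = 0 := by
    intro φ
    rw [← Abelian.Ext.mk₀_comp_mk₀]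
    exact D.shortExact.extClass_comp_assoc (Abelian.Ext.mk₀ φ) (h := add_zero 1)
  constructor
  · intro h
    obtain ⟨x, hx⟩ := Abelian.Ext.contravariant_sequence_exact₁ D.shortExact (ModuleCat.of R R)
      (Abelian.Ext.mk₀ (D.vecHom v)) (add_zero 1) h
    obtain ⟨φ, rfl⟩ := Abelian.Ext.addEquiv₀.symm.surjective x
    refine ⟨fun j => φ.hom (Pi.single j 1), ?_⟩
    have h1 : (ModuleCat.ofHom (Fintype.linearCombination R fun j => φ.hom (Pi.single j 1)) :
        D.shortComplex.X₂ ⟶ ModuleCat.of R R) = φ := by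
      refine ModuleCat.hom_ext (LinearMap.pi_ext' fun k => LinearMap.ext_ring ?_)
      change Fintype.linearCombination R _ (Pi.single k 1) = φ.hom (Pi.single k 1)
      rw [Fintype.linearCombination_apply_single, one_smul]
    have h2 := hcomp fun j => φ.hom (Pi.single j 1)
    rw [h1] at h2
    have h3 : Abelian.Ext.mk₀ (D.shortComplex.f ≫ φ) = Abelian.Ext.mk₀ (D.vecHom v) := by
      rw [← hx, ← Abelian.Ext.mk₀_comp_mk₀]
      rfl
    have h4 : D.shortComplex.f ≫ φ = D.vecHom v := (Abelian.Ext.mk₀_bijective _ _).1 h3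
    rw [h2] at h4
    funext k
    have h5 := congrArg (fun t : D.shortComplex.X₁ ⟶ ModuleCat.of R R =>
      t.hom (Pi.single k (1 : R) : Fin D.a → R)) h4
    change Fintype.linearCombination R _ (Pi.single k 1) = Fintype.linearCombination R v (Pi.single k 1) at h5
    rw [Fintype.linearCombination_apply_single, Fintype.linearCombination_apply_single, one_smul,
      one_smul] at h5
    exact h5
  · rintro ⟨u, rfl⟩
    change D.shortExact.extClass.comp (Abelian.Ext.mk₀ (D.vecHom (D.αᵀ *ᵥ u))) (add_zero 1) = 0
    rw [← hcomp]
    exact hzero _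

theorem length_ext_eq :
    Module.length R (Abelian.Ext (ModuleCat.of R (Module.Dual R E)) (ModuleCat.of R R) 1) =
      Module.length R ((Fin D.a → R) ⧸ LinearMap.range D.αᵀ.mulVecLin) := by
  have hker : LinearMap.ker D.toExt = LinearMap.range D.αᵀ.mulVecLin := by
    ext v
    exact D.toExt_eq_zero_iff v
  rw [← hker]
  exact (LinearEquiv.length_eq (D.toExt.quotKerEquivOfSurjective D.toExt_surjective)).symm

end DualPresentation

end ExtLength

end ExtLengths

/-! ### The affine charts of the blow-up as rings -/

section ChartRings

open Polynomial IsLocalRing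

/-- The ring `A`, generated over `R` by an element `T` with `x T = y`, is an affine chart of the blow-up
of `(x, y)`. -/
structure IsChart {R A : Type*} [CommRing R] [CommRing A] (x y : R) (ι : R →+* A) (T : A) : Prop where
  inj : Function.Injective ι
  rel : ι x * T = ι y
  gen (c : A) : ∃ P : R[X], P.eval₂ ι T = c

theorem eval₂_relation {R A : Type*} [CommRing R] [CommRing A] {x y : R} {ι : R →+* A} {T : A}
    (h : ι x * T = ι y) : (C x * X - C y).eval₂ ι T = 0 := by
  rw [eval₂_sub, eval₂_mul, eval₂_C, eval₂_C, eval₂_X, h, sub_self]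

theorem IsChart.isNoetherianRing {R A : Type*} [CommRing R] [CommRing A] {x y : R} {ι : R →+* A} {T : A}
    [IsNoetherianRing R] (hA : IsChart x y ι T) : IsNoetherianRing A :=
  isNoetherianRing_of_surjective R[X] A (eval₂RingHom ι T) hA.gen

section Chart

variable {R A : Type u} [CommRing R] [IsLocalRing R] [CommRing A] {x y z : R} {ι : R →+* A} {T : A}

/-- Homogenization: `x ^ n P(y / x)` is a form in `x` and `y`, and only the coefficient of `y ^ n`
survives modulo `x`. -/
theorem exists_map_eq_pow_mul_eval₂ {R A : Type*} [CommRing R] [CommRing A] {x y : R} {ι : R →+* A}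
    {T : A} (hrel : ι x * T = ι y) (n : ℕ) (P : R[X]) (hP : P.natDegree ≤ n) :
    ∃ e, ι x ^ n * P.eval₂ ι T = ι (x * e + P.coeff n * y ^ n) := by
  induction n generalizing P with
  | zero =>
    obtain ⟨c, rfl⟩ := natDegree_eq_zero.1 (Nat.le_zero.1 hP)
    exact ⟨0, by simp⟩
  | succ n ih =>
    obtain ⟨e, he⟩ := ih (P - C (P.coeff (n + 1)) * X ^ (n + 1)) (by
      rw [natDegree_le_iff_coeff_eq_zero]
      intro N hN
      rw [coeff_sub, coeff_C_mul_X_pow]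
      rcases (show N = n + 1 ∨ n + 1 < N by omega) with rfl | h
      · rw [if_pos rfl, sub_self]
      · rw [if_neg (by omega), coeff_eq_zero_of_natDegree_lt (hP.trans_lt h), sub_zero])
    rw [eval₂_sub, eval₂_mul, eval₂_C, eval₂_X_pow, mul_sub, sub_eq_iff_eq_add] at he
    refine ⟨x * e + (P - C (P.coeff (n + 1)) * X ^ (n + 1)).coeff n * y ^ n, ?_⟩
    rw [pow_succ', mul_assoc, he, mul_add, ← map_mul, map_add ι (x * _)]
    congr 1
    rw [map_mul, map_pow, ← hrel]
    ring

/-- Comparing with the homogenized polynomial, the top coefficient times a power of `y` lies in the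
prime ideal `(x)`, which does not contain `y`. -/
theorem exists_coeff_eq_mul (hp : IsParams x y z) (hinj : Function.Injective ι)
    (hrel : ι x * T = ι y) (n : ℕ) (P : R[X]) (hP : P.natDegree ≤ n + 1) {k : ℕ} {q : R}
    (hq : ι y ^ k * P.eval₂ ι T = ι q) : ∃ c, P.coeff (n + 1) = x * c := by
  obtain ⟨e, he⟩ := exists_map_eq_pow_mul_eval₂ hrel (n + 1) P hP
  have h1 : x ^ (n + 1) * q = y ^ k * (x * e + P.coeff (n + 1) * y ^ (n + 1)) := hinj (by
    rw [map_mul, map_mul, ← he, ← hq, map_pow, map_pow]; ring)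
  have h2 : P.coeff (n + 1) * y ^ (k + (n + 1)) ∈ Ideal.span {x} :=
    Ideal.mem_span_singleton.2 ⟨x ^ n * q - y ^ k * e, by linear_combination -h1⟩
  have := hp.isPrime_x
  exact Ideal.mem_span_singleton.1 ((this.mem_or_mem h2).resolve_right fun h =>
    hp.y_notMem (this.mem_of_pow_mem _ h))

/-- A top coefficient divisible by `x` can be removed with a multiple of `x X - y`, so the degree
descends to zero. With `k = 0` and `q = 0` this computes the ideal of relations of the chart; with
general `k` it computes the functions regular on both charts. -/
theorem exists_sub_C_mem (hp : IsParams x y z) (hinj : Function.Injective ι)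
    (hrel : ι x * T = ι y) {k : ℕ} (n : ℕ) (P : R[X]) (hP : P.natDegree ≤ n) {q : R}
    (hq : ι y ^ k * P.eval₂ ι T = ι q) : ∃ r, P - C r ∈ Ideal.span {C x * X - C y} := by
  induction n generalizing P with
  | zero =>
    obtain ⟨c, rfl⟩ := natDegree_eq_zero.1 (Nat.le_zero.1 hP)
    exact ⟨c, by simp⟩
  | succ n ih =>
    obtain ⟨c, hc⟩ := exists_coeff_eq_mul hp hinj hrel n P hP hq
    obtain ⟨r, hr⟩ := ih (P - C c * X ^ n * (C x * X - C y)) (by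
      rw [natDegree_le_iff_coeff_eq_zero]
      intro N hN
      have h1 : C c * X ^ n * (C x * X - C y) = C (x * c) * X ^ (n + 1) - C (c * y) * X ^ n := by
        rw [C_mul, C_mul]; ring
      rw [h1, coeff_sub, coeff_sub, coeff_C_mul_X_pow, coeff_C_mul_X_pow]
      rcases (show N = n + 1 ∨ n + 1 < N by omega) with rfl | h
      · rw [if_pos rfl, if_neg (by omega), hc]; ring
      · rw [if_neg (by omega), if_neg (by omega), coeff_eq_zero_of_natDegree_lt (hP.trans_lt h)]
        ring) (by
      rw [eval₂_sub, eval₂_mul, eval₂_relation hrel, mul_zero, sub_zero, hq])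
    refine ⟨r, ?_⟩
    have := add_mem hr (Ideal.mul_mem_left _ (C c * X ^ n) (Ideal.mem_span_singleton_self (C x * X - C y)))
    convert this using 1
    ring

namespace IsChart

variable (hA : IsChart x y ι T) (hp : IsParams x y z)
include hA hp

theorem mem_span_of_eval₂_eq_zero (P : R[X]) (hP : P.eval₂ ι T = 0) :
    P ∈ Ideal.span {C x * X - C y} := by
  obtain ⟨r, hr⟩ := exists_sub_C_mem hp hA.inj hA.rel (k := 0) (q := 0) P.natDegree P le_rfl
    (by rw [hP, map_zero, mul_zero])
  obtain ⟨Q, hQ⟩ := Ideal.mem_span_singleton.1 hr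
  have h1 := congrArg (eval₂ ι T) hQ
  rw [eval₂_mul, eval₂_relation hA.rel, eval₂_sub, eval₂_C, zero_mul, hP, zero_sub, neg_eq_zero] at h1
  have h2 : r = 0 := hA.inj (by rw [h1, map_zero])
  rwa [h2, C_0, sub_zero] at hr

theorem map_maximalIdeal : (maximalIdeal R).map ι = Ideal.span {ι x, ι z} := by
  rw [hp.span_eq, Ideal.map_span]
  refine le_antisymm ?_ (Ideal.span_mono ?_)
  · rw [Ideal.span_le]
    rintro _ ⟨t, rfl | rfl | rfl, rfl⟩
    · exact Ideal.subset_span (by simp)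
    · rw [← hA.rel]; exact Ideal.mul_mem_right _ _ (Ideal.subset_span (by simp))
    · exact Ideal.subset_span (by simp)
  · rintro _ (rfl | rfl)
    · exact ⟨x, by simp, rfl⟩
    · exact ⟨z, by simp, rfl⟩

/-- The exceptional divisor is the affine line over the residue field. -/
theorem exists_residue : ∃ θ : A →+* (ResidueField R)[X], Function.Surjective θ ∧
    RingHom.ker θ = (maximalIdeal R).map ι := by
  let φ : R[X] →+* A := eval₂RingHom ι T
  have hφ : Function.Surjective φ := hA.gen
  let ψ : R[X] →+* (ResidueField R)[X] := mapRingHom (residue R)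
  have hψ : ∀ P : R[X], ψ P = 0 ↔ ∀ i, P.coeff i ∈ maximalIdeal R := by
    intro P
    rw [Polynomial.ext_iff]
    refine forall_congr' fun i => ?_
    rw [coe_mapRingHom, coeff_map, coeff_zero, residue_eq_zero_iff]
  have hym : y ∈ maximalIdeal R := hp.span_eq ▸ Ideal.subset_span (by simp)
  have hxm : x ∈ maximalIdeal R := hp.span_eq ▸ Ideal.subset_span (by simp)
  -- The only relation `x X - y` vanishes modulo the maximal ideal, so reduction of coefficients
  -- factors through `A`.
  have hle : RingHom.ker φ ≤ RingHom.ker ψ := by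
    intro P hP
    obtain ⟨G, rfl⟩ := Ideal.mem_span_singleton.1 (hA.mem_span_of_eval₂_eq_zero hp P hP)
    rw [RingHom.mem_ker, map_mul]
    have : ψ (C x * X - C y) = 0 := by
      rw [map_sub, map_mul, coe_mapRingHom, map_C, map_C, (residue_eq_zero_iff _).2 hxm,
        (residue_eq_zero_iff _).2 hym]
      simp
    rw [this, zero_mul]
  let θ := φ.liftOfSurjective hφ ⟨ψ, hle⟩
  have hθ : ∀ P, θ (φ P) = ψ P := fun P => RingHom.liftOfRightInverse_comp_apply _ _ _ ⟨ψ, hle⟩ P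
  refine ⟨θ, fun Q => ?_, le_antisymm (fun c hc => ?_) ?_⟩
  · obtain ⟨P, rfl⟩ := map_surjective (residue R) residue_surjective Q
    exact ⟨φ P, hθ P⟩
  · obtain ⟨P, rfl⟩ := hφ c
    rw [RingHom.mem_ker, hθ, hψ] at hc
    change P.eval₂ ι T ∈ _
    rw [eval₂_eq_sum_range]
    exact Ideal.sum_mem _ fun i _ => Ideal.mul_mem_right _ _ (Ideal.mem_map_of_mem _ (hc i))
  · rw [Ideal.map_le_iff_le_comap]
    intro r hr
    have : ι r = φ (C r) := by simp [φ]
    rw [Ideal.mem_comap, RingHom.mem_ker, this, hθ, hψ]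
    intro i
    rw [coeff_C]
    split_ifs
    · exact hr
    · exact zero_mem _

theorem isPrime_map : ((maximalIdeal R).map ι).IsPrime := by
  obtain ⟨θ, -, h⟩ := hA.exists_residue hp
  rw [← h]
  exact RingHom.ker_isPrime θ

/-- Such a prime corresponds to a nonzero prime of the principal ideal domain of polynomials over
the residue field. -/
theorem isMaximal_of_lt (q : Ideal A) [hq : q.IsPrime] (h : (maximalIdeal R).map ι < q) :
    q.IsMaximal := by
  obtain ⟨θ, hθ, hker⟩ := hA.exists_residue hp
  have hkq : RingHom.ker θ ≤ q := hker ▸ h.le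
  have hcomap : (q.map θ).comap θ = q := by
    rw [Ideal.comap_map_of_surjective θ hθ, ← RingHom.ker_eq_comap_bot, sup_eq_left.2 hkq]
  have hprime : (q.map θ).IsPrime := Ideal.map_isPrime_of_surjective hθ hkq
  have hne : q.map θ ≠ ⊥ := by
    intro h0
    rw [h0, ← RingHom.ker_eq_comap_bot, hker] at hcomap
    exact h.ne hcomap
  have := IsPrime.to_maximal_ideal hne
  rw [← hcomap]
  exact Ideal.comap_isMaximal_of_surjective θ hθ

variable (hx : x ≠ 0)
include hx

/-- Lift to `R[X]`, where the relations are the multiples `(x X - y) G`, and compare coefficients.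
For `x`, regularity of `x, y` makes `G` divisible by `x`. For `z`, each coefficient of `P` lies in
the prime `(x, y)`, and `y` becomes a multiple of `x` in `A`. -/
theorem regPair : RegPair (ι x) (ι z) := by
  have hdom := hp.isDomain
  refine ⟨fun c hc => ?_, fun c e hce => ?_⟩
  · obtain ⟨P, rfl⟩ := hA.gen c
    have h1 : (C x * P).eval₂ ι T = 0 := by rw [eval₂_mul, eval₂_C, hc]
    obtain ⟨G, hG⟩ := Ideal.mem_span_singleton.1 (hA.mem_span_of_eval₂_eq_zero hp _ h1)
    have h2 : C y * G = C x * (X * G - P) := by rw [mul_sub, hG]; ring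
    obtain ⟨G', rfl⟩ : C x ∣ G := by
      rw [C_dvd_iff_dvd_coeff]
      intro i
      have h3 := congrArg (fun Q => coeff Q i) h2
      simp only [coeff_C_mul] at h3
      exact (hp.regPair hx).right _ _ h3
    have h3 : P = (C x * X - C y) * G' := by
      refine mul_left_cancel₀ (a := C x) (by simpa using hx) ?_
      rw [hG]; ring
    rw [h3, eval₂_mul, eval₂_relation hA.rel, zero_mul]
  · obtain ⟨P, rfl⟩ := hA.gen c
    obtain ⟨Q, rfl⟩ := hA.gen e
    have h1 : (C z * P - C x * Q).eval₂ ι T = 0 := by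
      rw [eval₂_sub, eval₂_mul, eval₂_mul, eval₂_C, eval₂_C, hce, sub_self]
    obtain ⟨G, hG⟩ := Ideal.mem_span_singleton.1 (hA.mem_span_of_eval₂_eq_zero hp _ h1)
    have h2 : ∀ i, ∃ c d, P.coeff i = x * c + y * d := by
      intro i
      have h3 := congrArg (fun Q => coeff Q i)
        (show C z * P = C x * (Q + X * G) - C y * G by rw [← sub_eq_zero] at hG ⊢; rw [← hG]; ring)
      simp only [coeff_C_mul, coeff_sub] at h3
      have h4 : z * P.coeff i ∈ Ideal.span {x, y} :=
        Ideal.mem_span_pair.2 ⟨(Q + X * G).coeff i, -G.coeff i, by rw [h3]; ring⟩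
      obtain ⟨c, d, h5⟩ := Ideal.mem_span_pair.1 ((hp.isPrime_xy.mem_or_mem h4).resolve_left hp.z_notMem)
      exact ⟨c, d, by rw [← h5]; ring⟩
    choose c d hcd using h2
    refine ⟨∑ i ∈ Finset.range (P.natDegree + 1), (ι (c i) + T * ι (d i)) * T ^ i, ?_⟩
    rw [eval₂_eq_sum_range, Finset.mul_sum]
    refine Finset.sum_congr rfl fun i _ => ?_
    rw [hcd, map_add, map_mul, map_mul, ← hA.rel]
    ring

/-- Powers of `x` are nonzerodivisors that carry any element of `A` into the domain `R`. -/
theorem isDomain : IsDomain A := by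
  have hdom := hp.isDomain
  have hreg := (hA.regPair hp hx).left
  have hpow : ∀ (n : ℕ) (c : A), ι x ^ n * c = 0 → c = 0 := by
    intro n
    induction n with
    | zero => intro c hc; simpa using hc
    | succ n ih => intro c hc; exact ih c (hreg _ (by rw [← hc]; ring))
  have hfrac : ∀ c, ∃ n r, ι x ^ n * c = ι r := by
    intro c
    obtain ⟨P, rfl⟩ := hA.gen c
    obtain ⟨e, he⟩ := exists_map_eq_pow_mul_eval₂ hA.rel P.natDegree P le_rfl
    exact ⟨_, _, he⟩
  have : Nontrivial A := hA.inj.nontrivial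
  have : NoZeroDivisors A := ⟨fun {c d} h => by
    obtain ⟨n, r, hr⟩ := hfrac c
    obtain ⟨k, s, hs⟩ := hfrac d
    have h1 : r * s = 0 := hA.inj (by
      rw [map_mul, ← hr, ← hs, map_zero]
      linear_combination ι x ^ n * ι x ^ k * h)
    rcases mul_eq_zero.1 h1 with rfl | rfl
    · exact Or.inl (hpow n c (by rw [hr, map_zero]))
    · exact Or.inr (hpow k d (by rw [hs, map_zero]))⟩
  exact NoZeroDivisors.to_isDomain A

end IsChart

/-- Functions on the two charts which agree on the overlap are constant. -/
theorem exists_eq_of_eval₂_eq {B : Type u} [CommRing B] {ι : R →+* B} {T T' : B} (hp : IsParams x y z)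
    (hinj : Function.Injective ι) (hrel : ι x * T = ι y) (hrel' : ι y * T' = ι x)
    (P Q : R[X]) (h : P.eval₂ ι T = Q.eval₂ ι T') : ∃ r, P.eval₂ ι T = ι r := by
  obtain ⟨e, he⟩ := exists_map_eq_pow_mul_eval₂ hrel' Q.natDegree Q le_rfl
  obtain ⟨r, hr⟩ := exists_sub_C_mem hp hinj hrel P.natDegree P le_rfl (k := Q.natDegree)
    (by rw [h, he])
  obtain ⟨G, hG⟩ := Ideal.mem_span_singleton.1 hr
  have h1 := congrArg (eval₂ ι T) hG
  rw [eval₂_mul, eval₂_relation hrel, eval₂_sub, eval₂_C, zero_mul, sub_eq_zero] at h1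
  exact ⟨r, h1⟩

end Chart

end ChartRings

/-! ### Linear forms with values in a ring and their local freeness -/

section LinearForms

open IsLocalRing

/-- Additive maps from an `R`-module to a ring which are semilinear along `ι`. -/
structure IsSemilin {R A E : Type*} [CommRing R] [CommRing A] [AddCommGroup E] [Module R E]
    (ι : R →+* A) (δ : E → A) : Prop where
  add (e e' : E) : δ (e + e') = δ e + δ e'
  smul (r : R) (e : E) : δ (r • e) = ι r * δ e

theorem RegPair.of_isLocalization {A B : Type*} [CommRing A] [CommRing B] [Algebra A B] (M : Submonoid A)
    [IsLocalization M B] {r t : A} (h : RegPair r t) : RegPair (algebraMap A B r) (algebraMap A B t) where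
  left c hc := by
    obtain ⟨a, m, rfl⟩ := IsLocalization.exists_mk'_eq M c
    rw [← IsLocalization.mk'_one (M := M) B r, ← IsLocalization.mk'_mul, one_mul,
      IsLocalization.mk'_eq_zero_iff] at hc
    obtain ⟨u, hu⟩ := hc
    rw [IsLocalization.mk'_eq_zero_iff]
    exact ⟨u, h.left _ (by rw [← hu]; ring)⟩
  right c e hce := by
    obtain ⟨m, hm⟩ := IsLocalization.exist_integer_multiples_of_finite M ![c, e]
    obtain ⟨a, ha⟩ := hm 0
    obtain ⟨b, hb⟩ := hm 1
    simp only [Matrix.cons_val_zero, Matrix.cons_val_one, Algebra.smul_def] at ha hb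
    have h1 : algebraMap A B (t * a) = algebraMap A B (r * b) := by
      rw [map_mul, map_mul, ha, hb]
      linear_combination algebraMap A B m * hce
    obtain ⟨u, hu⟩ := (IsLocalization.eq_iff_exists M B).1 h1
    obtain ⟨d, hd⟩ := h.right (u * a) (u * b) (by linear_combination hu)
    refine ⟨IsLocalization.mk' B d (u * m), ?_⟩
    have h2 := congrArg (algebraMap A B) hd
    rw [map_mul, map_mul, ha] at h2
    refine (IsLocalization.map_units B (u * m)).mul_left_cancel ?_
    have h3 := IsLocalization.mk'_spec' B d (u * m)
    rw [mul_left_comm, h3, ← h2, Submonoid.coe_mul, map_mul, mul_assoc]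

section HomFree

variable {R : Type u} [CommRing R] {E : Type u} [AddCommGroup E] [Module R E]
  [Module.Finite R E]

theorem finite_linearMap (A : Type u) [CommRing A] [Algebra R A] [IsNoetherianRing A] :
    Module.Finite A (E →ₗ[R] A) := by
  obtain ⟨n, t, ht⟩ := Module.Finite.exists_fin (R := R) (M := E)
  let v : (E →ₗ[R] A) →ₗ[A] (Fin n → A) :=
    { toFun := fun φ i => φ (t i)
      map_add' := fun _ _ => rfl
      map_smul' := fun _ _ => rfl }
  have hv : Function.Injective v := by
    intro φ ψ h
    exact LinearMap.ext_on_range ht fun i => congrFun h i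
  have := isNoetherian_of_injective v hv
  infer_instance

/-- Denominators of linear forms can be cleared. -/
theorem exists_clear {A B : Type*} [CommRing A] [CommRing B] {ι : R →+* A} {j : A →+* B}
    (hj : Function.Injective j)
    (hfrac : ∀ (m : ℕ) (b : Fin m → B), ∃ (t : A) (a : Fin m → A), IsUnit (j t) ∧
      ∀ i, j t * b i = j (a i)) (δ : E → B) (hδ : IsSemilin (j.comp ι) δ) :
    ∃ t, IsUnit (j t) ∧ ∃ δ' : E → A, IsSemilin ι δ' ∧ ∀ e, j t * δ e = j (δ' e) := by
  obtain ⟨n, g, hg⟩ := Module.Finite.exists_fin (R := R) (M := E)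
  obtain ⟨t, a, ht, ha⟩ := hfrac n (fun i => δ (g i))
  have hδ0 : δ 0 = 0 := by simpa using hδ.add 0 0
  have hrange : ∀ e, ∃ c, j t * δ e = j c := by
    intro e
    have he : e ∈ Submodule.span R (Set.range g) := hg ▸ trivial
    induction he using Submodule.span_induction with
    | mem e he => obtain ⟨i, rfl⟩ := he; exact ⟨a i, ha i⟩
    | zero => exact ⟨0, by rw [hδ0, mul_zero, map_zero]⟩
    | add e e' _ _ h h' =>
      obtain ⟨c, hc⟩ := h
      obtain ⟨c', hc'⟩ := h'
      exact ⟨c + c', by rw [map_add, hδ.add, mul_add, hc, hc']⟩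
    | smul r e _ h =>
      obtain ⟨c, hc⟩ := h
      exact ⟨ι r * c, by rw [map_mul, ← hc, hδ.smul, RingHom.comp_apply]; ring⟩
  choose c hc using hrange
  refine ⟨t, ht, c, ⟨fun e e' => hj ?_, fun r e => hj ?_⟩, hc⟩
  · rw [map_add, ← hc, ← hc, ← hc, hδ.add, mul_add]
  · rw [map_mul, ← hc, ← hc, hδ.smul, RingHom.comp_apply]; ring

/-- The module of linear forms with values in a domain is free near a prime ideal generated by a regular
pair. -/
theorem exists_basis_near {A : Type u} [CommRing A] [IsDomain A] [IsNoetherianRing A] {ι : R →+* A}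
    {s t : A} (hst : RegPair s t) (p : Ideal A) [hp : p.IsPrime] (hpst : p = Ideal.span {s, t}) :
    ∃ (h : A) (n : ℕ) (e : Fin n → E → A), h ∉ p ∧ (∀ i, IsSemilin ι (e i)) ∧
      ∀ (B : Type u) [CommRing B] (j : A →+* B), Function.Injective j →
        (∀ (m : ℕ) (b : Fin m → B), ∃ (t : A) (a : Fin m → A), IsUnit (j t) ∧
          ∀ i, j t * b i = j (a i)) → IsUnit (j h) →
        (∀ δ : E → B, IsSemilin (j.comp ι) δ → ∃ c : Fin n → B, ∀ m, δ m = ∑ i, c i * j (e i m)) ∧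
        ∀ c : Fin n → B, (∀ m, ∑ i, c i * j (e i m) = 0) → c = 0 := by
  let := ι.toAlgebra
  let L := Localization.AtPrime p
  have hinj : Function.Injective (algebraMap A L) :=
    IsLocalization.injective L p.primeCompl_le_nonZeroDivisors
  have hunit : ∀ s ∉ p, IsUnit (algebraMap A L s) := fun s hs =>
    IsLocalization.map_units L (⟨s, hs⟩ : p.primeCompl)
  have hfracL : ∀ (m : ℕ) (w : Fin m → L), ∃ (s : A) (a : Fin m → A), IsUnit (algebraMap A L s) ∧
      ∀ i, algebraMap A L s * w i = algebraMap A L (a i) := by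
    intro m w
    obtain ⟨s, hs⟩ := IsLocalization.exist_integer_multiples_of_finite p.primeCompl w
    choose w' hw' using hs
    exact ⟨s, w', hunit s s.2, fun j => by rw [hw', Algebra.smul_def]⟩
  have hsl : p.map (algebraMap A L) = maximalIdeal L := Localization.AtPrime.map_eq_maximalIdeal
  have hLst : RegPair (algebraMap A L s) (algebraMap A L t) := hst.of_isLocalization p.primeCompl
  have hLfin := finite_linearMap (R := R) (E := E) L
  have hAfin := finite_linearMap (R := R) (E := E) A
  -- The maximal ideal of `L` is generated by the regular pair `s, t`, which is also regular on the
  -- module of linear forms.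
  have hfree : Module.Free L (E →ₗ[R] L) := by
    refine free_of_regular_pair (x := algebraMap A L s) (y := algebraMap A L t) ?_
      (fun φ h => linearMap_smul_eq_zero hLst.left φ h)
      (fun φ ψ h => linearMap_exists_eq_smul hLst φ ψ h)
    rw [← hsl, ← Set.image_pair, ← Ideal.map_span]
    exact congrArg _ hpst
  let β := Module.finBasis L (E →ₗ[R] L)
  have hsemi : ∀ φ : E →ₗ[R] L, IsSemilin ((algebraMap A L).comp ι) φ := fun φ =>
    ⟨map_add φ, fun r e => by rw [map_smul, Algebra.smul_def]; rfl⟩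
  choose d hd e he hde using fun i => exists_clear hinj hfracL (β i) (hsemi (β i))
  -- linear forms with values in `A`
  let lin : ∀ δ : E → A, IsSemilin ι δ → (E →ₗ[R] A) := fun δ hδ =>
    { toFun := δ, map_add' := hδ.add, map_smul' := fun r m => by rw [hδ.smul, Algebra.smul_def]; rfl }
  have hsemiA : ∀ φ : E →ₗ[R] A, IsSemilin ι φ := fun φ =>
    ⟨map_add φ, fun r e => by rw [map_smul, Algebra.smul_def]; rfl⟩
  obtain ⟨k, μ, hμ⟩ := Module.Finite.exists_fin (R := A) (M := E →ₗ[R] A)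
  let toL : (E →ₗ[R] A) → (E →ₗ[R] L) := fun φ => (IsScalarTower.toAlgHom R A L).toLinearMap.comp φ
  have hrepr : ∀ (φ : E →ₗ[R] L) (m : E), φ m = ∑ i, β.repr φ i * β i m := by
    intro φ m
    have := LinearMap.congr_fun (β.sum_repr φ) m
    rw [LinearMap.sum_apply] at this
    exact this.symm
  choose u hu using hd
  -- `h` is a common denominator for the coordinates of the generators `μ` of `Hom(E, A)` in the
  -- basis rescaled by the `d i`. Therefore `h` times any form with values in `A` is a combination
  -- of the `e i`.
  obtain ⟨h, a, hh, ha⟩ := hfracL (k * _) (fun q => β.repr (toL (μ (finProdFinEquiv.symm q).1))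
    (finProdFinEquiv.symm q).2 * ↑(u (finProdFinEquiv.symm q).2)⁻¹)
  have hβ : ∀ i m, β i m = ↑(u i)⁻¹ * algebraMap A L (e i m) := by
    intro i m
    rw [← hde, ← hu, Units.inv_mul_cancel_left]
  have hspan : ∀ φ : E →ₗ[R] A, ∃ c : Fin _ → A, ∀ m, h * φ m = ∑ i, c i * e i m := by
    intro φ
    have hφ : φ ∈ Submodule.span A (Set.range μ) := hμ ▸ trivial
    induction hφ using Submodule.span_induction with
    | mem φ hφ =>
      obtain ⟨l, rfl⟩ := hφ
      refine ⟨fun i => a (finProdFinEquiv (l, i)), fun m => hinj ?_⟩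
      have h1 := hrepr (toL (μ l)) m
      rw [map_mul, map_sum]
      refine (congrArg (algebraMap A L h * ·) h1).trans ?_
      simp only
      rw [Finset.mul_sum]
      refine Finset.sum_congr rfl fun i _ => ?_
      have h2 := ha (finProdFinEquiv (l, i))
      simp only [Equiv.symm_apply_apply] at h2
      rw [map_mul, ← h2, hβ]
      ring
    | zero => exact ⟨0, by simp⟩
    | add φ ψ _ _ h1 h2 =>
      obtain ⟨c, hc⟩ := h1
      obtain ⟨c', hc'⟩ := h2
      exact ⟨c + c', fun m => by
        simp only [LinearMap.add_apply, mul_add, hc, hc', Pi.add_apply, add_mul, Finset.sum_add_distrib]⟩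
    | smul r φ _ h1 =>
      obtain ⟨c, hc⟩ := h1
      refine ⟨r • c, fun m => ?_⟩
      rw [LinearMap.smul_apply, smul_eq_mul, mul_left_comm, hc, Finset.mul_sum]
      exact Finset.sum_congr rfl fun i _ => by rw [Pi.smul_apply, smul_eq_mul, mul_assoc]
  have hindA : ∀ c : Fin _ → A, (∀ m, ∑ i, c i * e i m = 0) → c = 0 := by
    intro c hc
    have h1 : ∑ i, (algebraMap A L (c i * d i)) • β i = 0 := by
      refine LinearMap.ext fun m => ?_
      rw [LinearMap.sum_apply, LinearMap.zero_apply, ← map_zero (algebraMap A L), ← hc m, map_sum]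
      refine Finset.sum_congr rfl fun i _ => ?_
      rw [LinearMap.smul_apply, smul_eq_mul, map_mul, mul_assoc, hde, map_mul]
    have h2 := Fintype.linearIndependent_iff.1 β.linearIndependent _ h1
    funext i
    have h3 := h2 i
    rw [map_mul, ← hu] at h3
    exact hinj (by rw [Pi.zero_apply, map_zero]; exact ((u i).isUnit.mul_left_eq_zero).1 h3)
  refine ⟨h, _, e, fun hhp => ?_, he, fun B _ j hj hfrac hunitB => ⟨fun δ hδ => ?_, fun c hc => ?_⟩⟩
  · have h1 : algebraMap A L h ∈ maximalIdeal L := hsl ▸ Ideal.mem_map_of_mem _ hhp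
    exact h1 hh
  -- Elements of `B` have denominators in `A` that become units, so spanning and independence over
  -- `B` follow from the statements over `A`.
  · obtain ⟨t, ht, δ', hδ', h1⟩ := exists_clear hj hfrac δ hδ
    obtain ⟨c, hc⟩ := hspan (lin δ' hδ')
    obtain ⟨w, hw⟩ := ht.mul hunitB
    refine ⟨fun i => ↑w⁻¹ * j (c i), fun m => ?_⟩
    have h2 := congrArg j (hc m)
    rw [map_mul, map_sum] at h2
    have h3 : ↑w * δ m = ∑ i, j (c i) * j (e i m) := by
      rw [hw, mul_comm (j t), mul_assoc, h1]
      refine h2.trans ?_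
      exact Finset.sum_congr rfl fun i _ => map_mul _ _ _
    simp only [mul_assoc]
    rw [← Finset.mul_sum, ← h3, Units.inv_mul_cancel_left]
  · obtain ⟨t, b, ht, hb⟩ := hfrac _ c
    have h1 : b = 0 := hindA b fun m => hj (by
      rw [map_sum, map_zero, ← mul_zero (j t), ← hc m, Finset.mul_sum]
      exact Finset.sum_congr rfl fun i _ => by rw [map_mul, ← hb, mul_assoc])
    funext i
    have h2 := hb i
    rw [h1, Pi.zero_apply, map_zero] at h2
    exact (ht.mul_right_eq_zero).1 h2

end HomFree

end LinearForms

/-! ### Local sections of sheaves of modules -/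

section ModuleSections

section LocalSections

variable {X : Scheme.{u}}

/-- Restriction of sections of an `𝒪_X`-module. -/
noncomputable def res (M : X.Modules) {U V : X.Opens} (h : V ≤ U) : Γ(M, U) →+ Γ(M, V) :=
  (M.presheaf.map (homOfLE h).op).hom

/-- Restriction of functions. -/
noncomputable def ores {U V : X.Opens} (h : V ≤ U) : Γ(X, U) →+* Γ(X, V) :=
  (X.presheaf.map (homOfLE h).op).hom

@[simp] theorem res_res (M : X.Modules) {U V W : X.Opens} (h : V ≤ U) (h' : W ≤ V) (m : Γ(M, U)) :
    res M h' (res M h m) = res M (h'.trans h) m := modules_res_res M h h' m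

@[simp] theorem ores_ores {U V W : X.Opens} (h : V ≤ U) (h' : W ≤ V) (m : Γ(X, U)) :
    ores h' (ores h m) = ores (h'.trans h) m := by
  change X.presheaf.map _ (X.presheaf.map _ m) = X.presheaf.map _ m
  rw [← ConcreteCategory.comp_apply, ← X.presheaf.map_comp]; rfl

@[simp] theorem res_self (M : X.Modules) {U : X.Opens} (h : U ≤ U) (m : Γ(M, U)) :
    res M h m = m := by
  change M.presheaf.map (𝟙 _) m = m
  rw [M.presheaf.map_id]; rfl

@[simp] theorem ores_self {U : X.Opens} (h : U ≤ U) (m : Γ(X, U)) : ores h m = m := by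
  change X.presheaf.map (𝟙 _) m = m
  rw [X.presheaf.map_id]; rfl

@[simp] theorem res_smul (M : X.Modules) {U V : X.Opens} (h : V ≤ U) (a : Γ(X, U)) (m : Γ(M, U)) :
    res M h (a • m) = ores h a • res M h m := Scheme.Modules.map_smul M (homOfLE h) a m

theorem app_res {M N : X.Modules} (g : M ⟶ N) {U V : X.Opens} (h : V ≤ U) (m : Γ(M, U)) :
    g.app V (res M h m) = res N h (g.app U m) :=
  ConcreteCategory.congr_hom (g.mapPresheaf.naturality (homOfLE h).op) m

theorem eq_of_locally_eq (M : X.Modules) {U : X.Opens} (m n : Γ(M, U))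
    (h : ∀ x ∈ U, ∃ (V : X.Opens) (hV : V ≤ U), x ∈ V ∧ res M hV m = res M hV n) : m = n := by
  choose V hV hx he using h
  exact TopCat.Sheaf.eq_of_locally_eq' ⟨M.presheaf, M.isSheaf⟩ (fun i : U => V i.1 i.2) U
    (fun i => homOfLE (hV i.1 i.2)) (fun x hxU => Opens.mem_iSup.2 ⟨⟨x, hxU⟩, hx x hxU⟩) m n
    fun i => he i.1 i.2

theorem eq_zero_of_locally (M : X.Modules) {U : X.Opens} (m : Γ(M, U))
    (h : ∀ x ∈ U, ∃ (V : X.Opens) (hV : V ≤ U), x ∈ V ∧ res M hV m = 0) : m = 0 :=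
  eq_of_locally_eq M m 0 (by simpa using h)

theorem exists_glue (M : X.Modules) {ι : Type u} (V : ι → X.Opens) {U : X.Opens}
    (hVU : ∀ i, V i ≤ U) (hU : U ≤ iSup V) (s : ∀ i, Γ(M, V i))
    (h : ∀ i j, res M (inf_le_left : V i ⊓ V j ≤ V i) (s i) =
      res M (inf_le_right : V i ⊓ V j ≤ V j) (s j)) :
    ∃ m : Γ(M, U), ∀ i, res M (hVU i) m = s i := by
  obtain ⟨m, hm, -⟩ := TopCat.Sheaf.existsUnique_gluing' ⟨M.presheaf, M.isSheaf⟩ V U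
    (fun i => homOfLE (hVU i)) hU s h
  exact ⟨m, hm⟩

/-- Uniqueness makes the local solutions agree on overlaps. The glued section satisfies `P` only
locally, as `P` itself need not be a local condition. -/
theorem exists_of_locally_existsUnique (M : X.Modules) {U : X.Opens}
    (P : ∀ V : X.Opens, V ≤ U → Γ(M, V) → Prop)
    (hres : ∀ (V W : X.Opens) (hV : V ≤ U) (h : W ≤ V) (m : Γ(M, V)), P V hV m →
      P W (h.trans hV) (res M h m))
    (huniq : ∀ (V : X.Opens) (hV : V ≤ U) (m n : Γ(M, V)), P V hV m → P V hV n → m = n)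
    (hex : ∀ x ∈ U, ∃ (V : X.Opens) (hV : V ≤ U), x ∈ V ∧ ∃ m, P V hV m) :
    ∃ m : Γ(M, U), ∀ x ∈ U, ∃ (V : X.Opens) (hV : V ≤ U), x ∈ V ∧ P V hV (res M hV m) := by
  choose V hV hx s hs using hex
  obtain ⟨m, hm⟩ := exists_glue M (fun i : U => V i.1 i.2) (fun i => hV i.1 i.2)
    (fun x hxU => Opens.mem_iSup.2 ⟨⟨x, hxU⟩, hx x hxU⟩) (fun i => s i.1 i.2) fun i j =>
      huniq _ (inf_le_left.trans (hV i.1 i.2)) _ _ (hres _ _ _ _ _ (hs i.1 i.2))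
        (hres _ _ _ _ _ (hs j.1 j.2))
  exact ⟨m, fun x hxU => ⟨V x hxU, hV x hxU, hx x hxU, by
    have := hm ⟨x, hxU⟩
    simp only at this
    rw [this]; exact hs x hxU⟩⟩

/-- A family of submodules of the sections of an `𝒪_X`-module defined by a local condition. -/
structure LocalSubmodule (M : X.Modules) where
  obj (U : X.Opens) : Submodule Γ(X, U) Γ(M, U)
  res_mem {U V : X.Opens} (h : V ≤ U) {m : Γ(M, U)} : m ∈ obj U → res M h m ∈ obj V
  loc (U : X.Opens) (m : Γ(M, U)) :
    (∀ x ∈ U, ∃ (V : X.Opens) (hV : V ≤ U), x ∈ V ∧ res M hV m ∈ obj V) → m ∈ obj U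

namespace LocalSubmodule

variable {M : X.Modules} (K : LocalSubmodule M)

/-- The submodule of the presheaf of modules underlying `M`. -/
noncomputable def toPre : PresheafOfModules.Submodule M.val where
  obj U := K.obj U.unop
  map f _ hm := K.res_mem f.unop.le hm

/-- The `𝒪_X`-module attached to a local condition. -/
noncomputable def toModules : X.Modules where
  val := K.toPre.toPresheafOfModules
  isSheaf := by
    refine (TopCat.Presheaf.isSheaf_iff_isSheafUniqueGluing
      (K.toPre.toPresheafOfModules.presheaf)).2 ?_
    intro ι U sf hsf
    obtain ⟨m, hm⟩ := exists_glue M U (fun i => le_iSup U i) le_rfl (fun i => (sf i).1)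
      fun i j => congrArg Subtype.val (hsf i j)
    have hmem : m ∈ K.obj (iSup U) := K.loc _ _ fun x hx => by
      obtain ⟨i, hi⟩ := Opens.mem_iSup.1 hx
      exact ⟨U i, le_iSup U i, hi, by rw [hm]; exact (sf i).2⟩
    refine ⟨⟨m, hmem⟩, fun i => Subtype.ext (hm i), fun n hn => Subtype.ext ?_⟩
    refine eq_of_locally_eq M n.1 m fun x hx => ?_
    obtain ⟨i, hi⟩ := Opens.mem_iSup.1 hx
    exact ⟨U i, le_iSup U i, hi, (congrArg Subtype.val (hn i)).trans (hm i).symm⟩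

/-- The inclusion. -/
noncomputable def ι : K.toModules ⟶ M := ⟨K.toPre.ι⟩

/-- A section of `M` satisfying the local condition, as a section of the submodule. -/
noncomputable def sec {U : X.Opens} (m : Γ(M, U)) (hm : m ∈ K.obj U) : Γ(K.toModules, U) := ⟨m, hm⟩

theorem ι_mem {U : X.Opens} (m : Γ(K.toModules, U)) : K.ι.app U m ∈ K.obj U := m.2

theorem ι_injective {U : X.Opens} : Function.Injective (K.ι.app U) := Subtype.val_injective

instance : Mono K.ι where
  right_cancellation f g h := by
    refine Scheme.Modules.hom_ext _ _ fun U => ?_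
    ext m
    refine K.ι_injective ?_
    exact ConcreteCategory.congr_hom (congrArg (fun t => Scheme.Modules.Hom.app t U) h) m

/-- Morphisms to `M` whose values satisfy the local condition factor through the submodule. -/
noncomputable def lift {N : X.Modules} (g : N ⟶ M) (hg : ∀ U n, g.app U n ∈ K.obj U) :
    N ⟶ K.toModules :=
  ⟨PresheafOfModules.homMk (M₁ := N.val) (M₂ := K.toPre.toPresheafOfModules)
    { app U := AddCommGrpCat.ofHom
        { toFun n := ⟨g.app U.unop n, hg U.unop n⟩
          map_zero' := Subtype.ext (map_zero (g.app U.unop).hom)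
          map_add' _ _ := Subtype.ext (map_add (g.app U.unop).hom _ _) }
      naturality U V f := by
        ext n
        exact Subtype.ext (app_res g f.unop.le n) }
    (by
      intro U r n
      exact Subtype.ext (Scheme.Modules.Hom.app_smul g r n))⟩

theorem lift_ι {N : X.Modules} (g : N ⟶ M) (hg : ∀ U n, g.app U n ∈ K.obj U) :
    K.lift g hg ≫ K.ι = g := rfl

end LocalSubmodule

/-- Local lifting along an epimorphism. -/
theorem exists_local_lift_of_epi {M N : X.Modules} (g : M ⟶ N) [Epi g] {U : X.Opens} (n : Γ(N, U))
    {x : X} (hx : x ∈ U) :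
    ∃ (V : X.Opens) (hV : V ≤ U), x ∈ V ∧ ∃ m, g.app V m = res N hV n := by
  -- `K` is the image sheaf of `g`. Its inclusion is a monomorphism, and an epimorphism because `g`
  -- factors through it, hence an isomorphism.
  let K : LocalSubmodule N :=
    { obj U :=
        { carrier := {n | ∀ x ∈ U, ∃ (V : X.Opens) (hV : V ≤ U), x ∈ V ∧ ∃ m, g.app V m = res N hV n}
          zero_mem' := fun x hx => ⟨U, le_rfl, hx, 0, by simp⟩
          add_mem' := by
            intro a b ha hb x hx
            obtain ⟨V, hV, hxV, m, hm⟩ := ha x hx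
            obtain ⟨W, hW, hxW, m', hm'⟩ := hb x hx
            refine ⟨V ⊓ W, inf_le_left.trans hV, ⟨hxV, hxW⟩,
              res M inf_le_left m + res M inf_le_right m', ?_⟩
            rw [map_add, app_res, app_res, hm, hm', res_res, res_res, map_add]
          smul_mem' := by
            intro r a ha x hx
            obtain ⟨V, hV, hxV, m, hm⟩ := ha x hx
            refine ⟨V, hV, hxV, ores hV r • m, ?_⟩
            rw [Scheme.Modules.Hom.app_smul, hm, res_smul] }
      res_mem := by
        intro U V h m hm x hx
        obtain ⟨W, hW, hxW, n, hn⟩ := hm x (h hx)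
        refine ⟨W ⊓ V, inf_le_right, ⟨hxW, hx⟩, res M inf_le_left n, ?_⟩
        rw [app_res, hn, res_res, res_res]
      loc := by
        intro U m h x hx
        obtain ⟨V, hV, hxV, hm⟩ := h x hx
        obtain ⟨W, hW, hxW, n, hn⟩ := hm x hxV
        exact ⟨W, hW.trans hV, hxW, n, by rw [hn, res_res]⟩ }
  let g' : M ⟶ K.toModules := K.lift g fun U m x hx => ⟨U, le_rfl, hx, m, by simp⟩
  have hg : g' ≫ K.ι = g := K.lift_ι g _
  have : Epi K.ι := epi_of_epi_fac hg
  have : IsIso K.ι := isIso_of_mono_of_epi _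
  have h1 := K.ι_mem ((inv K.ι).app U n)
  rw [← ConcreteCategory.comp_apply, ← Scheme.Modules.Hom.comp_app, IsIso.inv_hom_id] at h1
  exact h1 x hx

/-- The kernel of a morphism of modules. -/
noncomputable def kerModule {M N : X.Modules} (g : M ⟶ N) : LocalSubmodule M where
  obj U :=
    { carrier := {m | g.app U m = 0}
      zero_mem' := by simp
      add_mem' := by intro a b ha hb; simp_all
      smul_mem' := by
        intro r a ha
        simp_all [Scheme.Modules.Hom.app_smul] }
  res_mem h m hm := by
    simp only [Submodule.mem_mk, AddSubmonoid.mem_mk, AddSubsemigroup.mem_mk, Set.mem_ofPred_eq] at *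
    rw [app_res, hm, map_zero]
  loc U m h := by
    refine eq_zero_of_locally N _ fun x hx => ?_
    obtain ⟨V, hV, hxV, hm⟩ := h x hx
    exact ⟨V, hV, hxV, by rw [← app_res]; exact hm⟩

theorem kerModule_ι_comp {M N : X.Modules} (g : M ⟶ N) : (kerModule g).ι ≫ g = 0 := by
  refine Scheme.Modules.hom_ext _ _ fun U => ?_
  ext m
  exact m.2

/-- Local lifting in an exact sequence. -/
theorem exists_local_lift_of_exact {S : ShortComplex X.Modules} (hS : S.Exact) {U : X.Opens}
    (n : Γ(S.X₂, U)) (hn : S.g.app U n = 0) {x : X} (hx : x ∈ U) :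
    ∃ (V : X.Opens) (hV : V ≤ U), x ∈ V ∧ ∃ m, S.f.app V m = res S.X₂ hV n := by
  -- Exactness lifts the inclusion of the kernel sheaf after composition with an epimorphism `π`,
  -- and sections lift locally along `π`.
  obtain ⟨A, π, hπ, x₁, h⟩ := hS.exact_up_to_refinements _ (kerModule_ι_comp S.g)
  obtain ⟨V, hV, hxV, m, hm⟩ := exists_local_lift_of_epi π ((kerModule S.g).sec n hn) hx
  refine ⟨V, hV, hxV, x₁.app V m, ?_⟩
  have h1 := ConcreteCategory.congr_hom (congrArg (fun t => Scheme.Modules.Hom.app t V) h) m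
  refine h1.symm.trans ?_
  change (kerModule S.g).ι.app V (π.app V m) = _
  rw [hm, app_res]
  rfl

theorem app_injective_of_mono {M N : X.Modules} (g : M ⟶ N) [Mono g] (U : X.Opens) :
    Function.Injective (g.app U) := by
  refine (injective_iff_map_eq_zero (g.app U).hom).2 fun m hm => ?_
  have h1 : (kerModule g).ι = 0 := by
    rw [← cancel_mono g, kerModule_ι_comp, zero_comp]
  have h2 := ConcreteCategory.congr_hom (congrArg (fun t => Scheme.Modules.Hom.app t U) h1)
    ((kerModule g).sec m hm)
  exact h2

end LocalSections

end ModuleSections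

/-! ### Sections of the sheaf `ℰxt¹` -/

section SheafExtSections

section LocalHom

variable {X : Scheme.{u}}

/-- Evaluation of a local homomorphism on a section over a smaller open subset. -/
noncomputable def happ {M N : X.Modules} {U : X.Opens} (φ : localHom M N U) {V : X.Opens} (h : V ≤ U) :
    Γ(M, V) →ₗ[Γ(X, V)] Γ(N, V) := φ.1 ⟨V, h⟩

theorem happ_res {M N : X.Modules} {U : X.Opens} (φ : localHom M N U) {V W : X.Opens} (hV : V ≤ U)
    (h : W ≤ V) (m : Γ(M, V)) : happ φ (h.trans hV) (res M h m) = res N h (happ φ hV m) :=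
  (φ.2 ⟨V, hV⟩ ⟨W, h.trans hV⟩ h m).symm

theorem localHom_ext {M N : X.Modules} {U : X.Opens} {φ ψ : localHom M N U}
    (h : ∀ (V : X.Opens) (hV : V ≤ U) (m : Γ(M, V)), happ φ hV m = happ ψ hV m) : φ = ψ :=
  Subtype.ext <| funext fun V => LinearMap.ext fun m => h V.1 V.2 m

/-- A homomorphism `M|_U ⟶ N|_U` is determined by a functional relation which is locally defined
everywhere and compatible with restriction and the module structures. -/
theorem exists_localHom_of_relation (M N : X.Modules) (U : X.Opens)
    (P : ∀ V : X.Opens, V ≤ U → Γ(M, V) → Γ(N, V) → Prop)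
    (hres : ∀ (V W : X.Opens) (hV : V ≤ U) (h : W ≤ V) (m : Γ(M, V)) (n : Γ(N, V)), P V hV m n →
      P W (h.trans hV) (res M h m) (res N h n))
    (hadd : ∀ (V : X.Opens) (hV : V ≤ U) (m m' : Γ(M, V)) (n n' : Γ(N, V)), P V hV m n →
      P V hV m' n' → P V hV (m + m') (n + n'))
    (hsmul : ∀ (V : X.Opens) (hV : V ≤ U) (r : Γ(X, V)) (m : Γ(M, V)) (n : Γ(N, V)), P V hV m n →
      P V hV (r • m) (r • n))
    (huniq : ∀ (V : X.Opens) (hV : V ≤ U) (n : Γ(N, V)), P V hV 0 n → n = 0)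
    (hex : ∀ (V : X.Opens) (hV : V ≤ U) (m : Γ(M, V)), ∀ x ∈ V,
      ∃ (W : X.Opens) (h : W ≤ V), x ∈ W ∧ ∃ n, P W (h.trans hV) (res M h m) n) :
    ∃ φ : Γ((sheafHom M).obj N, U), ∀ (V : X.Opens) (hV : V ≤ U) (m : Γ(M, V)), ∀ x ∈ V,
      ∃ (W : X.Opens) (h : W ≤ V), x ∈ W ∧
        P W (h.trans hV) (res M h m) (res N h (happ (M := M) (N := N) φ hV m)) := by
  have huniq2 : ∀ (V : X.Opens) (hV : V ≤ U) (m : Γ(M, V)) (n n' : Γ(N, V)), P V hV m n →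
      P V hV m n' → n = n' := by
    intro V hV m n n' h h'
    have h1 := hadd V hV _ _ _ _ h (hsmul V hV (-1) _ _ h')
    rw [neg_one_smul, neg_one_smul, add_neg_cancel] at h1
    exact add_neg_eq_zero.1 (huniq V hV _ h1)
  -- the local version of the relation
  let Q : ∀ V : X.Opens, V ≤ U → Γ(M, V) → Γ(N, V) → Prop := fun V hV m n =>
    ∀ x ∈ V, ∃ (W : X.Opens) (h : W ≤ V), x ∈ W ∧ P W (h.trans hV) (res M h m) (res N h n)
  have hQu : ∀ (V : X.Opens) (hV : V ≤ U) (m : Γ(M, V)) (n n' : Γ(N, V)), Q V hV m n →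
      Q V hV m n' → n = n' := by
    intro V hV m n n' h h'
    refine eq_of_locally_eq N n n' fun x hx => ?_
    obtain ⟨W, hW, hxW, hP⟩ := h x hx
    obtain ⟨W', hW', hxW', hP'⟩ := h' x hx
    refine ⟨W ⊓ W', inf_le_left.trans hW, ⟨hxW, hxW'⟩, huniq2 _ (inf_le_left.trans (hW.trans hV))
      (res M (inf_le_left.trans hW) m) _ _ ?_ ?_⟩
    · simpa using hres W (W ⊓ W') _ inf_le_left _ _ hP
    · simpa using hres W' (W ⊓ W') _ inf_le_right _ _ hP'
  have key : ∀ (V : X.Opens) (hV : V ≤ U) (m : Γ(M, V)), ∃ n, Q V hV m n := by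
    intro V hV m
    exact exists_of_locally_existsUnique N (fun W h n => P W (h.trans hV) (res M h m) n)
      (fun V' W hV' h n hn => by simpa using hres V' W _ h _ _ hn)
      (fun W h n n' => huniq2 W _ _ n n') (hex V hV m)
  choose f hf using key
  refine ⟨(⟨fun V => { toFun := f V.1 V.2, map_add' := ?_, map_smul' := ?_ }, ?_⟩ :
    localHom M N U), hf⟩
  · intro m m'
    refine hQu V.1 V.2 (m + m') _ _ (hf _ _ _) fun x hx => ?_
    obtain ⟨W, hW, hxW, hP⟩ := hf V.1 V.2 m x hx
    obtain ⟨W', hW', hxW', hP'⟩ := hf V.1 V.2 m' x hx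
    refine ⟨W ⊓ W', inf_le_left.trans hW, ⟨hxW, hxW'⟩, ?_⟩
    rw [map_add, map_add]
    refine hadd _ _ _ _ _ _ ?_ ?_
    · simpa using hres W (W ⊓ W') _ inf_le_left _ _ hP
    · simpa using hres W' (W ⊓ W') _ inf_le_right _ _ hP'
  · intro r m
    refine hQu V.1 V.2 (r • m) _ _ (hf _ _ _) fun x hx => ?_
    obtain ⟨W, hW, hxW, hP⟩ := hf V.1 V.2 m x hx
    refine ⟨W, hW, hxW, ?_⟩
    rw [RingHom.id_apply, res_smul, res_smul]
    exact hsmul _ _ _ _ _ hP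
  · intro V W h m
    change res N h (f V.1 V.2 m) = f W.1 W.2 (res M h m)
    refine hQu W.1 W.2 (res M h m) _ _ (fun x hx => ?_) (hf _ _ _)
    obtain ⟨W', hW', hxW', hP⟩ := hf V.1 V.2 m x (h hx)
    refine ⟨W' ⊓ W.1, inf_le_right, ⟨hxW', hx⟩, ?_⟩
    simpa using hres W' (W' ⊓ W.1) _ inf_le_left _ _ hP

end LocalHom

section SheafExtOne

variable {X : Scheme.{u}}

theorem app_congr {M N : X.Modules} {f g : M ⟶ N} (h : f = g) (U : X.Opens) (m : Γ(M, U)) :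
    f.app U m = g.app U m := by rw [h]

theorem exists_lift_of_injective_of_exact {S : ShortComplex X.Modules} (hS : S.Exact) [Mono S.f]
    {U : X.Opens} (n : Γ(S.X₂, U)) (hn : S.g.app U n = 0) : ∃ m, S.f.app U m = n := by
  obtain ⟨m, hm⟩ := exists_of_locally_existsUnique S.X₁ (U := U)
    (fun V hV m => S.f.app V m = res S.X₂ hV n)
    (fun V W hV h m hm => by rw [app_res, hm, res_res])
    (fun V hV m m' h h' => app_injective_of_mono S.f V (h.trans h'.symm))
    (fun x hx => exists_local_lift_of_exact hS n hn hx)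
  refine ⟨m, eq_of_locally_eq _ _ _ fun x hx => ?_⟩
  obtain ⟨V, hV, hxV, h⟩ := hm x hx
  exact ⟨V, hV, hxV, by rw [← app_res, h]⟩

/-- The first right derived functor of `ℋom(D, -)` at `A`, described by the sections of an
injective resolution `J₀ ⟶ J₁ ⟶ J₂` of `A`. -/
structure ExtOneData (D A : X.Modules) where
  J₀ : X.Modules
  J₁ : X.Modules
  ι : A ⟶ J₀
  d : J₀ ⟶ J₁
  Z : X.Modules
  cyc : Z ⟶ (sheafHom D).obj J₁
  π : Z ⟶ sheafExt 1 D A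
  ι_injective (U : X.Opens) : Function.Injective (ι.app U)
  d_ι (U : X.Opens) (a : Γ(A, U)) : d.app U (ι.app U a) = 0
  exists_ι (U : X.Opens) (j : Γ(J₀, U)) (h : d.app U j = 0) : ∃ a, ι.app U a = j
  cyc_lift (U : X.Opens) (z : Γ(Z, U)) (V : X.Opens) (h : V ≤ U) (m : Γ(D, V)) (x : X) (hx : x ∈ V) :
    ∃ (W : X.Opens) (hW : W ≤ V), x ∈ W ∧ ∃ j, d.app W j =
      res J₁ hW (happ (M := D) (N := J₁) (cyc.app U z) h m)
  exists_cyc (U : X.Opens) (s : Γ(sheafExt 1 D A, U)) (x : X) (hx : x ∈ U) :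
    ∃ (V : X.Opens) (hV : V ≤ U), x ∈ V ∧ ∃ z, π.app V z = res _ hV s
  exists_of_π (U : X.Opens) (z : Γ(Z, U)) (h : π.app U z = 0) (x : X) (hx : x ∈ U) :
    ∃ (V : X.Opens) (hV : V ≤ U), x ∈ V ∧ ∃ χ : Γ((sheafHom D).obj J₀, V),
      ((sheafHom D).map d).app V χ = res _ hV (cyc.app U z)
  π_of_exists (U : X.Opens) (z : Γ(Z, U)) (χ : Γ((sheafHom D).obj J₀, U))
    (h : ((sheafHom D).map d).app U χ = cyc.app U z) : π.app U z = 0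

/-- `Z` is the sheaf of 1-cycles of `ℋom(D, J)` for an injective resolution `J` of `A`, and `π` is
the projection to homology. A cycle takes values in the kernel of `J₁ ⟶ J₂`, so these values lift
locally to `J₀`. -/
theorem nonempty_extOneData (D A : X.Modules) : Nonempty (ExtOneData D A) := by
  let I : InjectiveResolution A := injectiveResolution A
  let K := ((sheafHom D).mapHomologicalComplex (ComplexShape.up ℕ)).obj I.cocomplex
  let e : sheafExt 1 D A ≅ K.homology 1 := I.isoRightDerivedObj (sheafHom D) 1
  let T : ShortComplex X.Modules := K.sc' 0 1 2
  let e' : K.homology 1 ≅ T.homology :=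
    ShortComplex.homologyMapIso (K.isoSc' 0 1 2 (by simp) (by simp))
  let p : T.cycles ⟶ sheafExt 1 D A := T.homologyπ ≫ (e ≪≫ e').inv
  have hI : (ShortComplex.mk (I.cocomplex.d 0 1) (I.cocomplex.d 1 2) (by simp)).Exact :=
    I.exact_succ 0
  have hmono : Mono (I.ι.f 0) := inferInstance
  have hI0 : (ShortComplex.mk (I.ι.f 0) (I.cocomplex.d 0 1)
    I.ι_f_zero_comp_complex_d).Exact := I.exact₀
  refine ⟨{
    J₀ := I.cocomplex.X 0
    J₁ := I.cocomplex.X 1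
    ι := I.ι.f 0
    d := I.cocomplex.d 0 1
    Z := T.cycles
    cyc := T.iCycles
    π := p
    ι_injective := fun U => @app_injective_of_mono X _ _ (I.ι.f 0) hmono U
    d_ι := fun U a => ?_
    exists_ι := fun U j h => ?_
    cyc_lift := fun U z V h m x hx => ?_
    exists_cyc := fun U s x hx => exists_local_lift_of_epi p s hx
    exists_of_π := fun U z h x hx => ?_
    π_of_exists := fun U z χ h => ?_ }⟩
  · exact app_congr I.ι_f_zero_comp_complex_d U a
  · exact exists_lift_of_injective_of_exact (S := ShortComplex.mk _ _ _) hI0 j h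
  · refine exists_local_lift_of_exact hI _ ?_ hx
    have h1 := app_congr T.iCycles_g U z
    have h2 : happ (M := D) (N := I.cocomplex.X 2) (((sheafHom D).map (I.cocomplex.d 1 2)).app U
      (T.iCycles.app U z)) h m = 0 := congrArg (fun t : localHom D (I.cocomplex.X 2) U => happ t h m) h1
    exact h2
  · have h0 : T.homologyπ.app U z = 0 := by
      refine app_injective_of_mono (e ≪≫ e').inv U ?_
      rw [map_zero]; exact h
    obtain ⟨V, hV, hxV, m, hm⟩ := exists_local_lift_of_exact
      (S := ShortComplex.mk T.toCycles T.homologyπ (by simp))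
      (ShortComplex.exact_of_g_is_cokernel _ T.homologyIsCokernel) z h0 hx
    refine ⟨V, hV, hxV, m, ?_⟩
    have h1 := congrArg (T.iCycles.app V) hm
    exact (app_congr T.toCycles_i.symm V m).trans (h1.trans (app_res T.iCycles hV z))
  · have h0 : z = T.toCycles.app U χ := by
      refine app_injective_of_mono T.iCycles U ?_
      exact h.symm.trans (app_congr T.toCycles_i.symm U χ)
    have h1 : T.toCycles ≫ p = 0 := by simp [p]
    rw [h0]
    exact app_congr h1 U χ

end SheafExtOne

end SheafExtSections

/-! ### Local sections of the dual of a pull-back -/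

section PullbackDual

section DualPairing

variable {X : Scheme.{u}} {R : Type u} [CommRing R] (f : X ⟶ Spec (.of R))

/-- The structure map `R → Γ(X, U)` of a scheme over `Spec R`. -/
noncomputable def omap (U : X.Opens) : R →+* Γ(X, U) :=
  (ores (le_top : U ≤ ⊤)).comp (f.appTop.hom.comp (Scheme.ΓSpecIso (.of R)).inv.hom)

theorem ores_omap {U V : X.Opens} (h : V ≤ U) (r : R) : ores h (omap f U r) = omap f V r := by
  simp [omap]

/-- The `R`-module of global sections of an `𝒪_X`-module. -/
noncomputable abbrev rsections (N : X.Modules) : ModuleCat R :=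
  (Scheme.Modules.pushforward f ⋙ moduleSpecΓFunctor (R := .of R)).obj N

/-- The underlying group of the `R`-module of global sections. -/
noncomputable def toSec (N : X.Modules) : rsections f N ≃+ Γ(N, ⊤) := AddEquiv.refl Γ(N, ⊤)

theorem toSec_smul (N : X.Modules) (n : rsections f N) (r : R) :
    toSec f N (r • n) = omap f ⊤ r • toSec f N n := by
  change _ = (ores le_rfl _ : Γ(X, ⊤)) • toSec f N n
  rw [ores_self]
  rfl

/-- The pull-back of the quasi-coherent sheaf on `Spec R` attached to an `R`-module. -/
noncomputable abbrev pullbackTilde (E : Type u) [AddCommGroup E] [Module R E] : X.Modules :=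
  (Scheme.Modules.pullback f).obj (tilde (R := .of R) (ModuleCat.of R E))

/-- The adjunction between pulling back `R`-modules to `X` and global sections. -/
noncomputable def pullbackTildeAdj :
    tilde.functor (.of R) ⋙ Scheme.Modules.pullback f ⊣
      Scheme.Modules.pushforward f ⋙ moduleSpecΓFunctor (R := .of R) :=
  (tilde.adjunction (R := .of R)).comp (Scheme.Modules.pullbackPushforwardAdjunction f)

variable (E : Type u) [AddCommGroup E] [Module R E]

/-- The canonical map from `E` to the global sections of its pull-back. -/
noncomputable def toRsections : E →ₗ[R] rsections f (pullbackTilde f E) :=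
  ((pullbackTildeAdj f).unit.app (ModuleCat.of R E)).hom

/-- The global section of the pull-back of `E` defined by an element of `E`. -/
noncomputable def gen : E →+ Γ(pullbackTilde f E, ⊤) :=
  (toSec f _).toAddMonoidHom.comp (toRsections f E).toAddMonoidHom

theorem gen_smul (r : R) (e : E) : gen f E (r • e) = omap f ⊤ r • gen f E e := by
  change toSec f _ (toRsections f E (r • e)) = _
  rw [map_smul, toSec_smul]; rfl

/-- This is the adjunction between pull-back of modules and global sections, in terms of elements.
-/
theorem existsUnique_hom (N : X.Modules) (δ : E →+ Γ(N, ⊤))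
    (hδ : ∀ (r : R) (e : E), δ (r • e) = omap f ⊤ r • δ e) :
    ∃! g : pullbackTilde f E ⟶ N, ∀ e, g.app ⊤ (gen f E e) = δ e := by
  let δ' : E →ₗ[R] rsections f N :=
    { toFun := fun e => (toSec f N).symm (δ e)
      map_add' := fun a b => by rw [map_add, map_add]
      map_smul' := fun r e => (toSec f N).injective (by
        rw [RingHom.id_apply, toSec_smul, AddEquiv.apply_symm_apply, AddEquiv.apply_symm_apply, hδ]) }
  let t : ModuleCat.of R E ⟶ rsections f N :=
    ModuleCat.ofHom (X := E) (Y := rsections f N) δ'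
  have key : ∀ g : pullbackTilde f E ⟶ N, (∀ e, g.app ⊤ (gen f E e) = δ e) ↔
      ((pullbackTildeAdj f).homEquiv (ModuleCat.of R E) N) g = t := by
    intro g
    have := (pullbackTildeAdj f).homEquiv_unit (ModuleCat.of R E) N g
    constructor
    · intro h
      refine this.trans ?_
      refine ModuleCat.hom_ext (LinearMap.ext fun e => ?_)
      exact h e
    · intro h e
      have h2 : ((Scheme.Modules.pushforward f ⋙ moduleSpecΓFunctor (R := .of R)).map g).hom
          (toRsections f E e) = δ' e :=
        LinearMap.congr_fun (congrArg ModuleCat.Hom.hom (this.symm.trans h)) e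
      exact h2
  refine ⟨((pullbackTildeAdj f).homEquiv (ModuleCat.of R E) N).symm t, ?_, ?_⟩
  · exact (key _).2 (Equiv.apply_symm_apply _ _)
  · intro g hg
    exact ((Equiv.symm_apply_eq _).2 ((key g).1 hg).symm).symm

/-- The presheaf `V ↦ Γ(N, V ∩ U)`. -/
noncomputable def interPresheaf (N : X.Modules) (U : X.Opens) : TopCat.Presheaf Ab.{u} X where
  obj V := Γ(N, V.unop ⊓ U)
  map {V W} i := AddCommGrpCat.ofHom (res N (inf_le_inf_right U i.unop.le))
  map_id V := by ext m; exact res_self N _ _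
  map_comp i j := by ext m; exact (res_res N _ _ _).symm

noncomputable instance (N : X.Modules) (U : X.Opens) (V : X.Opensᵒᵖ) :
    Module (X.ringCatSheaf.obj.obj V) ((interPresheaf N U).obj V) :=
  Module.compHom (R := Γ(X, V.unop ⊓ U)) Γ(N, V.unop ⊓ U) (ores (inf_le_left : V.unop ⊓ U ≤ V.unop))

/-- The `𝒪_X`-module `V ↦ Γ(N, V ∩ U)`. -/
noncomputable def interModule (N : X.Modules) (U : X.Opens) : X.Modules where
  val := PresheafOfModules.ofPresheaf (interPresheaf N U) (by
    intro V W i (r : Γ(X, V.unop)) (m : Γ(N, V.unop ⊓ U))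
    change res N (inf_le_inf_right U i.unop.le) (ores (inf_le_left : V.unop ⊓ U ≤ _) r • m) =
      ores (inf_le_left : W.unop ⊓ U ≤ _) (ores i.unop.le r) • res N _ m
    rw [res_smul, ores_ores, ores_ores])
  isSheaf := by
    refine (TopCat.Presheaf.isSheaf_iff_isSheafUniqueGluing (interPresheaf N U)).2 ?_
    intro ι V sf hsf
    obtain ⟨m, hm⟩ := exists_glue N (fun i => V i ⊓ U) (U := iSup V ⊓ U)
      (fun i => inf_le_inf_right U (le_iSup V i)) (by rw [iSup_inf_eq]) sf fun i j => by
        have h1 := congrArg (res N (le_inf (inf_le_inf inf_le_left inf_le_left)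
          (inf_le_left.trans inf_le_right) :
          (V i ⊓ U) ⊓ (V j ⊓ U) ≤ (V i ⊓ V j) ⊓ U)) (hsf i j)
        exact ((res_res N _ _ (sf i)).symm.trans h1).trans (res_res N _ _ (sf j))
    refine ⟨m, hm, fun n hn => eq_of_locally_eq N _ _ fun x hx => ?_⟩
    obtain ⟨i, hi⟩ := Opens.mem_iSup.1 hx.1
    exact ⟨V i ⊓ U, inf_le_inf_right U (le_iSup V i), ⟨hi, hx.2⟩, (hn i).trans (hm i).symm⟩

/-- Sections of `interModule N U`. -/
noncomputable def interSec (N : X.Modules) (U V : X.Opens) : Γ(interModule N U, V) ≃+ Γ(N, V ⊓ U) :=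
  AddEquiv.refl Γ(N, V ⊓ U)

theorem interSec_smul (N : X.Modules) (U V : X.Opens) (r : Γ(X, V)) (m : Γ(interModule N U, V)) :
    interSec N U V (r • m) = ores (inf_le_left : V ⊓ U ≤ V) r • interSec N U V m := rfl

theorem interSec_res (N : X.Modules) (U : X.Opens) {V W : X.Opens} (h : W ≤ V)
    (m : Γ(interModule N U, V)) :
    interSec N U W (res _ h m) = res N (inf_le_inf_right U h) (interSec N U V m) := rfl

variable {M N : X.Modules} {U : X.Opens}

/-- The map on sections underlying `localHomToHom`. -/
noncomputable def localHomToHomAux (φ : localHom M N U) (V : X.Opens) : Γ(M, V) →+ Γ(N, V ⊓ U) :=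
  (happ φ inf_le_right).toAddMonoidHom.comp (res M inf_le_left)

theorem localHomToHomAux_apply (φ : localHom M N U) (V : X.Opens) (m : Γ(M, V)) :
    localHomToHomAux φ V m = happ φ inf_le_right (res M inf_le_left m) := rfl

theorem localHomToHomAux_res (φ : localHom M N U) {V W : X.Opens} (h : W ≤ V) (m : Γ(M, V)) :
    localHomToHomAux φ W (res M h m) = res N (inf_le_inf_right U h) (localHomToHomAux φ V m) := by
  rw [localHomToHomAux_apply, localHomToHomAux_apply, ← happ_res, res_res, res_res]

theorem localHomToHomAux_smul (φ : localHom M N U) (V : X.Opens) (r : Γ(X, V)) (m : Γ(M, V)) :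
    localHomToHomAux φ V (r • m) = ores (inf_le_left : V ⊓ U ≤ V) r • localHomToHomAux φ V m := by
  rw [localHomToHomAux_apply, localHomToHomAux_apply, res_smul, map_smul]

/-- A local homomorphism `M|_U ⟶ N|_U` as a morphism `M ⟶ interModule N U`. -/
noncomputable def localHomToHom (φ : localHom M N U) : M ⟶ interModule N U :=
  ⟨PresheafOfModules.homMk (M₁ := M.val) (M₂ := (interModule N U).val)
    { app V := AddCommGrpCat.ofHom (localHomToHomAux φ V.unop)
      naturality V W i := by
        ext m
        exact localHomToHomAux_res φ i.unop.le m }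
    (fun V r m => localHomToHomAux_smul φ V.unop r m)⟩

theorem interSec_localHomToHom (φ : localHom M N U) (V : X.Opens) (m : Γ(M, V)) :
    interSec N U V ((localHomToHom φ).app V m) = happ φ inf_le_right (res M inf_le_left m) := rfl

/-- A morphism `M ⟶ interModule N U` as a local homomorphism. -/
noncomputable def homToLocalHom (g : M ⟶ interModule N U) : localHom M N U :=
  ⟨fun V =>
    { toFun := fun m => res N (le_inf le_rfl V.2) (interSec N U V.1 (g.app V.1 m))
      map_add' := fun _ _ => by rw [map_add, map_add, map_add]
      map_smul' := fun r m => by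
        rw [Scheme.Modules.Hom.app_smul, interSec_smul, res_smul, ores_ores, ores_self, RingHom.id_apply] }, by
    intro V W h m
    change res N h (res N _ (interSec N U V.1 (g.app V.1 m))) =
      res N _ (interSec N U W.1 (g.app W.1 (res M h m)))
    rw [app_res, interSec_res, res_res, res_res]⟩

theorem happ_homToLocalHom (g : M ⟶ interModule N U) {V : X.Opens} (h : V ≤ U) (m : Γ(M, V)) :
    happ (homToLocalHom g) h m = res N (le_inf le_rfl h) (interSec N U V (g.app V m)) := rfl

/-- A homomorphism over `U` with values in `N` is a global morphism to `interModule N U`, the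
push-forward of the restriction of `N`. The adjunction applies to the latter, so the values on the
generators from `E` determine it. -/
theorem localHom_ext_gen {φ ψ : localHom (pullbackTilde f E) N U}
    (h : ∀ e, happ φ le_rfl (res _ le_top (gen f E e)) = happ ψ le_rfl (res _ le_top (gen f E e))) :
    φ = ψ := by
  have key : ∀ φ : localHom (pullbackTilde f E) N U, ∀ e,
      interSec N U ⊤ ((localHomToHom φ).app ⊤ (gen f E e)) =
        res N inf_le_right (happ φ le_rfl (res _ le_top (gen f E e))) := by
    intro φ e
    rw [interSec_localHomToHom, ← happ_res, res_res]
  have h1 : localHomToHom φ = localHomToHom ψ := by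
    let δ : E →+ Γ(interModule N U, ⊤) := ((localHomToHom ψ).app ⊤).hom.comp (gen f E)
    refine (existsUnique_hom f E (interModule N U) δ fun r e => ?_).unique (fun e => ?_) fun e => rfl
    · change (localHomToHom ψ).app ⊤ (gen f E (r • e)) = _
      rw [gen_smul, Scheme.Modules.Hom.app_smul]; rfl
    · refine (interSec N U ⊤).injective ?_
      change _ = interSec N U ⊤ ((localHomToHom ψ).app ⊤ (gen f E e))
      rw [key, key, h]
  refine localHom_ext fun V hV m => ?_
  have h2 := congrArg (fun t => res N (le_inf le_rfl hV) (interSec N U V (t.app V m))) h1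
  simpa only [interSec_localHomToHom, ← happ_res, res_res, res_self] using h2

theorem exists_localHom_gen (δ : E →+ Γ(N, U)) (hδ : ∀ (r : R) (e : E), δ (r • e) = omap f U r • δ e) :
    ∃ φ : localHom (pullbackTilde f E) N U, ∀ e, happ φ le_rfl (res _ le_top (gen f E e)) = δ e := by
  let δ' : E →+ Γ(interModule N U, ⊤) :=
    (interSec N U ⊤).symm.toAddMonoidHom.comp ((res N inf_le_right).comp δ)
  have hδ' : ∀ e, interSec N U ⊤ (δ' e) = res N inf_le_right (δ e) := fun e => rfl
  obtain ⟨g, hg, -⟩ := existsUnique_hom f E (interModule N U) δ' fun r e => by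
    refine (interSec N U ⊤).injective ?_
    rw [interSec_smul, hδ', hδ', hδ, res_smul, ores_omap, ores_omap]
  refine ⟨homToLocalHom g, fun e => ?_⟩
  rw [happ_homToLocalHom, app_res, hg, interSec_res, hδ', res_res, res_res, res_self]

/-- Functions as sections of the structure module. -/
noncomputable def unitSec (U : X.Opens) : Γ(structureModule X, U) ≃ₗ[Γ(X, U)] Γ(X, U) :=
  LinearEquiv.refl Γ(X, U) Γ(X, U)

theorem unitSec_res {U V : X.Opens} (h : V ≤ U) (m : Γ(structureModule X, U)) :
    unitSec V (res _ h m) = ores h (unitSec U m) := rfl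

/-- The pairing of a local section of the dual of the pull-back of `E` with an element of `E`. -/
noncomputable def ev (d : Γ(dual (pullbackTilde f E), U)) (e : E) : Γ(X, U) :=
  unitSec U (happ (M := pullbackTilde f E) (N := structureModule X) d le_rfl
    (res _ le_top (gen f E e)))

theorem ev_ext {d d' : Γ(dual (pullbackTilde f E), U)} (h : ∀ e, ev f E d e = ev f E d' e) : d = d' :=
  localHom_ext_gen f E fun e => (unitSec U).injective (h e)

/-- Together with `ev_ext` this identifies the sections of the dual over `U` with the `R`-linear
maps from `E` to the functions on `U`, for an arbitrary open `U`. -/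
theorem exists_ev (δ : E → Γ(X, U)) (hadd : ∀ e e', δ (e + e') = δ e + δ e')
    (hδ : ∀ (r : R) (e : E), δ (r • e) = omap f U r * δ e) :
    ∃ d : Γ(dual (pullbackTilde f E), U), ∀ e, ev f E d e = δ e := by
  obtain ⟨φ, hφ⟩ := exists_localHom_gen f E (N := structureModule X)
    (((unitSec U).symm.toAddEquiv.toAddMonoidHom).comp (AddMonoidHom.mk' δ hadd)) fun r e => by
      change (unitSec U).symm (δ (r • e)) = omap f U r • (unitSec U).symm (δ e)
      rw [hδ, ← smul_eq_mul, map_smul]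
  refine ⟨φ, fun e => ?_⟩
  exact (congrArg (unitSec U) (hφ e)).trans ((unitSec U).apply_symm_apply _)

theorem ev_add_right (d : Γ(dual (pullbackTilde f E), U)) (e e' : E) :
    ev f E d (e + e') = ev f E d e + ev f E d e' := by
  simp only [ev, map_add]

theorem ev_zero_right (d : Γ(dual (pullbackTilde f E), U)) : ev f E d 0 = 0 := by
  simp only [ev, map_zero]

theorem ev_smul_right (d : Γ(dual (pullbackTilde f E), U)) (r : R) (e : E) :
    ev f E d (r • e) = omap f U r * ev f E d e := by
  simp only [ev]
  rw [gen_smul, res_smul, ores_omap, map_smul, map_smul, smul_eq_mul]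

theorem ev_add (d d' : Γ(dual (pullbackTilde f E), U)) (e : E) :
    ev f E (d + d') e = ev f E d e + ev f E d' e := rfl

theorem ev_zero (e : E) : ev f E (0 : Γ(dual (pullbackTilde f E), U)) e = 0 := rfl

theorem ev_smul (r : Γ(X, U)) (d : Γ(dual (pullbackTilde f E), U)) (e : E) :
    ev f E (r • d) e = r * ev f E d e := by
  change unitSec U (ores le_rfl r • _) = _
  rw [ores_self, map_smul]; rfl

theorem ev_res {V : X.Opens} (h : V ≤ U) (d : Γ(dual (pullbackTilde f E), U)) (e : E) :
    ev f E (res _ h d) e = ores h (ev f E d e) := by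
  change unitSec V (happ (M := pullbackTilde f E) (N := structureModule X) d h
    (res _ le_top (gen f E e))) = _
  rw [ev, ← unitSec_res]
  refine congrArg (unitSec V) (Eq.trans ?_
    (happ_res (M := pullbackTilde f E) (N := structureModule X) d le_rfl h _))
  rw [res_res]

theorem ev_sum {ι : Type*} (s : Finset ι) (d : ι → Γ(dual (pullbackTilde f E), U)) (e : E) :
    ev f E (∑ i ∈ s, d i) e = ∑ i ∈ s, ev f E (d i) e := by
  classical
  induction s using Finset.induction_on with
  | empty => simp [ev_zero]
  | insert a s ha h => rw [Finset.sum_insert ha, Finset.sum_insert ha, ev_add, h]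

end DualPairing

end PullbackDual

/-! ### Comparing sections of `ℰxt¹` with vectors of functions -/

section ExtRelations

section SheafHomSections

variable {X : Scheme.{u}} {M N N' : X.Modules} {U V W : X.Opens}

/-- Evaluation of a section of `ℋom(M, N)`. -/
noncomputable def sapp (φ : Γ((sheafHom M).obj N, U)) (h : V ≤ U) : Γ(M, V) →ₗ[Γ(X, V)] Γ(N, V) :=
  happ (M := M) (N := N) φ h

theorem sapp_res (φ : Γ((sheafHom M).obj N, U)) (hV : V ≤ U) (h : W ≤ V) (m : Γ(M, V)) :
    sapp φ (h.trans hV) (res M h m) = res N h (sapp φ hV m) :=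
  happ_res (M := M) (N := N) φ hV h m

theorem res_sapp (φ : Γ((sheafHom M).obj N, U)) (hV : V ≤ U) (h : W ≤ V) (m : Γ(M, W)) :
    sapp (res _ hV φ) h m = sapp φ (h.trans hV) m := rfl

theorem sapp_map (g : N ⟶ N') (φ : Γ((sheafHom M).obj N, U)) (h : V ≤ U) (m : Γ(M, V)) :
    sapp (((sheafHom M).map g).app U φ) h m = g.app V (sapp φ h m) := rfl

theorem sapp_add (φ ψ : Γ((sheafHom M).obj N, U)) (h : V ≤ U) (m : Γ(M, V)) :
    sapp (φ + ψ) h m = sapp φ h m + sapp ψ h m := rfl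

theorem sapp_smul (r : Γ(X, U)) (φ : Γ((sheafHom M).obj N, U)) (h : V ≤ U) (m : Γ(M, V)) :
    sapp (r • φ) h m = ores h r • sapp φ h m := rfl

theorem sapp_zero (h : V ≤ U) (m : Γ(M, V)) : sapp (0 : Γ((sheafHom M).obj N, U)) h m = 0 := rfl

theorem sapp_ext {φ ψ : Γ((sheafHom M).obj N, U)}
    (h : ∀ (V : X.Opens) (hV : V ≤ U) (m : Γ(M, V)), sapp φ hV m = sapp ψ hV m) : φ = ψ :=
  localHom_ext (M := M) (N := N) h

theorem exists_common_open {ι : Type*} [Finite ι] (P : ι → ∀ V : X.Opens, V ≤ U → Prop)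
    (hP : ∀ i (V W : X.Opens) (hV : V ≤ U) (h : W ≤ V), P i V hV → P i W (h.trans hV))
    {x : X} (hx : x ∈ U) (h : ∀ i, ∃ (V : X.Opens) (hV : V ≤ U), x ∈ V ∧ P i V hV) :
    ∃ (V : X.Opens) (hV : V ≤ U), x ∈ V ∧ ∀ i, P i V hV := by
  classical
  have := Fintype.ofFinite ι
  have key : ∀ s : Finset ι, ∃ (V : X.Opens) (hV : V ≤ U), x ∈ V ∧ ∀ i ∈ s, P i V hV := by
    intro s
    induction s using Finset.induction_on with
    | empty => exact ⟨U, le_rfl, hx, by simp⟩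
    | insert a s ha ih =>
      obtain ⟨V, hV, hxV, h1⟩ := ih
      obtain ⟨W, hW, hxW, h2⟩ := h a
      refine ⟨V ⊓ W, inf_le_left.trans hV, ⟨hxV, hxW⟩, fun i hi => ?_⟩
      rcases Finset.mem_insert.1 hi with rfl | hi
      · exact hP _ _ _ hW inf_le_right h2
      · exact hP _ _ _ hV inf_le_left (h1 i hi)
  obtain ⟨V, hV, hxV, h1⟩ := key Finset.univ
  exact ⟨V, hV, hxV, fun i => h1 i (Finset.mem_univ i)⟩

end SheafHomSections

open Matrix

/-- Multiplication by `r` splits the presentation of the dual of `E` given by the generators `g` and the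
relation matrix `α`, compatibly with a factorization of `r` on `E` through a free module. -/
def SplitsUpTo {R : Type*} [CommRing R] {E : Type*} [AddCommGroup E] [Module R E] {a b : ℕ}
    (g : Fin b → Module.Dual R E) (α : Matrix (Fin b) (Fin a) R) (r : R) : Prop :=
  ∃ (τ : Matrix (Fin a) (Fin b) R) (e : Fin b → E), τ * α = r • (1 : Matrix (Fin a) (Fin a) R) ∧
    r • (1 : Matrix (Fin b) (Fin b) R) = Matrix.of (fun i j => g j (e i)) + α * τ ∧
    ∀ m : E, r • m = ∑ j, g j m • e j

section Relation

variable {X : Scheme.{u}} {R : Type u} [CommRing R] (f : X ⟶ Spec (.of R))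
  {E : Type u} [AddCommGroup E] [Module R E] {a b : ℕ}
  (g : Fin b → Module.Dual R E) (α : Matrix (Fin b) (Fin a) R)

/-- The matrix `α` over the ring of functions on `U`. -/
noncomputable def omat (U : X.Opens) : Matrix (Fin b) (Fin a) Γ(X, U) := α.map (omap f U)

theorem exists_gsec (U : X.Opens) (j : Fin b) :
    ∃ d : Γ(dual (pullbackTilde f E), U), ∀ e, ev f E d e = omap f U (g j e) :=
  exists_ev f E _ (by simp) (by simp)

/-- The sections of `(f^* E)^∨` defined by linear forms on `E`. -/
noncomputable def gsec (U : X.Opens) (j : Fin b) : Γ(dual (pullbackTilde f E), U) :=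
  (exists_gsec f g U j).choose

theorem ev_gsec (U : X.Opens) (j : Fin b) (e : E) : ev f E (gsec f g U j) e = omap f U (g j e) :=
  (exists_gsec f g U j).choose_spec e

theorem gsec_res {U V : X.Opens} (h : V ≤ U) (j : Fin b) : res _ h (gsec f g U j) = gsec f g V j :=
  ev_ext f E fun e => by rw [ev_res, ev_gsec, ev_gsec, ores_omap]

variable (T : ExtOneData (dual (pullbackTilde f E)) (structureModule X))

/-- A section `s` of `ℰxt¹((f^* E)^∨, 𝒪_X)` and a vector `v` of functions correspond to each other
in the sequence attached to the presentation `α` of the dual of `E`. -/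
def Rel (U : X.Opens) (s : Γ(sheafExt 1 (dual (pullbackTilde f E)) (structureModule X), U))
    (v : Fin a → Γ(X, U)) : Prop :=
  ∃ z : Γ(T.Z, U), T.π.app U z = s ∧ ∃ ψ : Fin b → Γ(T.J₀, U),
    (∀ j, T.d.app U (ψ j) = sapp (T.cyc.app U z) le_rfl (gsec f g U j)) ∧
    ∀ k, ∑ j, omat f α U j k • ψ j = T.ι.app U ((unitSec U).symm (v k))

variable {f g α T}

theorem ι_smul {U : X.Opens} (r c : Γ(X, U)) :
    T.ι.app U ((unitSec U).symm (r * c)) = r • T.ι.app U ((unitSec U).symm c) := by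
  rw [← smul_eq_mul, map_smul, Scheme.Modules.Hom.app_smul]

theorem ι_res {U V : X.Opens} (h : V ≤ U) (c : Γ(X, U)) :
    T.ι.app V ((unitSec V).symm (ores h c)) = res _ h (T.ι.app U ((unitSec U).symm c)) := by
  rw [← app_res]; rfl

theorem ι_eq_iff {U : X.Opens} (c c' : Γ(X, U)) :
    T.ι.app U ((unitSec U).symm c) = T.ι.app U ((unitSec U).symm c') ↔ c = c' :=
  ⟨fun h => (unitSec U).symm.injective (T.ι_injective U h), fun h => by rw [h]⟩

theorem exists_ι' {U : X.Opens} (j : Γ(T.J₀, U)) (h : T.d.app U j = 0) :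
    ∃ c : Γ(X, U), T.ι.app U ((unitSec U).symm c) = j := by
  obtain ⟨c, hc⟩ := T.exists_ι U j h
  exact ⟨unitSec U c, by rw [LinearEquiv.symm_apply_apply, hc]⟩

theorem omat_res {U V : X.Opens} (h : V ≤ U) (j : Fin b) (k : Fin a) :
    ores h (omat f α U j k) = omat f α V j k := ores_omap f h _

theorem Rel.restrict {U V : X.Opens} (h : V ≤ U)
    {s : Γ(sheafExt 1 (dual (pullbackTilde f E)) (structureModule X), U)} {v : Fin a → Γ(X, U)}
    (hs : Rel f g α T U s v) : Rel f g α T V (res _ h s) (fun k => ores h (v k)) := by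
  obtain ⟨z, hz, ψ, h1, h2⟩ := hs
  refine ⟨res _ h z, by rw [app_res, hz], fun j => res _ h (ψ j), fun j => ?_,
    fun k => ?_⟩
  · rw [app_res, h1, app_res, res_sapp, ← gsec_res f g h, ← sapp_res]
  · rw [ι_res, ← h2, map_sum]
    exact Finset.sum_congr rfl fun j _ => by rw [res_smul, omat_res]

theorem Rel.add {U : X.Opens}
    {s s' : Γ(sheafExt 1 (dual (pullbackTilde f E)) (structureModule X), U)} {v v' : Fin a → Γ(X, U)}
    (hs : Rel f g α T U s v) (hs' : Rel f g α T U s' v') : Rel f g α T U (s + s') (v + v') := by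
  obtain ⟨z, hz, ψ, h1, h2⟩ := hs
  obtain ⟨z', hz', ψ', h1', h2'⟩ := hs'
  refine ⟨z + z', by rw [map_add, hz, hz'], ψ + ψ', fun j => ?_, fun k => ?_⟩
  · rw [Pi.add_apply, map_add, h1, h1', map_add, sapp_add]
  · simp only [Pi.add_apply, smul_add, Finset.sum_add_distrib, h2, h2', map_add]

theorem Rel.smul {U : X.Opens} (r : Γ(X, U))
    {s : Γ(sheafExt 1 (dual (pullbackTilde f E)) (structureModule X), U)} {v : Fin a → Γ(X, U)}
    (hs : Rel f g α T U s v) : Rel f g α T U (r • s) (r • v) := by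
  obtain ⟨z, hz, ψ, h1, h2⟩ := hs
  refine ⟨r • z, by rw [Scheme.Modules.Hom.app_smul, hz], r • ψ, fun j => ?_, fun k => ?_⟩
  · rw [Pi.smul_apply, Scheme.Modules.Hom.app_smul, h1, Scheme.Modules.Hom.app_smul, sapp_smul,
      ores_self]
  · rw [Pi.smul_apply, smul_eq_mul, ι_smul, ← h2, Finset.smul_sum]
    exact Finset.sum_congr rfl fun j _ => by rw [Pi.smul_apply, smul_comm]

/-- This is the indeterminacy of the vector: the lifts `ψ j` are unique only up to functions `w j`,
and changing them alters the vector by `w ᵥ* α`. -/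
theorem rel_zero_vecMul {U : X.Opens} (w : Fin b → Γ(X, U)) :
    Rel f g α T U 0 (w ᵥ* omat f α U) := by
  refine ⟨0, map_zero _, fun j => T.ι.app U ((unitSec U).symm (w j)), fun j => ?_, fun k => ?_⟩
  · rw [T.d_ι, map_zero, sapp_zero]
  · simp only [vecMul, dotProduct, map_sum, ι_smul, mul_comm (w _)]

theorem Rel.add_vecMul {U : X.Opens} (w : Fin b → Γ(X, U))
    {s : Γ(sheafExt 1 (dual (pullbackTilde f E)) (structureModule X), U)} {v : Fin a → Γ(X, U)}
    (hs : Rel f g α T U s v) : Rel f g α T U s (v + w ᵥ* omat f α U) := by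
  simpa using hs.add (rel_zero_vecMul w)

theorem sum_smul_gsec (hα : ∀ k, ∑ j, α j k • g j = 0) (U : X.Opens) (k : Fin a) :
    ∑ j, omat f α U j k • gsec f g U j = 0 :=
  ev_ext f E fun e => by
    rw [ev_sum, ev_zero]
    simp only [ev_smul, ev_gsec, omat, Matrix.map_apply, ← map_mul, ← map_sum]
    have := LinearMap.congr_fun (hα k) e
    simp only [LinearMap.sum_apply, LinearMap.smul_apply, smul_eq_mul, LinearMap.zero_apply] at this
    rw [this, map_zero]

/-- Every section of `ℰxt¹` locally corresponds to a vector of functions. -/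
theorem exists_rel (hα : ∀ k, ∑ j, α j k • g j = 0) {U : X.Opens}
    (s : Γ(sheafExt 1 (dual (pullbackTilde f E)) (structureModule X), U)) {x : X} (hx : x ∈ U) :
    ∃ (V : X.Opens) (hV : V ≤ U), x ∈ V ∧ ∃ v, Rel f g α T V (res _ hV s) v := by
  obtain ⟨V, hV, hxV, z, hz⟩ := T.exists_cyc U s x hx
  obtain ⟨W, hW, hxW, hψ⟩ := exists_common_open (U := V)
    (fun j W hW => ∃ ψ, T.d.app W ψ = res _ hW (sapp (T.cyc.app V z) le_rfl (gsec f g V j)))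
    (fun j W W' hW h ⟨ψ, hψ⟩ => ⟨res _ h ψ, by rw [app_res, hψ, res_res]⟩) hxV
    (fun j => T.cyc_lift V z V le_rfl (gsec f g V j) x hxV)
  choose ψ hψ using hψ
  have h1 : ∀ j, T.d.app W (ψ j) = sapp (T.cyc.app W (res _ hW z)) le_rfl (gsec f g W j) := by
    intro j
    rw [hψ, app_res, res_sapp, ← gsec_res f g hW, ← sapp_res]
  -- The columns of `α` are relations between the sections `gsec`, so the corresponding combinations
  -- of the lifts are killed by `d` and come from functions.
  have h2 : ∀ k, ∃ c : Γ(X, W), T.ι.app W ((unitSec W).symm c) = ∑ j, omat f α W j k • ψ j := by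
    intro k
    refine exists_ι' _ ?_
    rw [map_sum]
    simp only [Scheme.Modules.Hom.app_smul, h1, ← map_smul, ← map_sum]
    rw [sum_smul_gsec hα, map_zero]
  choose v hv using h2
  exact ⟨W, hW.trans hV, hxW, v, res _ hW z, by rw [app_res, hz, res_res], ψ, h1,
    fun k => (hv k).symm⟩

/-- A vector corresponding to the zero section is locally in the image of the transpose of `α`. -/
theorem Rel.exists_of_zero (hα : ∀ k, ∑ j, α j k • g j = 0) {U : X.Opens} {v : Fin a → Γ(X, U)}
    (h : Rel f g α T U 0 v) {x : X} (hx : x ∈ U) :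
    ∃ (V : X.Opens) (hV : V ≤ U), x ∈ V ∧ ∃ w : Fin b → Γ(X, V),
      (fun k => ores hV (v k)) = w ᵥ* omat f α V := by
  obtain ⟨z, hz, ψ, h1, h2⟩ := h
  obtain ⟨V, hV, hxV, χ, hχ⟩ := T.exists_of_π U z hz x hx
  -- When `z` is the coboundary of `χ`, both `ψ j` and the value of `χ` at `gsec j` lift the same
  -- section, so they differ by a function.
  have h3 : ∀ j, ∃ c : Γ(X, V), T.ι.app V ((unitSec V).symm c) =
      res _ hV (ψ j) - sapp χ le_rfl (gsec f g V j) := by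
    intro j
    refine exists_ι' _ ?_
    rw [map_sub, app_res, h1, ← sapp_map, hχ, res_sapp, ← gsec_res f g hV, ← sapp_res, sub_self]
  choose w hw using h3
  refine ⟨V, hV, hxV, w, funext fun k => (ι_eq_iff (T := T) _ _).1 ?_⟩
  have h4 : ∑ j, omat f α V j k • sapp χ le_rfl (gsec f g V j) = 0 := by
    simp only [← map_smul, ← map_sum]
    rw [sum_smul_gsec hα, map_zero]
  have h5 : (w ᵥ* omat f α V) k = ∑ j, omat f α V j k * w j := by
    simp only [vecMul, dotProduct, mul_comm]
  rw [ι_res, ← h2, map_sum, h5, map_sum, map_sum, ← sub_zero (∑ j, res _ _ _), ← h4,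
    ← Finset.sum_sub_distrib]
  refine Finset.sum_congr rfl fun j _ => ?_
  rw [ι_smul, hw, smul_sub, res_smul, omat_res]

theorem map_mulVec_ores {m n : ℕ} {U V : X.Opens} (h : V ≤ U) (A : Matrix (Fin m) (Fin n) R)
    (w : Fin n → Γ(X, U)) (i : Fin m) :
    ores h ((omat f A U *ᵥ w) i) = (omat f A V *ᵥ fun j => ores h (w j)) i := by
  simp [mulVec, dotProduct, omat_res]

/-- Elements of `R` satisfying a form of regularity on all opens contained in `U`. -/
structure RegularOn (f : X ⟶ Spec (.of R)) (U : X.Opens) (r t : R) : Prop where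
  left (W : X.Opens) (hW : W ≤ U) (c : Γ(X, W)) (h : omap f W r * c = 0) : c = 0
  right (W : X.Opens) (hW : W ≤ U) (c e : Γ(X, W)) (h : omap f W t * c = omap f W r * e)
    (x : X) (hx : x ∈ W) :
    ∃ (V : X.Opens) (hV : V ≤ W), x ∈ V ∧ ∃ c', ores hV c = omap f V r * c'

/-- Applying `d` to the factorization of `r` on `E` shows that `r` kills the dual modulo the
subsheaf generated by the `gsec`. -/
theorem smul_eq_sum_gsec {r : R} {e : Fin b → E} (he : ∀ m : E, r • m = ∑ j, g j m • e j)
    {W : X.Opens} (d : Γ(dual (pullbackTilde f E), W)) :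
    omap f W r • d = ∑ j, ev f E d (e j) • gsec f g W j := by
  refine ev_ext f E fun m => ?_
  rw [ev_smul, ← ev_smul_right, he, ev_sum]
  have : ∀ s : Finset (Fin b), ev f E d (∑ j ∈ s, g j m • e j) =
      ∑ j ∈ s, ev f E (ev f E d (e j) • gsec f g W j) m := by
    intro s
    classical
    induction s using Finset.induction_on with
    | empty =>
      rw [Finset.sum_empty, Finset.sum_empty, ev_zero_right]
    | insert i s hi ih =>
      rw [Finset.sum_insert hi, Finset.sum_insert hi, ev_add_right, ih, ev_smul_right, ev_smul,
        ev_gsec, mul_comm]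
  exact this _

/-- Evaluating the relation on the elements `e i` kills the first summand of `r`, so `r` moves every
relation into the column space of `α`. -/
theorem omap_mulVec_of_sum_eq_zero {r : R} {τ : Matrix (Fin a) (Fin b) R} {e : Fin b → E}
    (h1 : r • (1 : Matrix (Fin b) (Fin b) R) = Matrix.of (fun i j => g j (e i)) + α * τ)
    {W : X.Opens} (u : Fin b → Γ(X, W)) (hu : ∑ j, u j • gsec f g W j = 0) :
    omap f W r • u = omat f α W *ᵥ (omat f τ W *ᵥ u) := by
  have h2 : omap f W r • (1 : Matrix (Fin b) (Fin b) Γ(X, W)) =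
      (Matrix.of fun i j => omap f W (g j (e i))) + omat f α W * omat f τ W := by
    have := congrArg (fun A : Matrix (Fin b) (Fin b) R => A.map (omap f W)) h1
    have h3 : (α * τ).map (omap f W) = omat f α W * omat f τ W := Matrix.map_mul
    rw [← h3]
    ext i j
    have := congrFun (congrFun this i) j
    simp only [Matrix.map_apply, Matrix.smul_apply, Matrix.add_apply, Matrix.of_apply, smul_eq_mul,
      map_mul, map_add] at this ⊢
    rw [← this, Matrix.one_apply, Matrix.one_apply]
    split_ifs <;> simp
  have h4 : (Matrix.of fun i j => omap f W (g j (e i))) *ᵥ u = 0 := by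
    funext i
    have := congrArg (fun d => ev f E d (e i)) hu
    simp only [ev_sum, ev_smul, ev_gsec, ev_zero] at this
    simpa [mulVec, dotProduct, mul_comm] using this
  rw [mulVec_mulVec, ← zero_add ((omat f α W * omat f τ W) *ᵥ u), ← h4, ← add_mulVec, ← h2,
    smul_mulVec, one_mulVec]

theorem omat_mulVec_mulVec {r : R} {τ : Matrix (Fin a) (Fin b) R}
    (h : τ * α = r • (1 : Matrix (Fin a) (Fin a) R)) {W : X.Opens} (w : Fin a → Γ(X, W)) :
    omat f τ W *ᵥ (omat f α W *ᵥ w) = omap f W r • w := by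
  have h3 : (τ * α).map (omap f W) = omat f τ W * omat f α W := Matrix.map_mul
  rw [mulVec_mulVec, ← h3, h]
  have : (r • (1 : Matrix (Fin a) (Fin a) R)).map (omap f W) = omap f W r • 1 := by
    ext i j
    by_cases hij : i = j <;> simp [hij]
  rw [this, smul_mulVec, one_mulVec]

/-- The relations between the sections `gsec` are locally generated by the columns of `α`. -/
theorem exists_mulVec_of_sum_eq_zero {r t : R} (hr : SplitsUpTo g α r) (ht : SplitsUpTo g α t)
    {U : X.Opens} (hU : RegularOn f U r t) {W : X.Opens} (hW : W ≤ U) (u : Fin b → Γ(X, W))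
    (hu : ∑ j, u j • gsec f g W j = 0) {x : X} (hx : x ∈ W) :
    ∃ (V : X.Opens) (hV : V ≤ W), x ∈ V ∧ ∃ w, (fun j => ores hV (u j)) = omat f α V *ᵥ w := by
  obtain ⟨τ, e, hτ, he, -⟩ := hr
  obtain ⟨τ', e', hτ', he', -⟩ := ht
  have h1 := omap_mulVec_of_sum_eq_zero he u hu
  have h2 := omap_mulVec_of_sum_eq_zero he' u hu
  set w := omat f τ W *ᵥ u
  set w' := omat f τ' W *ᵥ u
  -- Both `r • u` and `t • u` lie in the image of `α`, which is injective because `τ * α` is the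
  -- nonzerodivisor `r`. Regularity of the pair then divides `w` by `r`, and `u` itself lies in the
  -- image.
  have h3 : omap f W t • w = omap f W r • w' := by
    have h4 : omat f α W *ᵥ (omap f W t • w - omap f W r • w') = 0 := by
      rw [mulVec_sub, mulVec_smul, mulVec_smul, ← h1, ← h2, smul_comm, sub_self]
    have h5 := omat_mulVec_mulVec (f := f) hτ (omap f W t • w - omap f W r • w')
    rw [h4, mulVec_zero] at h5
    funext k
    have h6 := congrFun h5.symm k
    simp only [Pi.smul_apply, Pi.sub_apply, Pi.zero_apply] at h6
    exact sub_eq_zero.1 (hU.left W hW _ h6)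
  obtain ⟨V, hV, hxV, h7⟩ := exists_common_open (U := W)
    (fun k V hV => ∃ c', ores hV (w k) = omap f V r * c')
    (fun k V V' hV h ⟨c', hc'⟩ => ⟨ores h c', by
      have := congrArg (ores h) hc'
      rwa [ores_ores, map_mul, ores_omap] at this⟩) hx
    (fun k => hU.right W hW (w k) (w' k) (congrFun h3 k) x hx)
  choose w'' hw'' using h7
  refine ⟨V, hV, hxV, w'', funext fun j => ?_⟩
  refine sub_eq_zero.1 (hU.left V (hV.trans hW) _ ?_)
  have h8 := congrArg (ores hV) (congrFun h1 j)
  rw [Pi.smul_apply, smul_eq_mul, map_mul, ores_omap, map_mulVec_ores] at h8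
  have h9 : (fun k => ores hV (w k)) = omap f V r • w'' := funext hw''
  rw [h9, mulVec_smul] at h8
  rw [mul_sub, h8, Pi.smul_apply, smul_eq_mul, sub_self]

theorem sum_smul_mulVec_eq_zero {M : X.Modules} {W : X.Opens} (ψ : Fin b → Γ(M, W))
    (hψ : ∀ k, ∑ j, omat f α W j k • ψ j = 0) (w : Fin a → Γ(X, W)) :
    ∑ j, (omat f α W *ᵥ w) j • ψ j = 0 := by
  simp only [mulVec, dotProduct, Finset.sum_smul]
  rw [Finset.sum_comm]
  refine Finset.sum_eq_zero fun k _ => ?_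
  simp only [mul_comm _ (w k), mul_smul]
  rw [← Finset.smul_sum, hψ, smul_zero]

/-- A section of `ℰxt¹` corresponding to the zero vector vanishes. -/
theorem Rel.eq_zero {r t : R} (hr : SplitsUpTo g α r) (ht : SplitsUpTo g α t)
    {U : X.Opens} (hU : RegularOn f U r t)
    {s : Γ(sheafExt 1 (dual (pullbackTilde f E)) (structureModule X), U)}
    (hs : Rel f g α T U s 0) : s = 0 := by
  obtain ⟨z, rfl, ψ, h1, h2⟩ := hs
  have h2' : ∀ (W : X.Opens) (hW : W ≤ U) k, ∑ j, omat f α W j k • res _ hW (ψ j) = 0 := by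
    intro W hW k
    have := congrArg (res _ hW) (h2 k)
    simpa only [map_sum, res_smul, omat_res, Pi.zero_apply, map_zero] using this
  have h1' : ∀ (W : X.Opens) (hW : W ≤ U) j, T.d.app W (res _ hW (ψ j)) =
      sapp (T.cyc.app U z) hW (gsec f g W j) := by
    intro W hW j
    rw [app_res, h1, ← sapp_res, gsec_res]
  -- vanishing of the combinations of `ψ` attached to relations
  have hrel : ∀ (W : X.Opens) (hW : W ≤ U) (u : Fin b → Γ(X, W)),
      ∑ j, u j • gsec f g W j = 0 → ∑ j, u j • res _ hW (ψ j) = 0 := by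
    intro W hW u hu
    refine eq_zero_of_locally _ _ fun x hx => ?_
    obtain ⟨V, hV, hxV, w, hw⟩ := exists_mulVec_of_sum_eq_zero hr ht hU hW u hu hx
    refine ⟨V, hV, hxV, ?_⟩
    rw [map_sum]
    simp only [res_smul, res_res]
    have := sum_smul_mulVec_eq_zero (fun j => res _ (hV.trans hW) (ψ j)) (h2' V _) w
    rw [← hw] at this
    exact this
  -- The lifts `ψ j` define a homomorphism to `T.J₀` on the subsheaf generated by the `gsec`. The
  -- relation describes its extension to the whole dual: `i` must lift the value of the cocycle at
  -- `d`, and `r • i` is prescribed because `r • d` lies in the subsheaf.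
  obtain ⟨χ, hχ⟩ := exists_localHom_of_relation (dual (pullbackTilde f E)) T.J₀ U
    (fun W hW d i => T.d.app W i = sapp (T.cyc.app U z) hW d ∧ ∃ u : Fin b → Γ(X, W),
      omap f W r • d = ∑ j, u j • gsec f g W j ∧ omap f W r • i = ∑ j, u j • res _ hW (ψ j))
    (by
      rintro V W hV h m n ⟨h3, u, h4, h5⟩
      refine ⟨by rw [app_res, h3, sapp_res], fun j => ores h (u j), ?_, ?_⟩
      · have := congrArg (res _ h) h4
        simpa only [map_sum, res_smul, ores_omap, gsec_res] using this
      · have := congrArg (res _ h) h5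
        simpa only [map_sum, res_smul, ores_omap, res_res] using this)
    (by
      rintro V hV m m' n n' ⟨h3, u, h4, h5⟩ ⟨h3', u', h4', h5'⟩
      refine ⟨by rw [map_add, h3, h3', map_add], u + u', ?_, ?_⟩
      · simp only [smul_add, h4, h4', Pi.add_apply, add_smul, Finset.sum_add_distrib]
      · simp only [smul_add, h5, h5', Pi.add_apply, add_smul, Finset.sum_add_distrib])
    (by
      rintro V hV c m n ⟨h3, u, h4, h5⟩
      refine ⟨by rw [Scheme.Modules.Hom.app_smul, h3, map_smul], c • u, ?_, ?_⟩
      · simp only [smul_comm _ c, h4, Pi.smul_apply, smul_assoc, Finset.smul_sum]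
      · simp only [smul_comm _ c, h5, Pi.smul_apply, smul_assoc, Finset.smul_sum])
    (by
      rintro V hV n ⟨h3, u, h4, h5⟩
      rw [map_zero] at h3
      obtain ⟨c, rfl⟩ := exists_ι' n h3
      rw [smul_zero] at h4
      rw [hrel V hV u h4.symm, ← ι_smul] at h5
      have h6 : omap f V r * c = 0 := by
        refine (ι_eq_iff (T := T) _ _).1 ?_
        rw [h5, map_zero, map_zero]
      rw [hU.left V hV c h6, map_zero, map_zero])
    (by
      intro V hV d x hx
      obtain ⟨W, hW, hxW, i, hi⟩ := T.cyc_lift U z V hV d x hx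
      have hWU := hW.trans hV
      set d' := res _ hW d
      have hi' : T.d.app W i = sapp (T.cyc.app U z) hWU d' := by
        rw [hi]; exact (sapp_res _ _ _ _).symm
      obtain ⟨-, e, -, -, he⟩ := hr
      obtain ⟨-, e', -, -, he'⟩ := ht
      have h4 := smul_eq_sum_gsec (f := f) he d'
      have h4' := smul_eq_sum_gsec (f := f) he' d'
      set u : Fin b → Γ(X, W) := fun j => ev f E d' (e j)
      set u' : Fin b → Γ(X, W) := fun j => ev f E d' (e' j)
      -- An arbitrary local lift `i` of the value at `d` fails the prescription for `q` by a
      -- function `c`.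
      have key : ∀ (q : R) (v : Fin b → Γ(X, W)), omap f W q • d' = ∑ j, v j • gsec f g W j →
          ∃ c, T.ι.app W ((unitSec W).symm c) = omap f W q • i - ∑ j, v j • res _ hWU (ψ j) := by
        intro q v hv
        refine exists_ι' _ ?_
        rw [map_sub, map_sum, Scheme.Modules.Hom.app_smul, hi', ← map_smul, hv, map_sum, sub_eq_zero]
        refine Finset.sum_congr rfl fun j _ => ?_
        rw [map_smul, Scheme.Modules.Hom.app_smul, h1']
      obtain ⟨c, hc⟩ := key r u h4
      obtain ⟨c', hc'⟩ := key t u' h4'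
      -- The errors for `r` and `t` are proportional, so the error for `r` is locally `r` times a
      -- function `c''`, and subtracting `c''` from `i` repairs the lift.
      have h5 : omap f W t * c = omap f W r * c' := by
        refine (ι_eq_iff (T := T) _ _).1 ?_
        rw [ι_smul, ι_smul, hc, hc', smul_sub, smul_sub, smul_comm, Finset.smul_sum,
          Finset.smul_sum]
        congr 1
        rw [← sub_eq_zero, ← Finset.sum_sub_distrib]
        simp only [← mul_smul, ← sub_smul]
        refine hrel W hWU _ ?_
        simp only [sub_smul, mul_smul, Finset.sum_sub_distrib, ← Finset.smul_sum]
        rw [← h4, ← h4', smul_comm, sub_self]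
      obtain ⟨W', hW', hxW', c'', hc''⟩ := hU.right W hWU c c' h5 x hxW
      refine ⟨W', hW'.trans hW, hxW', res _ hW' i - T.ι.app W' ((unitSec W').symm c''), ?_,
        fun j => ores hW' (u j), ?_, ?_⟩
      · rw [map_sub, T.d_ι, sub_zero, app_res, hi', ← sapp_res]
        simp only [d', res_res]
      · have := congrArg (res _ hW') h4
        simpa only [map_sum, res_smul, ores_omap, gsec_res, d', res_res] using this
      · have := congrArg (res _ hW') hc
        rw [← ι_res, hc'', ι_smul, map_sub, map_sum] at this
        simp only [res_smul, ores_omap, res_res] at this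
        rw [smul_sub, this, sub_sub_cancel])
  refine T.π_of_exists U z χ (sapp_ext fun V hV d => ?_)
  rw [sapp_map]
  refine eq_of_locally_eq _ _ _ fun x hx => ?_
  obtain ⟨W, hW, hxW, h3, -⟩ := hχ V hV d x hx
  refine ⟨W, hW, hxW, ?_⟩
  rw [← app_res]
  exact h3.trans (sapp_res _ _ _ _)

/-- If `(f^* E)^∨` is free near a point, then `ℰxt¹` vanishes near this point. -/
theorem exists_res_eq_zero_of_free {W₀ : X.Opens} {n : ℕ}
    (e : Fin n → Γ(dual (pullbackTilde f E), W₀))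
    (hspan : ∀ (W : X.Opens) (hW : W ≤ W₀) (d : Γ(dual (pullbackTilde f E), W)), ∀ x ∈ W,
      ∃ (V : X.Opens) (hV : V ≤ W), x ∈ V ∧ ∃ c : Fin n → Γ(X, V),
        res _ hV d = ∑ i, c i • res _ (hV.trans hW) (e i))
    (hind : ∀ (W : X.Opens) (hW : W ≤ W₀) (c : Fin n → Γ(X, W)),
      ∑ i, c i • res _ hW (e i) = 0 → c = 0)
    (T : ExtOneData (dual (pullbackTilde f E)) (structureModule X)) {U : X.Opens}
    (s : Γ(sheafExt 1 (dual (pullbackTilde f E)) (structureModule X), U)) {x : X} (hx : x ∈ U)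
    (hx0 : x ∈ W₀) :
    ∃ (V : X.Opens) (hV : V ≤ U), x ∈ V ∧ res _ hV s = 0 := by
  obtain ⟨V, hV, hxV, z, hz⟩ := T.exists_cyc U s x hx
  obtain ⟨W, hW, hxW, hψ⟩ := exists_common_open (U := V ⊓ W₀)
    (fun i W hW => ∃ ψ, T.d.app W ψ = res _ hW (sapp (T.cyc.app V z) inf_le_left
      (res _ inf_le_right (e i))))
    (fun j W W' hW h ⟨ψ, hψ⟩ => ⟨res _ h ψ, by rw [app_res, hψ, res_res]⟩) ⟨hxV, hx0⟩
    (fun i => T.cyc_lift V z (V ⊓ W₀) inf_le_left _ x ⟨hxV, hx0⟩)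
  choose ψ hψ using hψ
  have hWV := hW.trans inf_le_left
  have hW0 := hW.trans inf_le_right
  refine ⟨W, hWV.trans hV, hxW, ?_⟩
  have h1 : ∀ (W' : X.Opens) (h : W' ≤ W) i, T.d.app W' (res _ h (ψ i)) =
      sapp (T.cyc.app V z) (h.trans hWV) (res _ (h.trans hW0) (e i)) := by
    intro W' h i
    rw [app_res, hψ, ← sapp_res, ← sapp_res, res_res, res_res]
  -- Lifting the cocycle on a basis determines a homomorphism whose coboundary is the cocycle.
  obtain ⟨χ, hχ⟩ := exists_localHom_of_relation (dual (pullbackTilde f E)) T.J₀ W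
    (fun W' h d i => ∃ c : Fin n → Γ(X, W'), d = ∑ i, c i • res _ (h.trans hW0) (e i) ∧
      i = ∑ i, c i • res _ h (ψ i))
    (by
      rintro V W hV h m n ⟨c, rfl, rfl⟩
      exact ⟨fun j => ores h (c j), by simp only [map_sum, res_smul, res_res],
        by simp only [map_sum, res_smul, res_res]⟩)
    (by
      rintro V hV m m' n n' ⟨c, rfl, rfl⟩ ⟨c', rfl, rfl⟩
      exact ⟨c + c', by simp only [Pi.add_apply, add_smul, Finset.sum_add_distrib],
        by simp only [Pi.add_apply, add_smul, Finset.sum_add_distrib]⟩)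
    (by
      rintro V hV r m n ⟨c, rfl, rfl⟩
      exact ⟨r • c, by simp only [Pi.smul_apply, smul_assoc, Finset.smul_sum],
        by simp only [Pi.smul_apply, smul_assoc, Finset.smul_sum]⟩)
    (by
      rintro V hV n ⟨c, h2, rfl⟩
      rw [hind V _ c h2.symm]
      simp)
    (by
      intro V' hV' d x hx
      obtain ⟨W', hW', hxW', c, hc⟩ := hspan V' (hV'.trans hW0) d x hx
      exact ⟨W', hW', hxW', _, c, hc, rfl⟩)
  have h2 : T.π.app W (res _ hWV z) = 0 := by
    refine T.π_of_exists W _ χ (sapp_ext fun V' hV' d => ?_)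
    rw [sapp_map]
    refine eq_of_locally_eq _ _ _ fun x hx => ?_
    obtain ⟨W', hW', hxW', c, h3, h4⟩ := hχ V' hV' d x hx
    refine ⟨W', hW', hxW', ?_⟩
    rw [← app_res]
    refine (congrArg (T.d.app W') h4).trans (Eq.trans ?_ (sapp_res _ _ _ _))
    rw [h3, map_sum, map_sum]
    refine Finset.sum_congr rfl fun i _ => ?_
    rw [Scheme.Modules.Hom.app_smul, map_smul, h1, app_res]
    rfl
  rw [app_res, hz, res_res] at h2
  exact h2

end Relation

end ExtRelations

/-! ### Passing from local to affine representatives -/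

section AffineGluing

theorem RegPair.pow_right {A : Type*} [CommRing A] {r t : A} (h : RegPair r t) (n : ℕ) :
    RegPair r (t ^ n) := by
  refine ⟨h.left, ?_⟩
  induction n with
  | zero => intro c e hce; exact ⟨e, by simpa using hce⟩
  | succ n ih =>
    intro c e hce
    obtain ⟨d, hd⟩ := h.right (t ^ n * c) e (by rw [← hce]; ring)
    exact ih c d hd

theorem RegPair.pow_left {A : Type*} [CommRing A] {r t : A} (h : RegPair r t) (n : ℕ) :
    RegPair (r ^ n) t := by
  induction n with
  | zero => exact ⟨fun c hc => by simpa using hc, fun c e _ => ⟨c, by simp⟩⟩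
  | succ n ih =>
    refine ⟨fun c hc => ih.left c (h.left _ (by rw [← hc]; ring)), fun c e hce => ?_⟩
    obtain ⟨d, rfl⟩ := h.right c (r ^ n * e) (by rw [hce]; ring)
    obtain ⟨d', rfl⟩ := ih.right d e (by
      rw [← sub_eq_zero]
      refine h.left _ ?_
      linear_combination hce)
    exact ⟨d', by ring⟩

section Affine

variable {X : Scheme.{u}} {U : X.Opens}

theorem exists_basicOpen_subset (hU : IsAffineOpen U) {V : X.Opens} {x : X} (hxU : x ∈ U) (hx : x ∈ V) :
    ∃ h : Γ(X, U), X.basicOpen h ≤ V ∧ x ∈ X.basicOpen h := by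
  exact hU.exists_basicOpen_le ⟨x, hx⟩ hxU

theorem ideal_eq_top_of_forall_mem (hU : IsAffineOpen U) (J : Ideal Γ(X, U))
    (h : ∀ x ∈ U, ∃ k ∈ J, x ∈ X.basicOpen k) : J = ⊤ := by
  rw [← Ideal.span_eq J, ← hU.iSup_basicOpen_eq_self_iff]
  refine le_antisymm (iSup_le fun k => X.basicOpen_le _) fun x hx => ?_
  obtain ⟨k, hk, hxk⟩ := h x hx
  exact Opens.mem_iSup.2 ⟨⟨k, hk⟩, hxk⟩

theorem isUnit_ores_basicOpen (h : Γ(X, U)) : IsUnit (ores (X.basicOpen_le h) h) :=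
  RingedSpace.isUnit_res_basicOpen _ h

theorem exists_pow_mul_eq_ores (hU : IsAffineOpen U) (h : Γ(X, U)) {n : ℕ}
    (w : Fin n → Γ(X, X.basicOpen h)) : ∃ (N : ℕ) (w' : Fin n → Γ(X, U)), ∀ j,
      ores (X.basicOpen_le h) (h ^ N) * w j = ores (X.basicOpen_le h) (w' j) := by
  have := hU.isLocalization_basicOpen h
  obtain ⟨⟨_, N, rfl⟩, hs⟩ := IsLocalization.exist_integer_multiples_of_finite (Submonoid.powers h) w
  choose w' hw' using hs
  exact ⟨N, w', fun j => ((hw' j).trans (Algebra.smul_def _ _)).symm⟩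

theorem exists_pow_mul_eq_zero (hU : IsAffineOpen U) (h : Γ(X, U)) {n : ℕ}
    (w : Fin n → Γ(X, U)) (hw : ∀ j, ores (X.basicOpen_le h) (w j) = 0) :
    ∃ N : ℕ, ∀ j, h ^ N * w j = 0 := by
  have := hU.isLocalization_basicOpen h
  have key : ∀ j, ∃ N : ℕ, h ^ N * w j = 0 := by
    intro j
    obtain ⟨⟨_, N, rfl⟩, hN⟩ := (IsLocalization.map_eq_zero_iff (Submonoid.powers h)
      Γ(X, X.basicOpen h) (w j)).1 (hw j)
    exact ⟨N, hN⟩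
  choose N hN using key
  refine ⟨∑ j, N j, fun j => ?_⟩
  rw [← Finset.add_sum_erase _ _ (Finset.mem_univ j), add_comm, pow_add, mul_assoc, hN, mul_zero]

/-- Basic opens form a basis inside `U`, and regular pairs stay regular under localization. -/
theorem regularOn_of_regPair {R : Type u} [CommRing R] {f : X ⟶ Spec (.of R)} (hU : IsAffineOpen U)
    {r t : R} (h : RegPair (omap f U r) (omap f U t)) : RegularOn f U r t := by
  have key : ∀ k : Γ(X, U), RegPair (omap f (X.basicOpen k) r) (omap f (X.basicOpen k) t) := by
    intro k
    have := hU.isLocalization_basicOpen k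
    have h1 := h.of_isLocalization (B := Γ(X, X.basicOpen k)) (Submonoid.powers k)
    rw [← ores_omap f (X.basicOpen_le k) r, ← ores_omap f (X.basicOpen_le k) t]
    exact h1
  refine ⟨fun W hW c hc => ?_, fun W hW c e hce x hx => ?_⟩
  · refine eq_zero_of_locally (structureModule X) (U := W) c fun x hx => ?_
    obtain ⟨k, hk, hxk⟩ := exists_basicOpen_subset hU (hW hx) hx
    refine ⟨X.basicOpen k, hk, hxk, (key k).left (ores hk c) ?_⟩
    rw [← ores_omap f hk, ← map_mul, hc, map_zero]
  · obtain ⟨k, hk, hxk⟩ := exists_basicOpen_subset hU (hW hx) hx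
    refine ⟨X.basicOpen k, hk, hxk, (key k).right _ (ores hk e) ?_⟩
    rw [← ores_omap f hk, ← ores_omap f hk, ← map_mul, ← map_mul, hce]

end Affine

section Glue

open Matrix

variable {X : Scheme.{u}} {R : Type u} [CommRing R] {f : X ⟶ Spec (.of R)}
  {E : Type u} [AddCommGroup E] [Module R E] {a b : ℕ}
  {g : Fin b → Module.Dual R E} {α : Matrix (Fin b) (Fin a) R}
  {T : ExtOneData (dual (pullbackTilde f E)) (structureModule X)}

theorem ores_vecMul {U V : X.Opens} (h : V ≤ U) (w : Fin b → Γ(X, U)) (k : Fin a) :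
    ores h ((w ᵥ* omat f α U) k) = ((fun j => ores h (w j)) ᵥ* omat f α V) k := by
  simp [vecMul, dotProduct, omat_res]

/-- On an affine open, a vector which is locally in the image of the transpose of `α` is in this image,
up to powers of a given function. -/
theorem exists_vecMul_of_basicOpen {U : X.Opens} (hU : IsAffineOpen U) (h : Γ(X, U))
    (v : Fin a → Γ(X, U)) (w : Fin b → Γ(X, X.basicOpen h))
    (hw : (fun k => ores (X.basicOpen_le h) (v k)) = w ᵥ* omat f α (X.basicOpen h)) :
    ∃ (N : ℕ) (w' : Fin b → Γ(X, U)), h ^ N • v = w' ᵥ* omat f α U := by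
  obtain ⟨N, w', hw'⟩ := exists_pow_mul_eq_ores hU h w
  obtain ⟨M, hM⟩ := exists_pow_mul_eq_zero hU h (h ^ N • v - w' ᵥ* omat f α U) fun k => by
    have h1 : (fun j => ores (X.basicOpen_le h) (w' j)) = ores (X.basicOpen_le h) (h ^ N) • w :=
      funext fun j => (hw' j).symm
    rw [Pi.sub_apply, map_sub, ores_vecMul, h1, smul_vecMul, ← hw, Pi.smul_apply, Pi.smul_apply,
      smul_eq_mul, smul_eq_mul, map_mul, sub_self]
  refine ⟨M + N, h ^ M • w', funext fun k => ?_⟩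
  have h1 := hM k
  rw [Pi.sub_apply, mul_sub, sub_eq_zero] at h1
  rw [smul_vecMul, Pi.smul_apply, Pi.smul_apply, pow_add, smul_eq_mul, smul_eq_mul, ← h1, mul_assoc]
  rfl

/-- The functions `h` with `h • v` in the image form an ideal. Clearing denominators on basic opens,
it contains a function that is nonzero at any given point of `U`, hence it contains `1`. -/
theorem exists_vecMul_of_locally {U : X.Opens} (hU : IsAffineOpen U) (v : Fin a → Γ(X, U))
    (hv : ∀ x ∈ U, ∃ (V : X.Opens) (hV : V ≤ U), x ∈ V ∧ ∃ w : Fin b → Γ(X, V),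
      (fun k => ores hV (v k)) = w ᵥ* omat f α V) :
    ∃ w : Fin b → Γ(X, U), v = w ᵥ* omat f α U := by
  let J : Ideal Γ(X, U) :=
    { carrier := {h | ∃ w : Fin b → Γ(X, U), h • v = w ᵥ* omat f α U}
      zero_mem' := ⟨0, by rw [zero_smul, zero_vecMul]⟩
      add_mem' := by
        rintro h h' ⟨w, hw⟩ ⟨w', hw'⟩
        exact ⟨w + w', by rw [add_smul, hw, hw', add_vecMul]⟩
      smul_mem' := by
        rintro c h ⟨w, hw⟩
        exact ⟨c • w, by rw [smul_assoc, hw, smul_vecMul]⟩ }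
  have hJ : J = ⊤ := ideal_eq_top_of_forall_mem hU J fun x hx => by
    obtain ⟨V, hV, hxV, w, hw⟩ := hv x hx
    obtain ⟨h, hhV, hxh⟩ := exists_basicOpen_subset hU hx hxV
    obtain ⟨N, w', hw'⟩ := exists_vecMul_of_basicOpen (f := f) (α := α) hU h v (fun j => ores hhV (w j)) (by
      funext k
      rw [← ores_vecMul, ← hw, ores_ores])
    exact ⟨h ^ (N + 1), ⟨h • w', by rw [pow_succ', mul_smul, hw', smul_vecMul]⟩, by
      rwa [X.basicOpen_pow _ (Nat.succ_pos N)]⟩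
  obtain ⟨w, hw⟩ : (1 : Γ(X, U)) ∈ J := hJ ▸ trivial
  exact ⟨w, by rw [← hw, one_smul]⟩

variable (f g α T) in
/-- The relation `Rel`, locally. -/
def RelLoc (U : X.Opens) (s : Γ(sheafExt 1 (dual (pullbackTilde f E)) (structureModule X), U))
    (v : Fin a → Γ(X, U)) : Prop :=
  ∀ x ∈ U, ∃ (V : X.Opens) (hV : V ≤ U), x ∈ V ∧ Rel f g α T V (res _ hV s) (fun k => ores hV (v k))

theorem Rel.relLoc {U : X.Opens} {s : Γ(sheafExt 1 (dual (pullbackTilde f E)) (structureModule X), U)}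
    {v : Fin a → Γ(X, U)} (h : Rel f g α T U s v) : RelLoc f g α T U s v :=
  fun x hx => ⟨U, le_rfl, hx, by simpa using h⟩

theorem RelLoc.restrict {U V : X.Opens} (hV : V ≤ U)
    {s : Γ(sheafExt 1 (dual (pullbackTilde f E)) (structureModule X), U)}
    {v : Fin a → Γ(X, U)} (h : RelLoc f g α T U s v) :
    RelLoc f g α T V (res _ hV s) (fun k => ores hV (v k)) := by
  intro x hx
  obtain ⟨W, hW, hxW, h1⟩ := h x (hV hx)
  refine ⟨W ⊓ V, inf_le_right, ⟨hxW, hx⟩, ?_⟩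
  simpa using h1.restrict (inf_le_left : W ⊓ V ≤ W)

theorem RelLoc.add {U : X.Opens}
    {s s' : Γ(sheafExt 1 (dual (pullbackTilde f E)) (structureModule X), U)}
    {v v' : Fin a → Γ(X, U)} (h : RelLoc f g α T U s v) (h' : RelLoc f g α T U s' v') :
    RelLoc f g α T U (s + s') (v + v') := by
  intro x hx
  obtain ⟨W, hW, hxW, h1⟩ := h x hx
  obtain ⟨W', hW', hxW', h1'⟩ := h' x hx
  refine ⟨W ⊓ W', inf_le_left.trans hW, ⟨hxW, hxW'⟩, ?_⟩
  have := (h1.restrict (inf_le_left : W ⊓ W' ≤ W)).add (h1'.restrict (inf_le_right : W ⊓ W' ≤ W'))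
  simp only [res_res, ores_ores, ← map_add] at this
  convert this using 1
  funext k
  simp

theorem RelLoc.smul {U : X.Opens} (c : Γ(X, U))
    {s : Γ(sheafExt 1 (dual (pullbackTilde f E)) (structureModule X), U)}
    {v : Fin a → Γ(X, U)} (h : RelLoc f g α T U s v) : RelLoc f g α T U (c • s) (c • v) := by
  intro x hx
  obtain ⟨W, hW, hxW, h1⟩ := h x hx
  refine ⟨W, hW, hxW, ?_⟩
  have := h1.smul (ores hW c)
  rw [← res_smul] at this
  convert this using 1
  funext k
  simp

theorem RelLoc.neg {U : X.Opens}
    {s : Γ(sheafExt 1 (dual (pullbackTilde f E)) (structureModule X), U)}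
    {v : Fin a → Γ(X, U)} (h : RelLoc f g α T U s v) : RelLoc f g α T U (-s) (-v) := by
  simpa using h.smul (-1)

theorem relLoc_zero_vecMul {U : X.Opens} (w : Fin b → Γ(X, U)) :
    RelLoc f g α T U 0 (w ᵥ* omat f α U) := (rel_zero_vecMul w).relLoc

theorem RelLoc.of_locally {U : X.Opens}
    {s : Γ(sheafExt 1 (dual (pullbackTilde f E)) (structureModule X), U)} {v : Fin a → Γ(X, U)}
    (h : ∀ x ∈ U, ∃ (V : X.Opens) (hV : V ≤ U), x ∈ V ∧
      RelLoc f g α T V (res _ hV s) (fun k => ores hV (v k))) : RelLoc f g α T U s v := by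
  intro x hx
  obtain ⟨V, hV, hxV, h1⟩ := h x hx
  obtain ⟨W, hW, hxW, h2⟩ := h1 x hxV
  exact ⟨W, hW.trans hV, hxW, by simpa using h2⟩

theorem RelLoc.eq_zero {r t : R} (hr : SplitsUpTo g α r) (ht : SplitsUpTo g α t)
    {U : X.Opens} (hU : RegularOn f U r t)
    {s : Γ(sheafExt 1 (dual (pullbackTilde f E)) (structureModule X), U)}
    (hs : RelLoc f g α T U s 0) : s = 0 := by
  refine eq_zero_of_locally _ _ fun x hx => ?_
  obtain ⟨V, hV, hxV, h⟩ := hs x hx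
  refine ⟨V, hV, hxV, Rel.eq_zero hr ht (U := V) (T := T)
    ⟨fun W hW => hU.left W (hW.trans hV), fun W hW => hU.right W (hW.trans hV)⟩ ?_⟩
  convert h using 1
  funext k
  simp

theorem RelLoc.exists_of_zero (hα : ∀ k, ∑ j, α j k • g j = 0) {U : X.Opens} (hU : IsAffineOpen U)
    {v : Fin a → Γ(X, U)} (h : RelLoc f g α T U 0 v) : ∃ w : Fin b → Γ(X, U), v = w ᵥ* omat f α U := by
  refine exists_vecMul_of_locally hU v fun x hx => ?_
  obtain ⟨V, hV, hxV, h1⟩ := h x hx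
  rw [map_zero] at h1
  obtain ⟨W, hW, hxW, w, hw⟩ := h1.exists_of_zero hα hxV
  exact ⟨W, hW.trans hV, hxW, w, by simpa using hw⟩

/-- On an affine open, every section of `ℰxt¹` corresponds to a vector of functions. -/
theorem exists_relLoc (hα : ∀ k, ∑ j, α j k • g j = 0) {U : X.Opens} (hU : IsAffineOpen U)
    (s : Γ(sheafExt 1 (dual (pullbackTilde f E)) (structureModule X), U)) :
    ∃ v, RelLoc f g α T U s v := by
  let J : Ideal Γ(X, U) :=
    { carrier := {h | ∃ v, RelLoc f g α T U (h • s) v}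
      zero_mem' := ⟨0, by
        rw [zero_smul]
        simpa using relLoc_zero_vecMul (f := f) (g := g) (α := α) (T := T) (U := U) 0⟩
      add_mem' := by
        rintro h h' ⟨v, hv⟩ ⟨v', hv'⟩
        exact ⟨v + v', by rw [add_smul]; exact hv.add hv'⟩
      smul_mem' := by
        rintro c h ⟨v, hv⟩
        exact ⟨c • v, by rw [smul_assoc]; exact hv.smul c⟩ }
  have hJ : J = ⊤ := ideal_eq_top_of_forall_mem hU J fun x hx => by
    obtain ⟨V, hV, hxV, v, hv⟩ := exists_rel (f := f) (T := T) hα s hx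
    obtain ⟨h, hhV, hxh⟩ := exists_basicOpen_subset hU hx hxV
    have hv1 := hv.restrict hhV
    rw [res_res] at hv1
    obtain ⟨N, v', hv'⟩ := exists_pow_mul_eq_ores hU h (fun k => ores hhV (v k))
    have hv2 : Rel f g α T (X.basicOpen h) (res _ (X.basicOpen_le h) (h ^ N • s))
        (fun k => ores (X.basicOpen_le h) (v' k)) := by
      have := hv1.smul (ores (X.basicOpen_le h) (h ^ N))
      rw [← res_smul] at this
      convert this using 1
      exact funext fun k => (hv' k).symm
    -- The vector `v'` represents `h ^ N • s` only where `h` is invertible. Multiplying by a further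
    -- power of `h` makes this true on all of `U`; the exponent found near each point can be made
    -- uniform because `U` is compact.
    have hcpt : ∃ m₀ : ℕ, ∀ m ≥ m₀, ∀ y ∈ (U : Set X), ∃ (W : X.Opens) (hW : W ≤ U), y ∈ W ∧
        Rel f g α T W (res _ hW (h ^ (m + N) • s)) (fun k => ores hW (h ^ m * v' k)) := by
      refine hU.isCompact.induction_on (p := fun S => ∃ m₀ : ℕ, ∀ m ≥ m₀, ∀ y ∈ S,
        ∃ (W : X.Opens) (hW : W ≤ U), y ∈ W ∧
        Rel f g α T W (res _ hW (h ^ (m + N) • s)) (fun k => ores hW (h ^ m * v' k)))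
        ⟨0, by simp⟩ ?_ ?_ ?_
      · rintro S S' hSS ⟨m₀, hm⟩
        exact ⟨m₀, fun m hmm y hy => hm m hmm y (hSS hy)⟩
      · rintro S S' ⟨m₀, hm⟩ ⟨m₁, hm'⟩
        refine ⟨max m₀ m₁, fun m hmm y hy => hy.elim (fun hy => ?_) fun hy => ?_⟩
        · exact hm m ((le_max_left _ _).trans hmm) y hy
        · exact hm' m ((le_max_right _ _).trans hmm) y hy
      · intro y hy
        obtain ⟨W, hW, hyW, vy, hvy⟩ := exists_rel (f := f) (T := T) hα s hy
        obtain ⟨k, hkW, hyk⟩ := exists_basicOpen_subset hU hy hyW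
        have hvy1 := hvy.restrict hkW
        rw [res_res] at hvy1
        set D := X.basicOpen k
        have hD : IsAffineOpen D := hU.basicOpen k
        have hDU : D ≤ U := X.basicOpen_le k
        set u : Fin a → Γ(X, D) := fun i => ores hkW (vy i)
        -- the difference on the overlap
        set h' : Γ(X, D) := ores hDU h with hh'
        have hD' : X.basicOpen h' = D ⊓ X.basicOpen h := X.basicOpen_res h (homOfLE hDU).op
        have hle : X.basicOpen h' ≤ X.basicOpen h := hD'.le.trans inf_le_right
        have h3 := (hv2.restrict hle).relLoc.add
          ((((hvy1.restrict (X.basicOpen_le h')).relLoc).smul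
            (ores ((X.basicOpen_le h').trans hDU) (h ^ N))).neg)
        rw [res_res, res_res, ← res_smul, add_neg_cancel] at h3
        obtain ⟨w, hw⟩ := h3.exists_of_zero hα (hD.basicOpen h')
        obtain ⟨M, w', hw'⟩ := exists_vecMul_of_basicOpen (f := f) (α := α) hD h'
          ((fun i => ores hDU (v' i)) - h' ^ N • u) w (by
            rw [← hw]
            funext i
            simp [u, hh', sub_eq_add_neg])
        refine ⟨D, mem_nhdsWithin_of_mem_nhds (D.isOpen.mem_nhds hyk), M, fun m hm z hz =>
          ⟨D, hDU, hz, ?_⟩⟩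
        -- On `D` the section `s` has a representative `u`, and `h' ^ M` moves `v' - h' ^ N • u`
        -- into the image of the transpose. The representative of `h ^ (m + N) • s` may therefore be
        -- changed to `h ^ m • v'`.
        have h4 := (hvy1.smul (h' ^ (m + N))).add_vecMul (h' ^ (m - M) • w')
        rw [smul_vecMul, ← hw', smul_smul, ← pow_add, Nat.sub_add_cancel hm, smul_sub, smul_smul,
          ← pow_add, add_sub_cancel, hh', ← map_pow, ← res_smul] at h4
        convert h4 using 1
        funext i
        simp
    obtain ⟨m, hm⟩ := hcpt
    refine ⟨h ^ (m + 1 + N), ⟨fun k => h ^ (m + 1) * v' k, hm (m + 1) (Nat.le_succ m)⟩, ?_⟩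
    rwa [X.basicOpen_pow _ (by omega)]
  obtain ⟨v, hv⟩ : (1 : Γ(X, U)) ∈ J := hJ ▸ trivial
  exact ⟨v, by rwa [one_smul] at hv⟩

end Glue

end AffineGluing

/-! ### Two-chart covers and cohomology of the structure sheaf -/

section BlowUpCovers

section Points

variable {X : Scheme.{u}} {U : X.Opens}

theorem mem_primeIdealOf (hU : IsAffineOpen U) {x : X} (hx : x ∈ U) (h : Γ(X, U)) :
    h ∈ (hU.primeIdealOf ⟨x, hx⟩).asIdeal ↔ x ∉ X.basicOpen h := by
  have h1 := congrArg (hU.primeIdealOf ⟨x, hx⟩ ∈ ·) (hU.fromSpec_preimage_basicOpen h)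
  have h2 : hU.fromSpec (hU.primeIdealOf ⟨x, hx⟩) ∈ X.basicOpen h ↔
    hU.primeIdealOf ⟨x, hx⟩ ∈ PrimeSpectrum.basicOpen h := Iff.of_eq h1
  rw [hU.fromSpec_primeIdealOf, PrimeSpectrum.mem_basicOpen] at h2
  rw [h2, not_not]

theorem exists_primeIdealOf_eq (hU : IsAffineOpen U) (p : Ideal Γ(X, U)) [hp : p.IsPrime] :
    ∃ x ∈ U, ∀ h : Γ(X, U), x ∈ X.basicOpen h ↔ h ∉ p := by
  refine ⟨hU.fromSpec ⟨p, hp⟩, ?_, fun h => ?_⟩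
  · have : hU.fromSpec ⟨p, hp⟩ ∈ Set.range hU.fromSpec := ⟨_, rfl⟩
    rwa [hU.range_fromSpec] at this
  · exact Iff.of_eq (congrArg ((⟨p, hp⟩ : PrimeSpectrum Γ(X, U)) ∈ ·) (hU.fromSpec_preimage_basicOpen h))

theorem eq_of_specializes_of_isMaximal (hU : IsAffineOpen U) {x y : X} (hx : x ∈ U) (hy : y ∈ U)
    (hxy : x ⤳ y) (hm : (hU.primeIdealOf ⟨x, hx⟩).asIdeal.IsMaximal) : x = y := by
  have hle : (hU.primeIdealOf ⟨x, hx⟩).asIdeal ≤ (hU.primeIdealOf ⟨y, hy⟩).asIdeal := fun h hh => by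
    rw [mem_primeIdealOf] at hh ⊢
    exact fun hyh => hh (hxy.mem_open (X.basicOpen h).isOpen hyh)
  have h1 := hm.eq_of_le (hU.primeIdealOf ⟨y, hy⟩).2.ne_top hle
  have h2 : hU.primeIdealOf ⟨x, hx⟩ = hU.primeIdealOf ⟨y, hy⟩ := PrimeSpectrum.ext h1
  have h3 := congrArg hU.fromSpec h2
  rwa [hU.fromSpec_primeIdealOf, hU.fromSpec_primeIdealOf] at h3

theorem exists_section_of_nontrivial_stalk (M : X.Modules) {x : X} (h : Nontrivial (M.presheaf.stalk x))
    (W : X.Opens) (hxW : x ∈ W) :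
    ∃ (U : X.Opens) (_ : U ≤ W) (s : Γ(M, U)), x ∈ U ∧ ∀ (V : X.Opens) (hV : V ≤ U), x ∈ V → res M hV s ≠ 0 := by
  by_contra hcon
  push Not at hcon
  have key : ∀ t : M.presheaf.stalk x, t = 0 := by
    intro t
    obtain ⟨U, hxU, s, rfl⟩ := M.presheaf.exists_germ_eq t
    obtain ⟨V, hV, hxV, hs⟩ := hcon (U ⊓ W) inf_le_right (res M inf_le_left s) ⟨hxU, hxW⟩
    rw [res_res] at hs
    have h1 := M.presheaf.germ_res_apply (homOfLE (hV.trans inf_le_left)) x hxV s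
    refine h1.symm.trans ?_
    have h2 : (ConcreteCategory.hom (M.presheaf.map (homOfLE (hV.trans inf_le_left)).op)) s = 0 := hs
    rw [h2, map_zero]
  exact not_subsingleton (M.presheaf.stalk x) ⟨fun t t' => by rw [key t, key t']⟩

end Points

open Polynomial in
-- As `T` and `T'` are inverse on the overlap, a monomial `T ^ n T' ^ N` is a power of `T` or of
-- `T'`, so it extends to one of the two charts.
theorem exists_split_eval₂ {R A A' B : Type*} [CommRing R] [CommRing A] [CommRing A'] [CommRing B]
    {ι : R →+* A} {ι' : R →+* A'} {j : A →+* B} {j' : A' →+* B} {T : A} {T' : A'}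
    (hι : j.comp ι = j'.comp ι') (h : j T * j' T' = 1) (N : ℕ) (P : R[X]) :
    ∃ c c', j' T' ^ N * j (P.eval₂ ι T) = j c + j' c' := by
  induction P using Polynomial.induction_on' with
  | add P Q hP hQ =>
    obtain ⟨c, c', hc⟩ := hP
    obtain ⟨d, d', hd⟩ := hQ
    exact ⟨c + d, c' + d', by rw [eval₂_add, map_add, mul_add, hc, hd, map_add, map_add]; ring⟩
  | monomial n r =>
    have hr : j (ι r) = j' (ι' r) := congrArg (fun φ => φ r) (congrArg DFunLike.coe hι)
    rw [eval₂_monomial, map_mul, map_pow]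
    rcases le_total n N with hn | hn
    · obtain ⟨k, rfl⟩ := Nat.exists_eq_add_of_le hn
      refine ⟨0, ι' r * T' ^ k, ?_⟩
      rw [map_zero, zero_add, map_mul, map_pow, hr, pow_add]
      calc _ = (j T * j' T') ^ n * (j' (ι' r) * j' T' ^ k) := by ring
        _ = _ := by rw [h, one_pow, one_mul]
    · obtain ⟨k, rfl⟩ := Nat.exists_eq_add_of_le hn
      refine ⟨ι r * T ^ k, 0, ?_⟩
      rw [map_zero, add_zero, map_mul, map_pow, pow_add]
      calc _ = (j T * j' T') ^ N * (j (ι r) * j T ^ k) := by ring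
        _ = _ := by rw [h, one_pow, one_mul]

/-- Two affine open subsets of a scheme over `Spec R` which are the standard charts of the blow-up of the
ideal `(x, y)`. -/
structure IsBlowUpCover {X : Scheme.{u}} {R : Type u} [CommRing R] (f : X ⟶ Spec (.of R)) (x y : R)
    {U U' : X.Opens} (T : Γ(X, U)) (T' : Γ(X, U')) : Prop where
  affine : IsAffineOpen U
  affine' : IsAffineOpen U'
  cover : U ⊔ U' = ⊤
  chart : IsChart x y (omap f U) T
  chart' : IsChart y x (omap f U') T'
  inter : U ⊓ U' = X.basicOpen T
  inter' : U ⊓ U' = X.basicOpen T'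
  mul (W : X.Opens) (h : W ≤ U) (h' : W ≤ U') : ores h T * ores h' T' = 1

section Cover

variable {X : Scheme.{u}} {R : Type u} [CommRing R] {f : X ⟶ Spec (.of R)} {x y z : R}
  {U U' : X.Opens} {T : Γ(X, U)} {T' : Γ(X, U')}

theorem ores_injective_of_isDomain (hU : IsAffineOpen U) [IsDomain Γ(X, U)] {h : Γ(X, U)} (hh : h ≠ 0)
    {V : X.Opens} (hV : V ≤ U) (hhV : X.basicOpen h ≤ V) : Function.Injective (ores hV) := by
  rw [injective_iff_map_eq_zero]
  intro c hc
  obtain ⟨N, hN⟩ := exists_pow_mul_eq_zero hU h (n := 1) (fun _ => c) fun _ => by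
    rw [← ores_ores hV hhV, hc, map_zero]
  exact (mul_eq_zero.1 (hN 0)).resolve_left (pow_ne_zero _ hh)

theorem IsChart.ne_zero {A : Type*} [CommRing A] {ι : R →+* A} {T : A} (hA : IsChart x y ι T) (hy : y ≠ 0) :
    T ≠ 0 := by
  rintro rfl
  exact hy (hA.inj (by rw [← hA.rel, mul_zero, map_zero]))

/-- This is the vanishing of `H¹(X, 𝒪)`, computed with the cover by the two charts. -/
theorem IsBlowUpCover.exists_add (h : IsBlowUpCover f x y T T') (w : Γ(X, U ⊓ U')) :
    ∃ c c', w = ores inf_le_left c + ores inf_le_right c' := by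
  obtain ⟨N, w', hw'⟩ := exists_pow_mul_eq_ores h.affine T (n := 1) (fun _ => ores h.inter.ge w)
  have h1 := congrArg (ores h.inter.le) (hw' 0)
  rw [map_mul, ores_ores, ores_ores, ores_ores, ores_self] at h1
  obtain ⟨P, hP⟩ := h.chart.gen (w' 0)
  obtain ⟨c, c', hc⟩ := exists_split_eval₂ (ι := omap f U) (ι' := omap f U')
    (j := ores (inf_le_left : U ⊓ U' ≤ U)) (j' := ores (inf_le_right : U ⊓ U' ≤ U'))
    (RingHom.ext fun r => by rw [RingHom.comp_apply, RingHom.comp_apply, ores_omap, ores_omap])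
    (h.mul _ _ _) N P
  refine ⟨c, c', ?_⟩
  rw [← hc, hP, ← h1, ← mul_assoc, map_pow, ← mul_pow, mul_comm (ores _ T'), h.mul, one_pow, one_mul]

variable [IsLocalRing R]

theorem IsBlowUpCover.ores_injective (h : IsBlowUpCover f x y T T') (hp : IsParams x y z) (hx : x ≠ 0)
    (hy : y ≠ 0) : Function.Injective (ores (inf_le_left : U ⊓ U' ≤ U)) := by
  have := h.chart.isDomain hp hx
  exact ores_injective_of_isDomain h.affine (h.chart.ne_zero hy) _ h.inter.ge

/-- This is `H⁰(X, 𝒪) = R`. A polynomial in `y / x` that is also a polynomial in `x / y` is constant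
modulo the relation, and restriction to the overlap is injective on both charts. -/
theorem IsBlowUpCover.exists_const (h : IsBlowUpCover f x y T T') (hp : IsParams x y z)
    (hp' : IsParams y x z) (hx : x ≠ 0) (hy : y ≠ 0)
    (c : Γ(X, U)) (c' : Γ(X, U'))
    (hc : ores (inf_le_left : U ⊓ U' ≤ U) c = ores (inf_le_right : U ⊓ U' ≤ U') c') :
    ∃ r, c = omap f U r ∧ c' = omap f U' r := by
  have hinj := h.ores_injective hp hx hy
  have hinj' : Function.Injective (ores (inf_le_right : U ⊓ U' ≤ U')) := by
    have := h.chart'.isDomain hp' hy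
    exact ores_injective_of_isDomain h.affine' (h.chart'.ne_zero hx) _ h.inter'.ge
  obtain ⟨P, hP⟩ := h.chart.gen c
  obtain ⟨Q, hQ⟩ := h.chart'.gen c'
  have e : ∀ V (hV : U ⊓ U' ≤ V), (ores hV).comp (omap f V) = omap f (U ⊓ U') := fun V hV =>
    RingHom.ext fun r => ores_omap f hV r
  have hinj0 : Function.Injective (omap f (U ⊓ U')) := by
    rw [← e U inf_le_left]
    exact hinj.comp h.chart.inj
  have h1 : ∀ V (hV : U ⊓ U' ≤ V) (S : Γ(X, V)) (G : Polynomial R),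
      ores hV (G.eval₂ (omap f V) S) = G.eval₂ (omap f (U ⊓ U')) (ores hV S) := by
    intro V hV S G
    rw [Polynomial.hom_eval₂, e]
  obtain ⟨r, hr⟩ := exists_eq_of_eval₂_eq (ι := omap f (U ⊓ U')) (T := ores inf_le_left T)
    (T' := ores inf_le_right T') hp hinj0
    (by rw [← ores_omap f inf_le_left, ← map_mul, h.chart.rel, ores_omap])
    (by rw [← ores_omap f inf_le_right, ← map_mul, h.chart'.rel, ores_omap]) P Q
    (by rw [← h1, ← h1, hP, hQ, hc])
  refine ⟨r, hinj ?_, hinj' ?_⟩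
  · rw [ores_omap, ← hr, ← h1, hP]
  · rw [ores_omap, ← hr, ← h1, hP, hc]

end Cover

section Free

variable {X : Scheme.{u}} {R : Type u} [CommRing R] [IsLocalRing R] [IsNoetherianRing R]
  {f : X ⟶ Spec (.of R)} {x y z : R} {U : X.Opens} {T : Γ(X, U)}
  {E : Type u} [AddCommGroup E] [Module R E] [Module.Finite R E]

open IsLocalRing in
/-- `ℰxt¹((f^* E)^∨, 𝒪_X)` vanishes at the generic point of the exceptional divisor. -/
theorem IsChart.exists_res_eq_zero (hU : IsAffineOpen U) (hA : IsChart x y (omap f U) T)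
    (hp : IsParams x y z) (hx : x ≠ 0)
    (D : ExtOneData (dual (pullbackTilde f E)) (structureModule X)) {W : X.Opens} {η : X} (hηW : η ∈ W)
    (hη : ∀ h : Γ(X, U), h ∉ (maximalIdeal R).map (omap f U) → η ∈ X.basicOpen h)
    (s : Γ(sheafExt 1 (dual (pullbackTilde f E)) (structureModule X), W)) :
    ∃ (V : X.Opens) (hV : V ≤ W), η ∈ V ∧ res _ hV s = 0 := by
  have := hA.isNoetherianRing
  have := hA.isDomain hp hx
  have hprime := hA.isPrime_map hp
  obtain ⟨h, n, e, hh, he, hB⟩ := exists_basis_near (E := E) (ι := omap f U) (hA.regPair hp hx)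
    ((maximalIdeal R).map (omap f U)) (hA.map_maximalIdeal hp)
  choose d hd using fun i => exists_ev f E (U := U) (e i) (he i).add (he i).smul
  have hle := X.basicOpen_le h
  have key : ∀ (k : Γ(X, U)) (hk : X.basicOpen k ≤ X.basicOpen h), k ≠ 0 →
      (∀ δ : E → Γ(X, X.basicOpen k), IsSemilin ((ores (X.basicOpen_le k)).comp (omap f U)) δ →
        ∃ c : Fin n → _, ∀ m, δ m = ∑ i, c i * ores (X.basicOpen_le k) (e i m)) ∧
      ∀ c : Fin n → Γ(X, X.basicOpen k), (∀ m, ∑ i, c i * ores (X.basicOpen_le k) (e i m) = 0) →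
        c = 0 := by
    -- The basis found near the prime `mA` remains a basis over every nonempty basic open inside
    -- that of `h`, which is enough to test freeness locally.
    intro k hk hk0
    refine hB _ (ores (X.basicOpen_le k)) (ores_injective_of_isDomain hU hk0 _ le_rfl) ?_ ?_
    · intro m b
      obtain ⟨N, a, ha⟩ := exists_pow_mul_eq_ores hU k b
      exact ⟨k ^ N, a, by rw [map_pow]; exact (isUnit_ores_basicOpen k).pow N, ha⟩
    · have := (isUnit_ores_basicOpen h).map (ores hk)
      rwa [ores_ores] at this
  have hne : ∀ (k : Γ(X, U)) (p : X), p ∈ X.basicOpen k → k ≠ 0 := by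
    rintro _ p hpk rfl
    rw [Scheme.basicOpen_zero] at hpk
    exact hpk
  refine exists_res_eq_zero_of_free (W₀ := X.basicOpen h) (fun i => res _ hle (d i)) ?_ ?_ D s hηW
    (hη h hh)
  · intro W hW d' p hpW
    obtain ⟨k, hkW, hpk⟩ := exists_basicOpen_subset hU (hle (hW hpW)) hpW
    obtain ⟨c, hc⟩ := (key k (hkW.trans hW) (hne k p hpk)).1 (fun m => ev f E (res _ hkW d') m)
      ⟨ev_add_right f E _, fun r m => by
        rw [ev_smul_right, RingHom.comp_apply, ores_omap]⟩
    refine ⟨X.basicOpen k, hkW, hpk, c, ev_ext f E fun m => ?_⟩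
    rw [hc, ev_sum]
    refine Finset.sum_congr rfl fun i _ => ?_
    rw [ev_smul, res_res, ev_res, hd]
  · intro W hW c hc
    funext i
    refine eq_zero_of_locally (structureModule X) (U := W) (c i) fun p hpW => ?_
    obtain ⟨k, hkW, hpk⟩ := exists_basicOpen_subset hU (hle (hW hpW)) hpW
    refine ⟨X.basicOpen k, hkW, hpk, ?_⟩
    refine congrFun ((key k (hkW.trans hW) (hne k p hpk)).2 (fun i => ores hkW (c i)) fun m => ?_) i
    have h1 := congrArg (fun t => ev f E (res _ hkW t) m) hc
    simp only [ev_res, ev_sum, ev_smul, map_sum, map_mul, ores_ores, map_zero, ev_zero, hd] at h1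
    exact h1

end Free

end BlowUpCovers

/-! ### Support and length of `ℰxt¹` on the blow-up -/

section SupportAndLength

open Matrix IsLocalRing

theorem SplitsUpTo.of_mem_ann {R : Type u} [CommRing R] {E : Type u} [AddCommGroup E] [Module R E]
    [Module.IsReflexive R E] {D : DualPresentation R E} {r : R} (hr : r ∈ D.ann) :
    SplitsUpTo D.g D.α r := by
  obtain ⟨τ, hτ⟩ := hr
  obtain ⟨e, h1, h2⟩ := D.exists_splitting hτ
  exact ⟨τ, e, hτ, h1, h2⟩

/-- Where `r` is invertible the transpose of `α` is surjective, so every representing vector can be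
changed to zero. -/
theorem Rel.of_isUnit {X : Scheme.{u}} {R : Type u} [CommRing R] {f : X ⟶ Spec (.of R)}
    {E : Type u} [AddCommGroup E] [Module R E] {a b : ℕ} {g : Fin b → Module.Dual R E}
    {α : Matrix (Fin b) (Fin a) R} {T : ExtOneData (dual (pullbackTilde f E)) (structureModule X)}
    {τ : Matrix (Fin a) (Fin b) R} {r : R} (hτ : τ * α = r • (1 : Matrix (Fin a) (Fin a) R))
    {U : X.Opens} (hr : IsUnit (omap f U r))
    {s : Γ(sheafExt 1 (dual (pullbackTilde f E)) (structureModule X), U)} {v : Fin a → Γ(X, U)}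
    (h : Rel f g α T U s v) : Rel f g α T U s 0 := by
  obtain ⟨ρ, hρ⟩ := hr
  have h1 := h.add_vecMul (-((↑ρ⁻¹ : Γ(X, U)) • v) ᵥ* omat f τ U)
  have h2 : omat f τ U * omat f α U = omap f U r • (1 : Matrix (Fin a) (Fin a) Γ(X, U)) := by
    have h3 : (τ * α).map (omap f U) = omat f τ U * omat f α U := Matrix.map_mul
    rw [← h3, hτ]
    ext i j
    by_cases hij : i = j <;> simp [hij]
  rwa [vecMul_vecMul, h2, neg_vecMul, vecMul_smul, vecMul_one, smul_smul, ← hρ, Units.mul_inv,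
    one_smul, add_neg_cancel] at h1

section Support

variable {X : Scheme.{u}} {R : Type u} [CommRing R] [IsLocalRing R]
  {f : X ⟶ Spec (.of R)} {x y z : R} {U : X.Opens} {T : Γ(X, U)}
  {E : Type u} [AddCommGroup E] [Module R E] [Module.IsReflexive R E]
  {P : DualPresentation R E} {N : ℕ} (hN : maximalIdeal R ^ N ≤ P.ann)
include hN

/-- The elements `x ^ N` and `z ^ N` annihilate the cokernel and form a regular pair in the chart,
as `Rel.eq_zero` requires. -/
theorem IsChart.regularOn (hU : IsAffineOpen U) (hA : IsChart x y (omap f U) T)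
    (hp : IsParams x y z) (hx : x ≠ 0) :
    SplitsUpTo P.g P.α (x ^ N) ∧ SplitsUpTo P.g P.α (z ^ N) ∧ RegularOn f U (x ^ N) (z ^ N) := by
  have hxm : x ∈ maximalIdeal R := hp.span_eq ▸ Ideal.subset_span (by simp)
  have hzm : z ∈ maximalIdeal R := hp.span_eq ▸ Ideal.subset_span (by simp)
  refine ⟨.of_mem_ann (hN (Ideal.pow_mem_pow hxm N)), .of_mem_ann (hN (Ideal.pow_mem_pow hzm N)),
    regularOn_of_regPair hU ?_⟩
  rw [map_pow, map_pow]
  exact ((hA.regPair hp hx).pow_left N).pow_right N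

variable [IsNoetherianRing R] [Module.Finite R E]

/-- A point of the support lies on the closed fibre, since an element of the maximal ideal
invertible at the point would kill all representing vectors. It is not the generic point of the
fibre, where `ℰxt¹` vanishes, and the fibre in the chart is an affine line. -/
theorem IsChart.isMaximal_of_nontrivial (hU : IsAffineOpen U) (hA : IsChart x y (omap f U) T)
    (hp : IsParams x y z) (hx : x ≠ 0) {p : X} (hpU : p ∈ U)
    (h : Nontrivial ((sheafExt 1 (dual (pullbackTilde f E)) (structureModule X)).presheaf.stalk p)) :
    (hU.primeIdealOf ⟨p, hpU⟩).asIdeal.IsMaximal := by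
  obtain ⟨D⟩ := nonempty_extOneData (dual (pullbackTilde f E)) (structureModule X)
  obtain ⟨hr, ht, hreg⟩ := hA.regularOn hN hU hp hx
  obtain ⟨W, hWU, s, hpW, hs⟩ := exists_section_of_nontrivial_stalk _ h U hpU
  have hle : (maximalIdeal R).map (omap f U) ≤ (hU.primeIdealOf ⟨p, hpU⟩).asIdeal := by
    rw [Ideal.map_le_iff_le_comap]
    intro r hrm
    rw [Ideal.mem_comap, mem_primeIdealOf]
    intro hpr
    obtain ⟨τ, hτ⟩ := hN (Ideal.pow_mem_pow hrm N)
    obtain ⟨V, hV, hpV, v, hv⟩ := exists_rel (T := D) P.sum_smul_column s hpW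
    have hV' : V ⊓ X.basicOpen (omap f U r) ≤ W := inf_le_left.trans hV
    refine hs (V ⊓ X.basicOpen (omap f U r)) hV' ⟨hpV, hpr⟩ ?_
    have hunit : IsUnit (omap f (V ⊓ X.basicOpen (omap f U r)) (r ^ N)) := by
      have := (isUnit_ores_basicOpen (omap f U r)).map
        (ores (inf_le_right : V ⊓ X.basicOpen (omap f U r) ≤ _))
      rw [ores_ores, ores_omap] at this
      rw [map_pow]
      exact this.pow N
    have hv1 := (hv.restrict (inf_le_left : V ⊓ X.basicOpen (omap f U r) ≤ V)).of_isUnit hτ hunit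
    rw [res_res] at hv1
    exact Rel.eq_zero hr ht ⟨fun G hG => hreg.left G (hG.trans (hV'.trans hWU)),
      fun G hG => hreg.right G (hG.trans (hV'.trans hWU))⟩ hv1
  by_cases hlt : (maximalIdeal R).map (omap f U) < (hU.primeIdealOf ⟨p, hpU⟩).asIdeal
  · exact hA.isMaximal_of_lt hp _ hlt
  · have heq := hle.eq_of_not_lt hlt
    obtain ⟨V, hV, hpV, h0⟩ := hA.exists_res_eq_zero hU hp hx D hpW (fun k hk => by
      rw [heq, mem_primeIdealOf, not_not] at hk
      exact hk) s
    exact absurd h0 (hs V hV hpV)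

end Support

/-- Every specialization of a support point lies in one of the charts, which then contains the point
itself; maximality of its prime in that chart forces equality. -/
theorem IsBlowUpCover.supportedAtClosedPoints {X : Scheme.{u}} {R : Type u} [CommRing R] [IsLocalRing R]
    [IsNoetherianRing R] {f : X ⟶ Spec (.of R)} {x y z : R} {U U' : X.Opens} {T : Γ(X, U)} {T' : Γ(X, U')}
    (h : IsBlowUpCover f x y T T') (hp : IsParams x y z)
    (hp' : IsParams y x z) (hx : x ≠ 0) (hy : y ≠ 0)
    {E : Type u} [AddCommGroup E] [Module R E] [Module.Finite R E] [Module.IsReflexive R E]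
    {P : DualPresentation R E} {N : ℕ} (hN : maximalIdeal R ^ N ≤ P.ann) :
    SupportedAtClosedPoints (sheafExt 1 (dual (pullbackTilde f E)) (structureModule X)) := by
  intro p hnt
  refine isClosed_of_closure_subset fun q hq => ?_
  have hpq : p ⤳ q := specializes_iff_mem_closure.2 hq
  have hqU : q ∈ U ⊔ U' := h.cover ▸ trivial
  rcases hqU with hqU | hqU
  · have hpU := hpq.mem_open U.isOpen hqU
    exact (eq_of_specializes_of_isMaximal h.affine hpU hqU hpq
      (h.chart.isMaximal_of_nontrivial hN h.affine hp hx hpU hnt)).symm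
  · have hpU := hpq.mem_open U'.isOpen hqU
    exact (eq_of_specializes_of_isMaximal h.affine' hpU hqU hpq
      (h.chart'.isMaximal_of_nontrivial hN h.affine' hp' hy hpU hnt)).symm

section Length

variable {X : Scheme.{u}} {R : Type u} [CommRing R]
  {f : X ⟶ Spec (.of R)} {x y z : R} {U U' : X.Opens} {T : Γ(X, U)} {T' : Γ(X, U')}
  {E : Type u} [AddCommGroup E] [Module R E]

variable (P : DualPresentation R E) (D : ExtOneData (dual (pullbackTilde f E)) (structureModule X))

/-- The vectors over `R` which correspond to global sections of `ℰxt¹`. -/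
def sectionVectors : Submodule R (Fin P.a → R) where
  carrier := {v | ∃ s, RelLoc f P.g P.α D ⊤ s (fun k => omap f ⊤ (v k))}
  zero_mem' := ⟨0, by
    have := relLoc_zero_vecMul (f := f) (g := P.g) (α := P.α) (T := D) (U := ⊤) 0
    rw [zero_vecMul] at this
    simpa using! this⟩
  add_mem' := by
    rintro v v' ⟨s, hs⟩ ⟨s', hs'⟩
    refine ⟨s + s', ?_⟩
    simpa using! hs.add hs'
  smul_mem' := by
    rintro r v ⟨s, hs⟩
    refine ⟨omap f ⊤ r • s, ?_⟩
    simpa using! hs.smul (omap f ⊤ r)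

theorem omap_vecMul (V : X.Opens) (w : Fin P.b → R) (k : Fin P.a) :
    omap f V ((P.αᵀ *ᵥ w) k) = ((fun j => omap f V (w j)) ᵥ* omat f P.α V) k := by
  simp [vecMul, mulVec, dotProduct, omat, mul_comm]

theorem range_le_sectionVectors : LinearMap.range P.αᵀ.mulVecLin ≤ sectionVectors P D := by
  rintro _ ⟨w, rfl⟩
  refine ⟨0, ?_⟩
  simp only [mulVecLin_apply, omap_vecMul]
  exact relLoc_zero_vecMul _

variable [IsLocalRing R]

theorem IsBlowUpCover.exists_vector (h : IsBlowUpCover f x y T T') (hp : IsParams x y z)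
    (hp' : IsParams y x z) (hx : x ≠ 0) (hy : y ≠ 0)
    (s : Γ(sheafExt 1 (dual (pullbackTilde f E)) (structureModule X), ⊤)) :
    ∃ v : Fin P.a → R, RelLoc f P.g P.α D ⊤ s (fun k => omap f ⊤ (v k)) := by
  obtain ⟨v, hv⟩ := exists_relLoc (f := f) (T := D) P.sum_smul_column h.affine (res _ le_top s)
  obtain ⟨v', hv'⟩ := exists_relLoc (f := f) (T := D) P.sum_smul_column h.affine' (res _ le_top s)
  have h1 := (hv.restrict (inf_le_left : U ⊓ U' ≤ U)).add
    (hv'.restrict (inf_le_right : U ⊓ U' ≤ U')).neg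
  rw [res_res, res_res, add_neg_cancel] at h1
  obtain ⟨w, hw⟩ := h1.exists_of_zero P.sum_smul_column (h.inter ▸ h.affine.basicOpen T)
  -- The representatives on the two charts differ on the overlap by `w ᵥ* α`. Splitting `w` between
  -- the charts makes them agree, and functions that agree on the overlap come from `R`.
  choose c c' hc using fun j => h.exists_add (w j)
  have h2 := hv.add (relLoc_zero_vecMul (-c))
  have h2' := hv'.add (relLoc_zero_vecMul c')
  rw [add_zero] at h2 h2'
  have h3 : ∀ k, ∃ r, (v + -c ᵥ* omat f P.α U) k = omap f U r ∧
      (v' + c' ᵥ* omat f P.α U') k = omap f U' r := fun k => by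
    refine h.exists_const hp hp' hx hy _ _ ?_
    have h4 := congrFun hw k
    have h5 : w = (fun j => ores inf_le_left (c j)) + fun j => ores inf_le_right (c' j) := funext hc
    rw [h5, add_vecMul, Pi.add_apply, Pi.add_apply, Pi.neg_apply, ← ores_vecMul, ← ores_vecMul] at h4
    rw [neg_vecMul, Pi.add_apply, Pi.add_apply, Pi.neg_apply, map_add, map_add, map_neg]
    linear_combination h4
  choose r hr hr' using h3
  refine ⟨r, RelLoc.of_locally fun p _ => ?_⟩
  have hpU : p ∈ U ⊔ U' := h.cover ▸ trivial
  rcases hpU with hpU | hpU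
  · refine ⟨U, le_top, hpU, ?_⟩
    convert h2 using 1
    exact funext fun k => by rw [ores_omap, hr]
  · refine ⟨U', le_top, hpU, ?_⟩
    convert h2' using 1
    exact funext fun k => by rw [ores_omap, hr']

theorem IsBlowUpCover.eq_zero [Module.IsReflexive R E] (h : IsBlowUpCover f x y T T') (hp : IsParams x y z)
    (hp' : IsParams y x z) (hx : x ≠ 0) (hy : y ≠ 0) {N : ℕ} (hN : maximalIdeal R ^ N ≤ P.ann)
    (s : Γ(sheafExt 1 (dual (pullbackTilde f E)) (structureModule X), ⊤))
    (hs : RelLoc f P.g P.α D ⊤ s 0) : s = 0 := by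
  have h0 : ∀ V : X.Opens, RelLoc f P.g P.α D V (res _ le_top s) 0 := fun V => by
    convert hs.restrict le_top using 1
    exact funext fun k => by simp
  obtain ⟨h1, h2, h3⟩ := h.chart.regularOn hN h.affine hp hx
  obtain ⟨h1', h2', h3'⟩ := h.chart'.regularOn hN h.affine' hp' hy
  refine eq_zero_of_locally _ s fun p _ => ?_
  have hpU : p ∈ U ⊔ U' := h.cover ▸ trivial
  rcases hpU with hpU | hpU
  · exact ⟨U, le_top, hpU, (h0 U).eq_zero h1 h2 h3⟩
  · exact ⟨U', le_top, hpU, (h0 U').eq_zero h1' h2' h3'⟩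

variable [IsNoetherianRing R]

/-- If all unit vectors came from global sections, the vanishing of `ℰxt¹` at the generic point of
the closed fibre would put them in the image of `αᵀ` near that point, although `αᵀ` is not
surjective modulo the maximal ideal. -/
theorem IsChart.sectionVectors_ne_top [Module.Finite R E] [Module.IsReflexive R E] (hE : ¬ Module.Free R E)
    (hU : IsAffineOpen U) (hA : IsChart x y (omap f U) T)
    (hp : IsParams x y z) (hx : x ≠ 0) : sectionVectors P D ≠ ⊤ := by
  intro htop
  have hprime := hA.isPrime_map hp
  obtain ⟨η, hηU, hη⟩ := exists_primeIdealOf_eq hU ((maximalIdeal R).map (omap f U))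
  have hsec : ∀ i : Fin P.a, (Pi.single i 1 : Fin P.a → R) ∈ sectionVectors P D := fun i => htop ▸ trivial
  choose s hs using hsec
  obtain ⟨V, hV, hηV, h1⟩ := exists_common_open (U := U) (fun i V hV => res _ (le_top : V ≤ ⊤) (s i) = 0)
    (fun i V W hV h h0 => by rw [← res_res _ (le_top : V ≤ ⊤) h, h0, map_zero]) hηU fun i => by
      obtain ⟨V, hV, hηV, h0⟩ := hA.exists_res_eq_zero hU hp hx D hηU (fun h hh => (hη h).2 hh)
        (res _ le_top (s i))
      exact ⟨V, hV, hηV, by rwa [res_res] at h0⟩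
  obtain ⟨h, hhV, hηh⟩ := exists_basicOpen_subset hU hηU hηV
  have h2 : ∀ i, ∃ (N : ℕ) (w : Fin P.b → Γ(X, U)),
      h ^ N • (fun k => omap f U ((Pi.single i 1 : Fin P.a → R) k)) = w ᵥ* omat f P.α U := by
    intro i
    have h3 := (hs i).restrict (le_top : X.basicOpen h ≤ ⊤)
    rw [← res_res _ (le_top : V ≤ ⊤) hhV, h1, map_zero] at h3
    obtain ⟨w, hw⟩ := h3.exists_of_zero P.sum_smul_column (hU.basicOpen h)
    refine exists_vecMul_of_basicOpen hU h _ w ?_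
    rw [← hw]
    exact funext fun k => by rw [ores_omap, ores_omap]
  obtain ⟨c, k, hck, hc⟩ := P.exists_unimodular hE
  obtain ⟨N, w, hw⟩ := h2 k
  -- Pairing with `c` turns the `k`-th unit vector into the unit `c k` and the image of `αᵀ` into
  -- combinations of the entries of `α *ᵥ c`, which lie in the maximal ideal.
  have h3 := congrArg (fun v => v ⬝ᵥ fun l => omap f U (c l)) hw
  have h4 : (fun k' => omap f U ((Pi.single k 1 : Fin P.a → R) k')) ⬝ᵥ (fun l => omap f U (c l)) =
      omap f U (c k) := by
    simp [dotProduct, Pi.single_apply]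
  have h5 : (omat f P.α U *ᵥ fun l => omap f U (c l)) = fun j => omap f U ((P.α *ᵥ c) j) := by
    funext j
    simp [omat, mulVec, dotProduct]
  simp only [smul_dotProduct] at h3
  rw [h4, ← dotProduct_mulVec, h5, smul_eq_mul] at h3
  have h6 : h ^ N * omap f U (c k) ∈ (maximalIdeal R).map (omap f U) := by
    rw [h3]
    exact Ideal.sum_mem _ fun j _ => Ideal.mul_mem_left _ _ (Ideal.mem_map_of_mem _ (hc j))
  rcases hprime.mem_or_mem h6 with h7 | h7
  · exact (hη h).1 hηh (hprime.mem_of_pow_mem _ h7)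
  · exact hprime.ne_top (Ideal.eq_top_of_isUnit_mem _ h7 (hck.map _))

variable [Module.Finite R E] [Module.IsReflexive R E]

/-- Global sections are a quotient of the submodule `Q` of classes of vectors that represent them,
and `Q` is proper in a module of finite length. -/
theorem IsBlowUpCover.length_lt (h : IsBlowUpCover f x y T T') (hp : IsParams x y z)
    (hp' : IsParams y x z) (hx : x ≠ 0) (hy : y ≠ 0) {N : ℕ} (hN : maximalIdeal R ^ N ≤ P.ann)
    (hE : ¬ Module.Free R E) (hlen : Module.length R P.Coker < ⊤) :
    Module.length R (rsections f (sheafExt 1 (dual (pullbackTilde f E)) (structureModule X))) <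
      Module.length R P.Coker := by
  obtain ⟨D⟩ := nonempty_extOneData (dual (pullbackTilde f E)) (structureModule X)
  let S := sheafExt 1 (dual (pullbackTilde f E)) (structureModule X)
  let K := LinearMap.range P.αᵀ.mulVecLin
  let Q : Submodule R P.Coker := (sectionVectors P D).map K.mkQ
  have hQ : Q ≠ ⊤ := by
    intro htop
    refine h.chart.sectionVectors_ne_top P D hE h.affine hp hx ?_
    have h1 := congrArg (Submodule.comap K.mkQ) htop
    rw [Submodule.comap_map_mkQ, Submodule.comap_top, sup_eq_right.2 (range_le_sectionVectors P D)] at h1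
    exact h1
  have huniq : ∀ (v v' : Fin P.a → R) (s s' : Γ(S, ⊤)), K.mkQ v = K.mkQ v' →
      RelLoc f P.g P.α D ⊤ s (fun k => omap f ⊤ (v k)) →
      RelLoc f P.g P.α D ⊤ s' (fun k => omap f ⊤ (v' k)) → s = s' := by
    intro v v' s s' hvv hs hs'
    obtain ⟨w, hw⟩ : v - v' ∈ K := (Submodule.Quotient.eq _).1 hvv
    rw [← sub_eq_zero]
    refine h.eq_zero P D hp hp' hx hy hN _ ?_
    have h1 := (hs.add hs'.neg).add
      (relLoc_zero_vecMul (f := f) (g := P.g) (α := P.α) (T := D) (fun j => omap f ⊤ (w j))).neg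
    rw [neg_zero, add_zero, ← sub_eq_add_neg] at h1
    convert h1 using 1
    funext k
    have h2 := congrFun hw k
    rw [Pi.add_apply, Pi.add_apply, Pi.neg_apply, Pi.neg_apply, ← omap_vecMul]
    rw [mulVecLin_apply, Pi.sub_apply] at h2
    rw [h2, map_sub, Pi.zero_apply]
    ring
  have hex : ∀ q : Q, ∃ s : Γ(S, ⊤), ∃ v, K.mkQ v = q.1 ∧
      RelLoc f P.g P.α D ⊤ s (fun k => omap f ⊤ (v k)) := by
    rintro ⟨_, v, ⟨s, hs⟩, rfl⟩
    exact ⟨s, v, rfl, hs⟩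
  choose s v hv hs using hex
  -- The section attached to a class is chosen, and `huniq` shows that it depends only on the class;
  -- linearity follows.
  let φ : Q →ₗ[R] rsections f S :=
    { toFun := fun q => (toSec f S).symm (s q)
      map_add' := fun q q' => (toSec f S).injective (by
        rw [map_add, AddEquiv.apply_symm_apply, AddEquiv.apply_symm_apply, AddEquiv.apply_symm_apply]
        refine huniq _ (v q + v q') _ _ ?_ (hs _) ?_
        · rw [hv, map_add, hv, hv]; rfl
        · convert (hs q).add (hs q') using 1
          exact funext fun k => by simp)
      map_smul' := fun r q => (toSec f S).injective (by
        rw [RingHom.id_apply, toSec_smul, AddEquiv.apply_symm_apply, AddEquiv.apply_symm_apply]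
        refine huniq _ (r • v q) _ _ ?_ (hs _) ?_
        · rw [hv, map_smul, hv]; rfl
        · convert (hs q).smul (omap f ⊤ r) using 1
          exact funext fun k => by simp) }
  have hφ : Function.Surjective φ := by
    intro t
    obtain ⟨w, hw⟩ := h.exists_vector P D hp hp' hx hy (toSec f S t)
    refine ⟨⟨K.mkQ w, w, ⟨_, hw⟩, rfl⟩, (toSec f S).injective ?_⟩
    refine ((toSec f S).apply_symm_apply _).trans (huniq _ w _ _ ?_ (hs _) hw)
    rw [hv]
  obtain ⟨_, _⟩ := isFiniteLength_iff_isNoetherian_isArtinian.1 (Module.length_ne_top_iff.1 hlen.ne)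
  exact (Module.length_le_of_surjective φ hφ).trans_lt (Submodule.length_lt hQ)

end Length

end SupportAndLength

/-! ### Homogeneous localizations of the Rees algebra -/

section ReesAlgebraCharts

section ProjCharts

open HomogeneousLocalization

variable {S : Type u} [CommRing S] {σ : Type*} [SetLike σ S] [AddSubgroupClass σ S] (𝒜 : ℕ → σ)
  [GradedRing 𝒜]

theorem bijective_awayToSection {s : S} {m : ℕ} (hs : s ∈ 𝒜 m) (hm : 0 < m) :
    Function.Bijective (Proj.awayToSection 𝒜 s).hom := by
  have : IsIso (Proj.awayToSection 𝒜 s) := by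
    change IsIso (Proj.basicOpenIsoAway 𝒜 s hs hm).hom
    infer_instance
  exact ConcreteCategory.bijective_of_isIso (Proj.awayToSection 𝒜 s)

theorem basicOpen_awayToSection {s t : S} {m n : ℕ} (hs : s ∈ 𝒜 m) (hm : 0 < m) (ht : t ∈ 𝒜 n) (hn : 0 < n) :
    Proj.basicOpen 𝒜 s ⊓ Proj.basicOpen 𝒜 t =
      (Proj 𝒜).basicOpen ((Proj.awayToSection 𝒜 s).hom (Away.isLocalizationElem hs ht)) := by
  set U := Proj.basicOpen 𝒜 s
  have h1 : U.ι ⁻¹ᵁ Proj.basicOpen 𝒜 t =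
      U.ι ⁻¹ᵁ (Proj 𝒜).basicOpen ((Proj.awayToSection 𝒜 s).hom (Away.isLocalizationElem hs ht)) := by
    have h2 : U.ι = Proj.basicOpenToSpec 𝒜 s ≫ Proj.awayι 𝒜 s hs hm := by
      rw [← Proj.basicOpenIsoSpec_hom 𝒜 s hs hm, Proj.awayι, Iso.hom_inv_id_assoc]
    rw [← Scheme.Opens.toSpecΓ_preimage_basicOpen]
    conv_lhs => rw [h2]
    rw [Scheme.Hom.comp_preimage, Proj.awayι_preimage_basicOpen 𝒜 hs hm ht hn, Proj.basicOpenToSpec]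
    rfl
  have h3 := congrArg (fun V => U.ι ''ᵁ V) h1
  simp only [Scheme.Hom.image_preimage_eq_opensRange_inf, Scheme.Opens.opensRange_ι] at h3
  rw [h3]
  exact inf_eq_right.2 (Scheme.basicOpen_le _ _)

theorem omap_basicOpen {R : Type u} [CommRing R] (φ : R →+* 𝒜 0) {s : S} {m : ℕ} (hs : s ∈ 𝒜 m) (hm : 0 < m)
    (r : R) :
    omap (Proj.toSpecZero 𝒜 ≫ Spec.map (CommRingCat.ofHom φ)) (Proj.basicOpen 𝒜 s) r =
      (Proj.awayToSection 𝒜 s).hom (fromZeroRingHom 𝒜 _ (φ r)) := by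
  set U := Proj.basicOpen 𝒜 s
  have h2 : U.ι = Proj.basicOpenToSpec 𝒜 s ≫ Proj.awayι 𝒜 s hs hm := by
    rw [← Proj.basicOpenIsoSpec_hom 𝒜 s hs hm, Proj.awayι, Iso.hom_inv_id_assoc]
  have h1 : U.ι ≫ Proj.toSpecZero 𝒜 ≫ Spec.map (CommRingCat.ofHom φ) = U.toSpecΓ ≫ Spec.map (CommRingCat.ofHom φ ≫
      CommRingCat.ofHom (fromZeroRingHom 𝒜 _) ≫ Proj.awayToSection 𝒜 s) := by
    rw [h2, Category.assoc, Proj.awayι_toSpecZero_assoc, Proj.basicOpenToSpec, Category.assoc,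
      Spec.map_comp, Spec.map_comp, Category.assoc]
  generalize Proj.toSpecZero 𝒜 ≫ Spec.map (CommRingCat.ofHom φ) = f at *
  have h3 := congrArg Scheme.Hom.appTop h1
  rw [Scheme.Hom.comp_appTop, Scheme.Hom.comp_appTop, Scheme.Opens.toSpecΓ_appTop,
    Scheme.ΓSpecIso_naturality_assoc] at h3
  have h4 : (Scheme.ΓSpecIso (.of R)).inv ≫ f.appTop ≫ U.ι.appTop ≫ U.topIso.hom =
      CommRingCat.ofHom φ ≫ CommRingCat.ofHom (fromZeroRingHom 𝒜 _) ≫ Proj.awayToSection 𝒜 s := by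
    rw [← Category.assoc f.appTop, h3]
    simp only [Category.assoc, Iso.inv_hom_id, Category.comp_id, Iso.inv_hom_id_assoc]
  have h5 : U.ι.appTop ≫ U.topIso.hom = (Proj 𝒜).presheaf.map (homOfLE le_top).op := by
    simp only [Scheme.Opens.ι_appTop, Scheme.Opens.topIso]
    exact ((Proj 𝒜).presheaf.map_comp _ _).symm
  rw [h5] at h4
  exact congrArg (fun ψ => ψ.hom r) h4

end ProjCharts

section ReesCharts

open HomogeneousLocalization Polynomial

variable {R : Type u} [CommRing R] {I : Ideal R}

/-- The element `x t` of the Rees algebra. -/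
noncomputable def reesVar (x : R) (hx : x ∈ I) : reesAlgebra I :=
  ⟨monomial 1 x, reesAlgebra.monomial_mem.2 (by simpa using hx)⟩

theorem reesVar_mem (x : R) (hx : x ∈ I) : reesVar x hx ∈ reesGrading I 1 := ⟨x, rfl⟩

theorem reesVar_ne_zero {x : R} (hx : x ∈ I) (hx0 : x ≠ 0) : reesVar x hx ≠ 0 := by
  intro h
  have h1 := congrArg (fun p : reesAlgebra I => (p : R[X]).coeff 1) h
  simp [reesVar] at h1
  exact hx0 h1

/-- An element of `(x, y) ^ n` is a form of degree `n` in `x` and `y`, and dividing it by `x ^ n`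
gives a polynomial in `T = y / x`. -/
theorem exists_eval₂_of_mem_pow {A : Type*} [CommRing A] {x y : R} {ι : R →+* A} {T : A}
    (hrel : ι x * T = ι y) (hI : I = Ideal.span {x, y}) (n : ℕ) {r : R} (hr : r ∈ I ^ n) :
    ∃ P : R[X], ι x ^ n * P.eval₂ ι T = ι r := by
  induction n generalizing r with
  | zero => exact ⟨C r, by simp⟩
  | succ n ih =>
    rw [pow_succ'] at hr
    induction hr using Submodule.mul_induction_on' with
    | mem_mul_mem i hi j hj =>
      obtain ⟨P, hP⟩ := ih hj
      rw [hI] at hi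
      obtain ⟨c, d, rfl⟩ := Ideal.mem_span_pair.1 hi
      refine ⟨(C c + C d * X) * P, ?_⟩
      rw [eval₂_mul, eval₂_add, eval₂_mul, eval₂_C, eval₂_C, eval₂_X, map_mul, map_add, map_mul, map_mul,
        ← hP, ← hrel]
      ring
    | add r _ s _ h h' =>
      obtain ⟨P, hP⟩ := h
      obtain ⟨Q, hQ⟩ := h'
      exact ⟨P + Q, by rw [eval₂_add, mul_add, hP, hQ, map_add]⟩

/-- The homomorphism from `R` to the ring of functions on a chart of the blow-up. -/
noncomputable def toAway (s : reesAlgebra I) : R →+* Away (reesGrading I) s :=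
  (fromZeroRingHom (reesGrading I) _).comp (algebraMap R (reesGrading I 0))

theorem val_toAway (s : reesAlgebra I) (r : R) :
    (toAway s r).val = algebraMap (reesAlgebra I) (Localization (Submonoid.powers s))
      (algebraMap R (reesAlgebra I) r) := by
  rw [← Localization.mk_one_eq_algebraMap]
  rfl

/-- A degree-zero fraction has the form `r t ^ n / (x t) ^ n` with `r ∈ I ^ n`, so it is a
polynomial in `y / x`. The identities are verified in the localized Rees algebra, a domain in which
`x` is nonzero. -/
theorem isChart_away [IsDomain R] {x y : R} (hI : I = Ideal.span {x, y}) (hx0 : x ≠ 0)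
    (hx : x ∈ I) (hy : y ∈ I) :
    IsChart x y (toAway (reesVar x hx))
      (Away.isLocalizationElem (reesVar_mem x hx) (reesVar_mem y hy)) := by
  set s := reesVar x hx
  set t := reesVar y hy
  have hinj : Function.Injective (algebraMap (reesAlgebra I) (Localization (Submonoid.powers s))) :=
    IsLocalization.injective _ (powers_le_nonZeroDivisors_of_noZeroDivisors (reesVar_ne_zero hx hx0))
  have hdom : IsDomain (Localization (Submonoid.powers s)) :=
    IsLocalization.isDomain_localization
      (powers_le_nonZeroDivisors_of_noZeroDivisors (reesVar_ne_zero hx hx0))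
  set ψ := algebraMap (reesAlgebra I) (Localization (Submonoid.powers s)) with hψ
  have hs : ψ s ≠ 0 := fun h => reesVar_ne_zero hx hx0 (hinj (by rw [h, map_zero]))
  have hmk : ∀ (n : ℕ) (a : reesAlgebra I) (ha : a ∈ reesGrading I (n • 1)),
      ψ s ^ n * (Away.mk (reesGrading I) (reesVar_mem x hx) n a ha).val = ψ a := by
    intro n a ha
    rw [Away.val_mk, Localization.mk_eq_mk', ← map_pow]
    exact IsLocalization.mk'_spec' (Localization (Submonoid.powers s)) a
      (⟨s ^ n, n, rfl⟩ : Submonoid.powers s)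
  have hrel : toAway s x * Away.isLocalizationElem (reesVar_mem x hx) (reesVar_mem y hy) =
      toAway s y := by
    refine val_injective _ (mul_left_cancel₀ hs ?_)
    have h1 := hmk 1 (t ^ 1) (by simpa using! reesVar_mem y hy)
    rw [pow_one] at h1
    rw [val_mul, mul_left_comm, val_toAway, val_toAway, ← hψ]
    refine (congrArg _ h1).trans ?_
    rw [pow_one, ← map_mul, ← map_mul]
    refine congrArg ψ (Subtype.ext ?_)
    change C x * monomial 1 y = monomial 1 x * C y
    rw [C_mul_monomial, monomial_mul_C]
  refine ⟨fun r r' h => ?_, hrel, fun c => ?_⟩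
  · have h1 := congrArg HomogeneousLocalization.val h
    rw [val_toAway, val_toAway] at h1
    have h2 : C r = C r' := congrArg Subtype.val (hinj h1)
    exact C_injective h2
  · obtain ⟨n, a, ha, rfl⟩ := Away.mk_surjective (reesGrading I) (reesVar_mem x hx) c
    have ha1 := (mem_reesGrading I _ a).1 ha
    rw [smul_eq_mul, mul_one] at ha1
    obtain ⟨P, hP⟩ := exists_eval₂_of_mem_pow hrel hI n (a.2 n)
    refine ⟨P, ?_⟩
    have h1 : toAway s x ^ n * Away.mk (reesGrading I) (reesVar_mem x hx) n a ha =
        toAway s ((a : R[X]).coeff n) := by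
      refine val_injective _ (mul_left_cancel₀ (pow_ne_zero n hs) ?_)
      rw [val_mul, mul_left_comm, hmk, val_pow, val_toAway, val_toAway, ← hψ, ← map_pow, ← map_pow,
        ← map_pow, ← map_mul, ← map_mul]
      refine congrArg ψ (Subtype.ext ?_)
      change C (x ^ n) * (a : R[X]) = monomial 1 x ^ n * C ((a : R[X]).coeff n)
      rw [← ha1, monomial_pow, one_mul, monomial_mul_C, C_mul_monomial, coeff_monomial, if_pos rfl]
    have h2 : (toAway s x).val ≠ 0 := by
      rw [val_toAway]
      intro h
      have h3 : C x = 0 := congrArg Subtype.val (hinj (h.trans (map_zero ψ).symm))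
      exact hx0 (C_eq_zero.1 h3)
    have h3 := congrArg HomogeneousLocalization.val (hP.trans h1.symm)
    rw [val_mul, val_mul, val_pow] at h3
    exact val_injective _ (mul_left_cancel₀ (pow_ne_zero n h2) h3)

theorem IsChart.map {A B : Type*} [CommRing A] [CommRing B] {x y : R} {ι : R →+* A} {T : A}
    (h : IsChart x y ι T) (σ : A →+* B) (hσ : Function.Bijective σ) {ι' : R →+* B}
    (hι : ∀ r, ι' r = σ (ι r)) : IsChart x y ι' (σ T) where
  inj r r' hr := h.inj (hσ.1 (by rw [← hι, ← hι, hr]))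
  rel := by rw [hι, hι, ← map_mul, h.rel]
  gen c := by
    obtain ⟨a, rfl⟩ := hσ.2 c
    obtain ⟨P, rfl⟩ := h.gen a
    obtain rfl : ι' = σ.comp ι := RingHom.ext hι
    exact ⟨P, (Polynomial.hom_eval₂ _ _ _ _).symm⟩

/-- The irrelevant ideal is generated by `x t` and `y t`, so no point of `Proj` contains both. -/
theorem iSup_basicOpen_reesVar {x y : R} (hI : I = Ideal.span {x, y}) (hx : x ∈ I) (hy : y ∈ I) :
    Proj.basicOpen (reesGrading I) (reesVar x hx) ⊔ Proj.basicOpen (reesGrading I) (reesVar y hy) = ⊤ := by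
  have key : ∀ (n : ℕ) (r : R) (hr : r ∈ I ^ (n + 1)),
      (⟨monomial (n + 1) r, reesAlgebra.monomial_mem.2 hr⟩ : reesAlgebra I) ∈
        Ideal.span {reesVar x hx, reesVar y hy} := by
    intro n r hr
    rw [pow_succ'] at hr
    induction hr using Submodule.mul_induction_on' with
    | mem_mul_mem i hi j hj =>
      rw [hI] at hi
      obtain ⟨c, d, rfl⟩ := Ideal.mem_span_pair.1 hi
      refine Ideal.mem_span_pair.2 ⟨⟨monomial n (c * j), reesAlgebra.monomial_mem.2
        (Ideal.mul_mem_left _ _ hj)⟩, ⟨monomial n (d * j), reesAlgebra.monomial_mem.2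
        (Ideal.mul_mem_left _ _ hj)⟩, Subtype.ext ?_⟩
      change monomial n (c * j) * monomial 1 x + monomial n (d * j) * monomial 1 y = _
      rw [monomial_mul_monomial, monomial_mul_monomial, ← map_add]
      congr 1
      ring
    | add r hr' s hs h h' =>
      rw [← pow_succ'] at hr' hs
      have h1 : (⟨monomial (n + 1) (r + s), reesAlgebra.monomial_mem.2 hr⟩ : reesAlgebra I) =
          ⟨monomial (n + 1) r, reesAlgebra.monomial_mem.2 hr'⟩ +
            ⟨monomial (n + 1) s, reesAlgebra.monomial_mem.2 hs⟩ :=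
        Subtype.ext (map_add _ _ _)
      rw [h1]
      exact add_mem (h hr') (h' hs)
  rw [eq_top_iff]
  intro p _
  by_contra hp
  have h1 : reesVar x hx ∈ p.asHomogeneousIdeal := by
    by_contra h; exact hp (Or.inl h)
  have h2 : reesVar y hy ∈ p.asHomogeneousIdeal := by
    by_contra h; exact hp (Or.inr h)
  have h3 : Ideal.span {reesVar x hx, reesVar y hy} ≤ p.asHomogeneousIdeal.toIdeal := by
    rw [Ideal.span_le]
    rintro _ (rfl | rfl)
    · exact h1
    · exact h2
  refine p.not_irrelevant_le ?_
  change (HomogeneousIdeal.irrelevant (reesGrading I)).toIdeal ≤ _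
  rw [HomogeneousIdeal.irrelevant_eq_span, Ideal.span_le]
  refine Set.iUnion₂_subset fun i hi a ha => h3 ?_
  obtain ⟨n, rfl⟩ := Nat.exists_eq_add_of_lt hi
  have h4 := key (0 + n) _ (a.2 (0 + n + 1))
  have h5 : (⟨monomial (0 + n + 1) ((a : R[X]).coeff (0 + n + 1)),
      reesAlgebra.monomial_mem.2 (a.2 _)⟩ : reesAlgebra I) = a :=
    Subtype.ext ((mem_reesGrading I _ a).1 ha)
  rwa [h5] at h4

end ReesCharts

end ReesAlgebraCharts

/-! ### The standard charts of the blow-up -/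

section BlowUpCharts

open HomogeneousLocalization IsLocalRing

/-- The relations `x T = y` and `y T' = x` give `x (T T' - 1) = 0`, and `x` is a nonzerodivisor on
every open subset of `U`. -/
theorem ores_mul_ores_eq_one {X : Scheme.{u}} {R : Type u} [CommRing R] [IsLocalRing R]
    {f : X ⟶ Spec (.of R)} {x y z : R} {U U' : X.Opens} {T : Γ(X, U)} {T' : Γ(X, U')}
    (hU : IsAffineOpen U) (hA : IsChart x y (omap f U) T) (hA' : IsChart y x (omap f U') T')
    (hp : IsParams x y z) (hx : x ≠ 0) (W : X.Opens) (h : W ≤ U) (h' : W ≤ U') :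
    ores h T * ores h' T' = 1 := by
  have hreg := regularOn_of_regPair hU (hA.regPair hp hx)
  have h1 := congrArg (ores h) hA.rel
  have h2 := congrArg (ores h') hA'.rel
  rw [map_mul, ores_omap, ores_omap] at h1 h2
  refine sub_eq_zero.1 (hreg.left W h _ ?_)
  linear_combination ores h' T' * h1 + h2

/-- The chart of the blow-up where `x` generates the exceptional divisor. -/
noncomputable def chartOpen {R : Type u} [CommRing R] {I : Ideal R} {x : R} (hx : x ∈ I) :
    (blowUp I).Opens :=
  Proj.basicOpen (reesGrading I) (reesVar x hx)

/-- The regular function `y / x` on a chart of the blow-up. -/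
noncomputable def chartCoordinate {R : Type u} [CommRing R] {I : Ideal R} {x y : R} (hx : x ∈ I) (hy : y ∈ I) :
    Γ(blowUp I, chartOpen hx) :=
  (Proj.awayToSection (reesGrading I) (reesVar x hx)).hom
    (Away.isLocalizationElem (reesVar_mem x hx) (reesVar_mem y hy))

theorem isAffineOpen_chartOpen {R : Type u} [CommRing R] {I : Ideal R} {x : R} (hx : x ∈ I) :
    IsAffineOpen (chartOpen hx) :=
  Proj.isAffineOpen_basicOpen (reesGrading I) _ (reesVar_mem x hx) Nat.one_pos

theorem isChart_blowUp {R : Type u} [CommRing R] [IsDomain R] {I : Ideal R} {x y : R}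
    (hI : I = Ideal.span {x, y}) (hx0 : x ≠ 0) (hx : x ∈ I) (hy : y ∈ I) :
    IsChart x y (omap (blowUpMap I) (chartOpen hx)) (chartCoordinate hx hy) :=
  (isChart_away hI hx0 hx hy).map _
    (bijective_awayToSection (reesGrading I) (reesVar_mem x hx) Nat.one_pos)
    fun r => omap_basicOpen (reesGrading I) _ (reesVar_mem x hx) Nat.one_pos r

theorem chartOpen_inf {R : Type u} [CommRing R] {I : Ideal R} {x y : R} (hx : x ∈ I) (hy : y ∈ I) :
    chartOpen hx ⊓ chartOpen hy = (blowUp I).basicOpen (chartCoordinate hx hy) :=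
  basicOpen_awayToSection (reesGrading I) (reesVar_mem x hx) Nat.one_pos (reesVar_mem y hy) Nat.one_pos

theorem isBlowUpCover {R : Type u} [CommRing R] [IsLocalRing R] {I : Ideal R} {x y z : R}
    (hI : I = Ideal.span {x, y}) (hp : IsParams x y z) (hx0 : x ≠ 0) (hy0 : y ≠ 0)
    (hx : x ∈ I) (hy : y ∈ I) :
    IsBlowUpCover (blowUpMap I) x y (chartCoordinate hx hy) (chartCoordinate hy hx) := by
  have := hp.isDomain
  have hc := isChart_blowUp hI hx0 hx hy
  have hc' := isChart_blowUp (hI.trans (by rw [Set.pair_comm])) hy0 hy hx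
  exact ⟨isAffineOpen_chartOpen hx, isAffineOpen_chartOpen hy, iSup_basicOpen_reesVar hI hx hy, hc, hc',
    chartOpen_inf hx hy, (inf_comm _ _).trans (chartOpen_inf hy hx),
    ores_mul_ores_eq_one (isAffineOpen_chartOpen hx) hc hc' hp hx0⟩

end BlowUpCharts

end BlowUpExt

theorem mainTheorem7 {R : Type u} [CommRing R] [IsRegularLocalRing R] (hR : ringKrullDim R = 3)
    (E : Type u) [AddCommGroup E] [Module R E] [Module.Finite R E] [Module.IsReflexive R E]
    (hE : ¬ Module.Free R E)
    (I : Ideal R) [IsRegularLocalRing (R ⧸ I)] (hI : ringKrullDim (R ⧸ I) = 1) :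
    BlowUpExt.SupportedAtClosedPoints (BlowUpExt.blowUpExt I E) ∧
      BlowUpExt.sectionsLength (BlowUpExt.blowUpMap I) (BlowUpExt.blowUpExt I E) <
        Module.length R (Abelian.Ext (ModuleCat.of R (Module.Dual R E)) (ModuleCat.of R R) 1) ∧
      Module.length R (Abelian.Ext (ModuleCat.of R (Module.Dual R E)) (ModuleCat.of R R) 1) < ⊤ := by
  obtain ⟨x, y, z, hxy, hm⟩ := BlowUpExt.exists_params hR I hI
  have hp := BlowUpExt.isParams_of_span_eq hR.ge hm
  -- The second chart is the first with `x` and `y` exchanged, so the parameters are needed in both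
  -- orders.
  have hp' : BlowUpExt.IsParams y x z :=
    BlowUpExt.isParams_of_span_eq hR.ge (hm.trans (by rw [Set.insert_comm]))
  have hx0 : x ≠ 0 := fun h => hp'.y_notMem (h ▸ zero_mem _)
  have hy0 : y ≠ 0 := fun h => hp.y_notMem (h ▸ zero_mem _)
  have := hp.isDomain
  have hcover := BlowUpExt.isBlowUpCover hxy hp hx0 hy0 (hxy ▸ Ideal.subset_span (by simp))
    (hxy ▸ Ideal.subset_span (by simp))
  obtain ⟨P⟩ := BlowUpExt.nonempty_dualPresentation hp hx0 E
  obtain ⟨N, hN⟩ := P.exists_pow_mem_ann hR.le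
  have hlen := P.length_coker_lt_top hE hR.le
  rw [P.length_ext_eq]
  exact ⟨hcover.supportedAtClosedPoints hp hp' hx0 hy0 hN,
    hcover.length_lt P hp hp' hx0 hy0 hN hE hlen, hlen⟩
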